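/- **Theorem.** Let $\Bbbk$ be a field. Coloured operads are symmetric, unital, and coloured by $\mathbb N=\{1,2,\dots\}$; they are given by partial compositions $\circ_i$ and right actions of the symmetric groups. *Operadic trees.* For $n_1,\dots,n_k\ge 1$, let ${\tt Tree}(n_1,\dots,n_k;n)$ be the set of isomorphism classes of pairs $(\mathcal T,\sigma)$ of a planar rooted tree $\mathcal T$ with $n$ input leaves and $k$ vertices and a bijection $\sigma:[k]\to v(\mathcal T)$ such that $\sigma(i)$ has $n_i$ inputs. The tree is *left-recursive* if $\sigma$ enumerates the vertices in the order: root vertex first, then the subtrees on its inputs from left to right, recursively. $(\mathcal T_1\bullet_i\mathcal T_2,\sigma_1\bullet_i\sigma_2)$ is obtained by substituting $\mathcal T_2$ for the vertex $\sigma_1(i)$ of $\mathcal T_1$, the indices being shifted in the usual way. *Constructs.* The edge-graph ${\bf H}_{\mathcal T}$ has as vertices the internal edges of $\mathcal T$, two of them being joined if they share a vertex of $\mathcal T$. A construct of a connected (hyper)graph ${\bf H}$ with vertex set $H$ is a non-planar rooted tree $Y\{C_1,\dots,C_p\}$ with root decorated by some $\emptyset\ne Y\subseteq H$, where $C_1,\dots,C_p$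 are constructs of the connected components of ${\bf H}\setminus Y$ (so $p=0$ if $Y=H$; this is the maximal construct). *The operad $\mathcal O_\infty$.* For $k\ge2$, $\mathcal O_\infty(n_1,\dots,n_k;n)$ is the vector space with basis the isomorphism classes of triples $(\mathcal T,\sigma,C)$ with $(\mathcal T,\sigma)\in{\tt Tree}(n_1,\dots,n_k;n)$ and $C$ a construct of ${\bf H}_{\mathcal T}$; $\mathcal O_\infty(n;n)$ is spanned by the identity (the corolla with $n$ inputs), and $\mathcal O_\infty(m;n)=0$ for $m\neq n$. One puts $(\mathcal T,\sigma,C)^\kappa=(\mathcal T,\sigma\circ\kappa,C)$ and $(\mathcal T_1,\sigma_1,C_1)\circ_i(\mathcal T_2,\sigma_2,C_2)=(\mathcal T_1\bullet_i\mathcal T_2,\sigma_1\bullet_i\sigma_2,C_1\bullet_iC_2)$. Here, for $C_1=X\{C_{11},\dots,C_{1p}\}$, if some component of ${\bf H}_{\mathcal T_1}\setminus X$ corresponds to a subtree of $\mathcal T_1$ containing the vertex $\sigma_1(i)$, then $C_1\bullet_iC_2$ is obtained by replacing the corresponding $C_{1j}$ by its composite with $C_2$ at that vertex (recursively); otherwise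 $C_1\bullet_iC_2=X\{C_{11},\dots,C_{1p},C_2\}$. *Decorated trees.* Let $\mathcal F(n_1,\dots,n_k;n)$ be the vector space with basis the planar rooted trees with $\mathbb N$-coloured edges and root of colour $n$, with leaves labelled bijectively by $1,\dots,k$, the leaf labelled $i$ having colour $n_i$, and with each vertex decorated by a left-recursive operadic tree in some ${\tt Tree}(a_1,\dots,a_m;a)$, $m\ge2$, where $a_1,\dots,a_m$ and $a$ are the colours of the inputs and of the output of that vertex. Composition is grafting, the unit is the tree without vertices, and the symmetric groups permute the labels of the leaves. Let $K$ be the symmetric collection with $K(n_1,\dots,n_k;n)=\bigoplus_{{\tt Tree}(n_1,\dots,n_k;n)}\Bbbk$ for $k\ge2$ and $K(m;n)=0$ for $k=1$; it is freely generated, as a symmetric collection, by the left-recursive operadic trees. Let $\iota:K\to\mathcal O_\infty$ send $(\mathcal T,\sigma)$ to $(\mathcal T,\sigma,C)$ with $C$ the maximal construct of ${\bf H}_{\mathcal T}$. 1. $\mathcal O_\infty$, with $\iota$, is the free $\mathbb N$-coloured operad $\mathcal T_{\mathbb N}(K)$ of vector spaces on $K$. 2. There is an isomorphism of coloured operads $\alpha:\mathcal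 O_\infty\to\mathcal F$ which restricts to a bijection between triples $(\mathcal T,\sigma,C)$ (and identities) and decorated trees, and which sends a left-recursive operadic tree $\mathcal T$ with its maximal construct to the one-vertex tree decorated by $\mathcal T$ with leaves labelled from left to right. In particular $\mathcal F$, with $\alpha\circ\iota$, is also the free operad on $K$. 3. Grade $\mathcal O_\infty$ by $|(\mathcal T,\sigma,C)|=k-1-|v(C)|$ (identities having degree $0$) and multiply the composite $x\circ_iy$ of basis elements by $(-1)^{\varepsilon}$, where $\varepsilon$ is the number of edges and leaves of the tree $\alpha(x)$ that are strictly to the right of the path from the leaf $i$ to the root, times the number of all edges and leaves of $\alpha(y)$ other than the root. With these signs, $\mathcal O_\infty$, with $\iota$, is the free $\mathbb N$-coloured graded operad on $K$, where an operadic tree with $k$ vertices has degree $k-2$. -/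

import Mathlib

/-! # The combinatorial operad `O_∞` and the operad of decorated planar trees -/

universe u v w

namespace OInfty

/-! ## Coloured symmetric operads in vector spaces -/

section Operads

/-- If an operation with `l` inputs is plugged into the `i`-th input of an operation with `k`
inputs, the input `j ≠ i` of the latter becomes input number `j` (if `j < i`) or `j + l - 1`
(if `j > i`) of the result, which has `r = k + l - 1` inputs (everything is counted from `0`). -/
def outerPos {k l r : ℕ} (h : r + 1 = k + l) (i j : Fin k) (hj : j ≠ i) : Fin r :=
  if hlt : j < i then ⟨j, by have := i.2; have : (j : ℕ) < i := hlt; omega⟩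
  else ⟨j + l - 1, by
    have := j.2
    have : (i : ℕ) < j := lt_of_le_of_ne (not_lt.mp hlt) (fun e => hj (Fin.ext e.symm))
    omega⟩

/-- In the same situation, input `j` of the operation that is plugged in becomes input number
`i + j` of the result. -/
def innerPos {k l r : ℕ} (h : r + 1 = k + l) (i : Fin k) (j : Fin l) : Fin r :=
  ⟨i + j, by have := i.2; have := j.2; omega⟩

/-- `a = (c_1, …, c_{i-1}, b_1, …, b_l, c_{i+1}, …, c_k)`.  The list `a` is determined by `c`, `i`
and `b`; using a predicate avoids transports along equalities of lists of colours. -/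
structure Ins {C : Type} {k l r : ℕ} (c : Fin k → C) (i : Fin k) (b : Fin l → C)
    (a : Fin r → C) : Prop where
  card : r + 1 = k + l
  outer : ∀ (j : Fin k) (hj : j ≠ i), a (outerPos card i j hj) = c j
  inner : ∀ j : Fin l, a (innerPos card i j) = b j

/-- The underlying data of a symmetric `C`-coloured collection of vector spaces: the spaces
`Op (c_1, …, c_k) d` and the right action `x ↦ x ^ κ` of the symmetric groups. -/
structure Collection (𝕜 : Type u) [Field 𝕜] (C : Type) where
  Op : ∀ {k : ℕ}, (Fin k → C) → C → Type v
  [acg : ∀ {k : ℕ} (c : Fin k → C) (d : C), AddCommGroup (Op c d)]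
  [mod : ∀ {k : ℕ} (c : Fin k → C) (d : C), Module 𝕜 (Op c d)]
  act : ∀ {k : ℕ} {c : Fin k → C} {d : C} (κ : Equiv.Perm (Fin k)), Op c d →ₗ[𝕜] Op (c ∘ κ) d

attribute [instance] Collection.acg Collection.mod

/-- The data of a `C`-coloured operad of vector spaces: a collection with units and bilinear
partial compositions `x ∘_i y`, defined when the output colour `e` of `y` is the `i`-th input
colour of `x`. -/
structure OperadData (𝕜 : Type u) [Field 𝕜] (C : Type) extends Collection.{u, v} 𝕜 C where
  one : ∀ n : C, Op (fun _ : Fin 1 => n) n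
  comp : ∀ {k l r : ℕ} {c : Fin k → C} {b : Fin l → C} {a : Fin r → C} {d e : C} (i : Fin k),
    c i = e → Ins c i b a → Op c d →ₗ[𝕜] Op b e →ₗ[𝕜] Op a d

variable {𝕜 : Type u} [Field 𝕜] {C : Type}

/-- `μ` is the permutation `κ ∘_i lam` of the inputs of a composite along the `i`-th input that is
induced by permutations `κ` and `lam` of the inputs of the two factors. -/
def IsBlockPerm {k l r : ℕ} (h : r + 1 = k + l) (i : Fin k) (κ : Equiv.Perm (Fin k))
    (lam : Equiv.Perm (Fin l)) (μ : Equiv.Perm (Fin r)) : Prop :=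
  (∀ (j : Fin k) (hj : j ≠ i),
    μ (outerPos h i j hj) = outerPos h (κ i) (κ j) (fun e => hj (κ.injective e))) ∧
  ∀ j : Fin l, μ (innerPos h i j) = innerPos h (κ i) (lam j)

/-- The axioms of a coloured operad, apart from the one on parallel compositions. -/
structure OperadData.Laws (O : OperadData.{u, v} 𝕜 C) : Prop where
  act_one : ∀ {k : ℕ} {c : Fin k → C} {d : C} (x : O.Op c d), O.act (c := c) 1 x = x
  act_mul : ∀ {k : ℕ} {c : Fin k → C} {d : C} (κ lam : Equiv.Perm (Fin k)) (x : O.Op c d),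
    O.act lam (O.act κ x) = O.act (κ * lam) x
  one_comp : ∀ {l : ℕ} {b : Fin l → C} {e : C} (h : Ins (fun _ : Fin 1 => e) 0 b b)
    (y : O.Op b e), O.comp 0 rfl h (O.one e) y = y
  comp_one : ∀ {k : ℕ} {c : Fin k → C} {d e : C} (i : Fin k) (he : c i = e)
    (h : Ins c i (fun _ : Fin 1 => e) c) (x : O.Op c d), O.comp i he h x (O.one e) = x
  assoc : ∀ {k l m r s t : ℕ} {c : Fin k → C} {b : Fin l → C} {b₁ : Fin m → C} {a : Fin r → C}
    {a₁ : Fin s → C} {a₂ : Fin t → C} {d e e₁ : C} (i : Fin k) (j : Fin l) (hi : c i = e)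
    (hj : b j = e₁) (hcb : Ins c i b a) (hj₁ : a (innerPos hcb.card i j) = e₁)
    (h₁ : Ins a (innerPos hcb.card i j) b₁ a₂) (h₂ : Ins b j b₁ a₁) (h₃ : Ins c i a₁ a₂)
    (x : O.Op c d) (y : O.Op b e) (z : O.Op b₁ e₁),
    O.comp _ hj₁ h₁ (O.comp i hi hcb x y) z = O.comp i hi h₃ x (O.comp j hj h₂ y z)
  equivariant : ∀ {k l r : ℕ} {c : Fin k → C} {b : Fin l → C} {a : Fin r → C} {d e : C}
    (i : Fin k) (κ : Equiv.Perm (Fin k)) (lam : Equiv.Perm (Fin l)) (μ : Equiv.Perm (Fin r))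
    (he : c (κ i) = e) (h : Ins c (κ i) b a) (h₁ : Ins (c ∘ κ) i (b ∘ lam) (a ∘ μ)),
    IsBlockPerm h.card i κ lam μ → ∀ (x : O.Op c d) (y : O.Op b e),
    O.comp i he h₁ (O.act κ x) (O.act lam y) = O.act μ (O.comp (κ i) he h x y)

/-- `C`-coloured operads of vector spaces. -/
structure OperadData.IsOperad (O : OperadData.{u, v} 𝕜 C) : Prop extends O.Laws where
  parallel : ∀ {k l m r s t : ℕ} {c : Fin k → C} {b : Fin l → C} {b₁ : Fin m → C} {a : Fin r → C}
    {a₁ : Fin s → C} {a₂ : Fin t → C} {d e e₁ : C} (i j : Fin k) (hij : j ≠ i) (hi : c i = e)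
    (hj : c j = e₁) (h : Ins c i b a) (h₁ : Ins c j b₁ a₁)
    (hj₂ : a (outerPos h.card i j hij) = e₁) (hi₂ : a₁ (outerPos h₁.card j i hij.symm) = e)
    (h₂ : Ins a (outerPos h.card i j hij) b₁ a₂) (h₃ : Ins a₁ (outerPos h₁.card j i hij.symm) b a₂)
    (x : O.Op c d) (y : O.Op b e) (z : O.Op b₁ e₁),
    O.comp _ hj₂ h₂ (O.comp i hi h x y) z = O.comp _ hi₂ h₃ (O.comp j hj h₁ x z) y

/-- A family of subspaces of the spaces of operations, indexed by degrees. -/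
abbrev Collection.Grading (O : Collection.{u, v} 𝕜 C) : Type v :=
  ∀ (k : ℕ) (c : Fin k → C) (d : C), ℤ → Submodule 𝕜 (O.Op c d)

/-- `C`-coloured operads of graded vector spaces: the spaces of operations are the direct sums of
their homogeneous parts, the structure maps preserve degrees, and interchanging `y` and `z`
in a parallel composition gives the Koszul sign. -/
structure OperadData.IsGradedOperad (O : OperadData.{u, v} 𝕜 C) (gr : O.Grading) : Prop
    extends O.Laws where
  internal : ∀ {k : ℕ} (c : Fin k → C) (d : C), DirectSum.IsInternal (gr k c d)
  one_mem : ∀ n : C, O.one n ∈ gr _ (fun _ : Fin 1 => n) n 0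
  act_mem : ∀ {k : ℕ} {c : Fin k → C} {d : C} (κ : Equiv.Perm (Fin k)) (p : ℤ) (x : O.Op c d),
    x ∈ gr _ c d p → O.act κ x ∈ gr _ (c ∘ κ) d p
  comp_mem : ∀ {k l r : ℕ} {c : Fin k → C} {b : Fin l → C} {a : Fin r → C} {d e : C} (i : Fin k)
    (he : c i = e) (h : Ins c i b a) (p q : ℤ) (x : O.Op c d) (y : O.Op b e),
    x ∈ gr _ c d p → y ∈ gr _ b e q → O.comp i he h x y ∈ gr _ a d (p + q)
  parallel : ∀ {k l m r s t : ℕ} {c : Fin k → C} {b : Fin l → C} {b₁ : Fin m → C} {a : Fin r → C}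
    {a₁ : Fin s → C} {a₂ : Fin t → C} {d e e₁ : C} (i j : Fin k) (hij : j ≠ i) (hi : c i = e)
    (hj : c j = e₁) (h : Ins c i b a) (h₁ : Ins c j b₁ a₁)
    (hj₂ : a (outerPos h.card i j hij) = e₁) (hi₂ : a₁ (outerPos h₁.card j i hij.symm) = e)
    (h₂ : Ins a (outerPos h.card i j hij) b₁ a₂) (h₃ : Ins a₁ (outerPos h₁.card j i hij.symm) b a₂)
    (p q : ℤ) (x : O.Op c d) (y : O.Op b e) (z : O.Op b₁ e₁), y ∈ gr _ b e p → z ∈ gr _ b₁ e₁ q →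
    O.comp _ hj₂ h₂ (O.comp i hi h x y) z =
      ((-1 : 𝕜) ^ (p * q)) • O.comp _ hi₂ h₃ (O.comp j hj h₁ x z) y

/-- Families of linear maps between the spaces of operations. -/
abbrev LinFamily (K : Collection.{u, v} 𝕜 C) (L : Collection.{u, w} 𝕜 C) : Type (max v w) :=
  ∀ (k : ℕ) (c : Fin k → C) (d : C), K.Op c d →ₗ[𝕜] L.Op c d

/-- Maps of symmetric collections. -/
def IsEquivariant (K : Collection.{u, v} 𝕜 C) (L : Collection.{u, w} 𝕜 C)
    (φ : LinFamily K L) : Prop :=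
  ∀ {k : ℕ} (c : Fin k → C) (d : C) (κ : Equiv.Perm (Fin k)) (x : K.Op c d),
    φ k (c ∘ κ) d (K.act κ x) = L.act κ (φ k c d x)

/-- Morphisms of coloured operads. -/
structure IsOperadHom (O : OperadData.{u, v} 𝕜 C) (P : OperadData.{u, w} 𝕜 C)
    (F : LinFamily O.toCollection P.toCollection) : Prop where
  equivariant : IsEquivariant O.toCollection P.toCollection F
  map_one : ∀ n : C, F 1 (fun _ : Fin 1 => n) n (O.one n) = P.one n
  map_comp : ∀ {k l r : ℕ} {c : Fin k → C} {b : Fin l → C} {a : Fin r → C} {d e : C} (i : Fin k)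
    (he : c i = e) (h : Ins c i b a) (x : O.Op c d) (y : O.Op b e),
    F r a d (O.comp i he h x y) = P.comp i he h (F k c d x) (F l b e y)

/-- `O`, with `ι : K → O`, is the free coloured operad on the symmetric collection `K`. -/
def IsFreeOperadOn (O : OperadData.{u, v} 𝕜 C) (K : Collection.{u, v} 𝕜 C)
    (ι : LinFamily K O.toCollection) : Prop :=
  O.IsOperad ∧ IsEquivariant K O.toCollection ι ∧
  ∀ P : OperadData.{u, w} 𝕜 C, P.IsOperad →
  ∀ φ : LinFamily K P.toCollection, IsEquivariant K P.toCollection φ →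
    ∃! F : LinFamily O.toCollection P.toCollection, IsOperadHom O P F ∧
      ∀ {k : ℕ} (c : Fin k → C) (d : C) (x : K.Op c d), F k c d (ι k c d x) = φ k c d x

/-- A family of linear maps preserves degrees. -/
def PreservesDegree (K : Collection.{u, v} 𝕜 C) (L : Collection.{u, w} 𝕜 C)
    (grK : K.Grading) (grL : L.Grading) (φ : LinFamily K L) : Prop :=
  ∀ {k : ℕ} (c : Fin k → C) (d : C) (p : ℤ) (x : K.Op c d), x ∈ grK _ c d p → φ k c d x ∈ grL _ c d p

/-- `O`, with `ι : K → O`, is the free coloured graded operad on the graded symmetric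
collection `K`. -/
def IsFreeGradedOperadOn (O : OperadData.{u, v} 𝕜 C) (grO : O.Grading)
    (K : Collection.{u, v} 𝕜 C) (grK : K.Grading) (ι : LinFamily K O.toCollection) : Prop :=
  O.IsGradedOperad grO ∧ IsEquivariant K O.toCollection ι ∧
  PreservesDegree K O.toCollection grK grO ι ∧
  ∀ (P : OperadData.{u, w} 𝕜 C) (grP : P.Grading), P.IsGradedOperad grP →
  ∀ φ : LinFamily K P.toCollection, IsEquivariant K P.toCollection φ →
    PreservesDegree K P.toCollection grK grP φ →
    ∃! F : LinFamily O.toCollection P.toCollection, IsOperadHom O P F ∧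
      PreservesDegree O.toCollection P.toCollection grO grP F ∧
      ∀ {k : ℕ} (c : Fin k → C) (d : C) (x : K.Op c d), F k c d (ι k c d x) = φ k c d x

end Operads

/-! ## Positions -/

section Positions

variable {k l r : ℕ}

theorem pos_cases (h : r + 1 = k + l) (i : Fin k) (p : Fin r) :
    (∃ j hj, p = outerPos h i j hj) ∨ ∃ j, p = innerPos h i j := by
  have hp := p.2
  have hi := i.2
  by_cases h1 : (p : ℕ) < i
  · refine Or.inl ⟨⟨p, by omega⟩, fun e => ?_, ?_⟩
    · rw [← e] at h1; exact lt_irrefl _ h1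
    · unfold outerPos; rw [dif_pos (show (⟨p, _⟩ : Fin k) < i from h1)]
  · by_cases h2 : (p : ℕ) < i + l
    · exact Or.inr ⟨⟨p - i, by omega⟩, Fin.ext (by simp only [innerPos]; omega)⟩
    · refine Or.inl ⟨⟨p + 1 - l, by omega⟩, fun e => ?_, ?_⟩
      · have := congrArg Fin.val e; simp only at this; omega
      · unfold outerPos
        rw [dif_neg (fun hh : (⟨p + 1 - l, _⟩ : Fin k) < i => by
          have : p + 1 - l < (i : ℕ) := hh
          omega)]
        exact Fin.ext (by simp only; omega)

theorem outerPos_val (h : r + 1 = k + l) (i j : Fin k) (hj : j ≠ i) :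
    (outerPos h i j hj : ℕ) = if j < i then (j : ℕ) else j + l - 1 := by
  unfold outerPos; split <;> rfl

theorem outerPos_inj (h : r + 1 = k + l) (i j j₁ : Fin k) (hj : j ≠ i) (hj₁ : j₁ ≠ i)
    (e : outerPos h i j hj = outerPos h i j₁ hj₁) : j = j₁ := by
  have e1 := congrArg Fin.val e
  rw [outerPos_val, outerPos_val] at e1
  have a1 : (j : ℕ) ≠ i := fun q => hj (Fin.ext q)
  have a2 : (j₁ : ℕ) ≠ i := fun q => hj₁ (Fin.ext q)
  apply Fin.ext
  simp only [Fin.lt_def] at e1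
  have := j.2
  have := j₁.2
  have := i.2
  split at e1 <;> split at e1 <;> omega

theorem innerPos_inj (h : r + 1 = k + l) (i : Fin k) (j j₁ : Fin l)
    (e : innerPos h i j = innerPos h i j₁) : j = j₁ := by
  have e1 := congrArg Fin.val e
  simp only [innerPos] at e1
  exact Fin.ext (by omega)

theorem outerPos_ne_innerPos (h : r + 1 = k + l) (i j : Fin k) (hj : j ≠ i) (j₁ : Fin l) :
    outerPos h i j hj ≠ innerPos h i j₁ := by
  intro e
  have e1 := congrArg Fin.val e
  rw [outerPos_val] at e1
  have a1 : (j : ℕ) ≠ i := fun q => hj (Fin.ext q)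
  have := j₁.2
  simp only [Fin.lt_def, innerPos] at e1
  split at e1 <;> omega

end Positions

/-! ## Planar rooted trees -/

/-- Planar rooted trees with vertices labelled in `V`; the inputs of a vertex are ordered from
left to right, and `leaf` stands for an input edge without a vertex on top of it.  Such trees are
in bijection with isomorphism classes of labelled planar rooted trees. -/
inductive PTree (V : Type) : Type
  | leaf : PTree V
  | node (v : V) (n : ℕ) (ch : Fin n → PTree V) : PTree V

namespace PTree

variable {U V W : Type}

/-- The label of the root vertex. -/
def rootLabel : PTree V → Option V
  | leaf => none
  | node v _ _ => some v

/-- The number of input leaves. -/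
def leaves : PTree V → ℕ
  | leaf => 1
  | node _ _ ch => ∑ j, (ch j).leaves

/-- The labels of the vertices in the left-recursive order (from bottom to top and from left to
right: first the root vertex, then the subtrees on its inputs, from left to right). -/
def labels : PTree V → List V
  | leaf => []
  | node v _ ch => v :: (List.ofFn fun j => (ch j).labels).flatten

/-- Every vertex with label `v` has `a v` inputs. -/
def HasArities (a : V → ℕ) : PTree V → Prop
  | leaf => True
  | node v n ch => n = a v ∧ ∀ j, (ch j).HasArities a

/-- There is an (internal) edge from the vertex `w` down to the vertex `p`. -/
def IsParent : PTree V → V → V → Prop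
  | leaf, _, _ => False
  | node v _ ch, p, w => (p = v ∧ ∃ j, (ch j).rootLabel = some w) ∨ ∃ j, (ch j).IsParent p w

/-- Relabelling of the vertices. -/
def map (f : V → W) : PTree V → PTree W
  | leaf => leaf
  | node v n ch => node (f v) n fun j => (ch j).map f

/-- Grafting of the trees `s 0, s 1, …` to the leaves of a tree, from left to right. -/
def graft : PTree V → (ℕ → PTree V) → PTree V
  | leaf, s => s 0
  | node v n ch, s => node v n fun j =>
      (ch j).graft fun p => s ((∑ q ∈ Finset.Iio j, (ch q).leaves) + p)

/-- Substitution: the vertex `i` of the first tree is replaced by the tree `t₂`, the inputs of the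
vertex being identified with the leaves of `t₂` from left to right.  The labels of the remaining
vertices of the first tree are renamed by `f`, those of `t₂` by `g`. -/
def subst [DecidableEq V] (i : V) (t₂ : PTree W) (f : ∀ v, v ≠ i → U) (g : W → U) :
    PTree V → PTree U
  | leaf => leaf
  | node v n ch =>
      if hv : v = i then
        (t₂.map g).graft fun p => if hp : p < n then subst i t₂ f g (ch ⟨p, hp⟩) else leaf
      else node (f v hv) n fun j => subst i t₂ f g (ch j)

theorem sum_range_split : ∀ (n : ℕ) (m : Fin n → ℕ) (F : ℕ → ℕ),
    ∑ p ∈ Finset.range (∑ j, m j), F p =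
      ∑ j, ∑ p ∈ Finset.range (m j), F ((∑ q ∈ Finset.Iio j, m q) + p)
  | 0, m, F => by simp
  | n + 1, m, F => by
      rw [Fin.sum_univ_castSucc, Fin.sum_univ_castSucc, Finset.sum_range_add,
        sum_range_split n (fun j => m j.castSucc) F]
      have e1 : ∀ j : Fin n, ∑ q ∈ Finset.Iio j.castSucc, m q =
          ∑ q ∈ Finset.Iio j, m q.castSucc := by
        intro j
        rw [← Fin.map_castSuccEmb_Iio, Finset.sum_map]; rfl
      have e2 : ∑ q ∈ Finset.Iio (Fin.last n), m q = ∑ q : Fin n, m q.castSucc := by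
        have : Finset.Iio (Fin.last n) = Finset.univ.map Fin.castSuccEmb := by
          ext q
          simp only [Finset.mem_Iio, Finset.mem_map, Finset.mem_univ, true_and]
          constructor
          · intro hq
            exact ⟨q.castPred (ne_of_lt hq), by simp⟩
          · rintro ⟨x, rfl⟩
            exact Fin.castSucc_lt_last x
        rw [this, Finset.sum_map]; rfl
      simp only [e1, e2]

theorem labels_map (f : V → W) (t : PTree V) : (t.map f).labels = t.labels.map f := by
  induction t with
  | leaf => rfl
  | node v n ch ih =>
      simp only [map, labels, ih, List.map_cons, List.map_flatten, List.map_ofFn]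
      rfl

theorem leaves_map (f : V → W) (t : PTree V) : (t.map f).leaves = t.leaves := by
  induction t with
  | leaf => rfl
  | node v n ch ih => simp only [map, leaves, ih]

theorem rootLabel_map (f : V → W) (t : PTree V) : (t.map f).rootLabel = t.rootLabel.map f := by
  cases t <;> rfl

theorem HasArities.map {a : V → ℕ} {a₁ : W → ℕ} (f : V → W) (hf : ∀ v, a₁ (f v) = a v)
    {t : PTree V} (ht : t.HasArities a) : (t.map f).HasArities a₁ := by
  induction t with
  | leaf => trivial
  | node v n ch ih => exact ⟨ht.1.trans (hf v).symm, fun j => ih j (ht.2 j)⟩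

theorem leaves_graft (t : PTree V) (s : ℕ → PTree V) :
    (t.graft s).leaves = ∑ p ∈ Finset.range t.leaves, (s p).leaves := by
  induction t generalizing s with
  | leaf => simp [graft, leaves]
  | node v n ch ih =>
      simp only [graft, leaves, ih]
      rw [sum_range_split n (fun j => (ch j).leaves) (fun p => (s p).leaves)]

theorem count_node [DecidableEq V] (u v : V) (n : ℕ) (ch : Fin n → PTree V) :
    (node v n ch).labels.count u = (if v = u then 1 else 0) + ∑ j, (ch j).labels.count u := by
  simp only [labels, List.count_cons, List.count_flatten, List.map_ofFn, List.sum_ofFn, beq_iff_eq,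
    Function.comp_apply]
  ring

theorem count_graft [DecidableEq V] (u : V) (t : PTree V) (s : ℕ → PTree V) :
    (t.graft s).labels.count u =
      t.labels.count u + ∑ p ∈ Finset.range t.leaves, (s p).labels.count u := by
  induction t generalizing s with
  | leaf => simp [graft, leaves, labels]
  | node v n ch ih =>
      simp only [graft, count_node, ih, leaves, Finset.sum_add_distrib]
      rw [sum_range_split n (fun j => (ch j).leaves) (fun p => (s p).labels.count u)]
      ring

theorem HasArities.graft {a : V → ℕ} {t : PTree V} {s : ℕ → PTree V} (ht : t.HasArities a)
    (hs : ∀ p, (s p).HasArities a) : (t.graft s).HasArities a := by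
  induction t generalizing s with
  | leaf => exact hs 0
  | node v n ch ih => exact ⟨ht.1, fun j => ih j (ht.2 j) fun p => hs _⟩

theorem isSome_subst [DecidableEq V] (i : V) (t₂ : PTree W) (f : ∀ v, v ≠ i → U) (g : W → U)
    (t : PTree V) (ρ : V) (ρ₂ : W) (h : t.rootLabel = some ρ) (h₂ : t₂.rootLabel = some ρ₂) :
    (PTree.subst i t₂ f g t).rootLabel = some (if hv : ρ = i then g ρ₂ else f ρ hv) := by
  cases t with
  | leaf => cases h
  | node v n ch =>
      obtain rfl : v = ρ := Option.some.inj h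
      cases t₂ with
      | leaf => cases h₂
      | node w m ch₂ =>
          obtain rfl : w = ρ₂ := Option.some.inj h₂
          by_cases hv : v = i <;> simp [subst, hv, PTree.map, graft, rootLabel]

theorem leaves_subst [DecidableEq V] (i : V) (t₂ : PTree W) (f : ∀ v, v ≠ i → U) (g : W → U)
    (a : V → ℕ) (h₂ : t₂.leaves = a i) (t : PTree V) (ht : t.HasArities a) :
    (PTree.subst i t₂ f g t).leaves = t.leaves := by
  induction t with
  | leaf => rfl
  | node v n ch ih =>
      by_cases hv : v = i
      · subst hv
        have hn : n = a v := ht.1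
        simp only [subst, dif_pos, leaves_graft, leaves_map, h₂, leaves]
        rw [← hn, Finset.sum_range]
        exact Finset.sum_congr rfl fun j _ => by simp [ih j (ht.2 j)]
      · simp only [subst, dif_neg hv, leaves]
        exact Finset.sum_congr rfl fun j _ => ih j (ht.2 j)

theorem HasArities.subst [DecidableEq V] {i : V} {t₂ : PTree W} {f : ∀ v, v ≠ i → U} {g : W → U}
    {a : V → ℕ} {a₂ : W → ℕ} {a₃ : U → ℕ} (hf : ∀ v hv, a₃ (f v hv) = a v)
    (hg : ∀ w, a₃ (g w) = a₂ w) (h₂ : t₂.HasArities a₂) {t : PTree V} (ht : t.HasArities a) :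
    (PTree.subst i t₂ f g t).HasArities a₃ := by
  induction t with
  | leaf => trivial
  | node v n ch ih =>
      by_cases hv : v = i
      · simp only [PTree.subst, dif_pos hv]
        refine (h₂.map g hg).graft fun p => ?_
        split
        · exact ih _ (ht.2 _)
        · trivial
      · simp only [PTree.subst, dif_neg hv]
        exact ⟨ht.1.trans (hf v hv).symm, fun j => ih j (ht.2 j)⟩

theorem count_subst [DecidableEq V] [DecidableEq U] (i : V) (t₂ : PTree W) (f : ∀ v, v ≠ i → U)
    (g : W → U) (a : V → ℕ) (h₂ : t₂.leaves = a i) (u : U) (t : PTree V) (ht : t.HasArities a) :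
    (PTree.subst i t₂ f g t).labels.count u = (t.labels.map fun v =>
      if hv : v = i then (t₂.labels.map g).count u else if f v hv = u then 1 else 0).sum := by
  induction t with
  | leaf => rfl
  | node v n ch ih =>
      have key : ((List.ofFn fun j => (ch j).labels).flatten.map fun v =>
          if hv : v = i then (t₂.labels.map g).count u else if f v hv = u then 1 else 0).sum =
          ∑ j, (PTree.subst i t₂ f g (ch j)).labels.count u := by
        rw [List.map_flatten, List.sum_flatten, List.map_ofFn, List.map_ofFn, List.sum_ofFn]
        exact Finset.sum_congr rfl fun j _ => (ih j (ht.2 j)).symm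
      rw [labels, List.map_cons, List.sum_cons, key]
      by_cases hv : v = i
      · subst hv
        have hn : n = a v := ht.1
        simp only [subst, dif_pos, count_graft, leaves_map, h₂, labels_map]
        rw [← hn, Finset.sum_range]
        simp
      · simp only [subst, dif_neg hv, count_node]

end PTree

/-! ## Operadic trees -/

/-- Operadic trees: (isomorphism classes of) planar rooted trees with `d` inputs whose vertices are
indexed bijectively by `1, …, k` (here `Fin k`), the vertex with index `v` having `c v` inputs. -/
structure OpTree {k : ℕ} (c : Fin k → ℕ+) (d : ℕ+) where
  tree : PTree (Fin k)
  isSome : tree.rootLabel.isSome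
  bij : ∀ v, tree.labels.count v = 1
  arities : tree.HasArities fun v => (c v : ℕ)
  leaves : tree.leaves = d

namespace OpTree

variable {k l r : ℕ} {c : Fin k → ℕ+} {b : Fin l → ℕ+} {a : Fin r → ℕ+} {d e : ℕ+}

/-- The index of the root vertex. -/
def root (T : OpTree c d) : Fin k := T.tree.rootLabel.get T.isSome

theorem rootLabel_eq (T : OpTree c d) : T.tree.rootLabel = some T.root :=
  (Option.some_get T.isSome).symm

theorem sum_labels (T : OpTree c d) (φ : Fin k → ℕ) : (T.tree.labels.map φ).sum = ∑ v, φ v := by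
  have hp : T.tree.labels.Perm (List.finRange k) := by
    rw [List.perm_iff_count]
    intro v
    rw [T.bij v, List.count_eq_one_of_mem (List.nodup_finRange k) (List.mem_finRange v)]
  rw [(hp.map φ).sum_eq, ← List.ofFn_eq_map, List.sum_ofFn]

/-- An operadic tree is left-recursive if its vertices are indexed in the left-recursive order. -/
def IsLeftRecursive (T : OpTree c d) : Prop := T.tree.labels = List.finRange k

/-- The right action of the symmetric group: the vertex with index `i` in the new tree is the one
that has index `κ i` in the old tree. -/
def act (T : OpTree c d) (κ : Equiv.Perm (Fin k)) : OpTree (c ∘ κ) d where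
  tree := T.tree.map κ.symm
  isSome := by rw [PTree.rootLabel_map, T.rootLabel_eq]; rfl
  bij v := by
    have h := List.count_map_of_injective T.tree.labels κ.symm κ.symm.injective (κ v)
    rw [Equiv.symm_apply_apply] at h
    rw [PTree.labels_map, h, T.bij]
  arities := T.arities.map _ fun v => by simp
  leaves := by rw [PTree.leaves_map, T.leaves]

/-- Substitution of the vertex with index `i` of `T₁` by `T₂`. -/
def comp (i : Fin k) (he : c i = e) (h : Ins c i b a) (T₁ : OpTree c d) (T₂ : OpTree b e) :
    OpTree a d where
  tree := PTree.subst i T₂.tree (outerPos h.card i) (innerPos h.card i) T₁.tree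
  isSome := by
    rw [PTree.isSome_subst _ _ _ _ _ _ _ T₁.rootLabel_eq T₂.rootLabel_eq]; rfl
  bij u := by
    rw [PTree.count_subst i _ _ _ (fun v => (c v : ℕ)) (by rw [T₂.leaves, he]) u _ T₁.arities,
      T₁.sum_labels]
    rcases pos_cases h.card i u with ⟨j, hj, rfl⟩ | ⟨j, rfl⟩
    · rw [Finset.sum_eq_single j]
      · simp [hj]
      · intro v _ hv
        by_cases hvi : v = i
        · rw [dif_pos hvi, List.count_eq_zero]
          rintro hm
          obtain ⟨w, -, hw⟩ := List.mem_map.mp hm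
          exact outerPos_ne_innerPos h.card i j hj w hw.symm
        · rw [dif_neg hvi, if_neg fun q => hv (outerPos_inj _ _ _ _ _ _ q)]
      · simp
    · rw [Finset.sum_eq_single i]
      · rw [dif_pos rfl, List.count_map_of_injective _ _ (fun x y => innerPos_inj h.card i x y),
          T₂.bij]
      · intro v _ hv
        rw [dif_neg hv, if_neg (outerPos_ne_innerPos h.card i v hv j)]
      · simp
  arities := PTree.HasArities.subst (fun v hv => by rw [h.outer]) (fun w => by rw [h.inner])
    T₂.arities T₁.arities
  leaves := by
    rw [PTree.leaves_subst i _ _ _ (fun v => (c v : ℕ)) (by rw [T₂.leaves, he]) _ T₁.arities,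
      T₁.leaves]

/-- The corolla with `n` inputs. -/
def corolla (n : ℕ+) : OpTree (fun _ : Fin 1 => n) n where
  tree := .node 0 n fun _ => .leaf
  isSome := rfl
  bij v := by
    rw [PTree.count_node, if_pos (Subsingleton.elim _ _)]; simp [PTree.labels]
  arities := ⟨rfl, fun _ => trivial⟩
  leaves := by simp [PTree.leaves]

end OpTree

/-! ## Hypergraphs and constructs -/

/-- (Finite, atomic) hypergraphs: a finite set of vertices and a set of non-empty sets of vertices
that contains all the singletons. -/
structure Hypergraph (E : Type) where
  verts : Finset E
  hyperedges : Set (Finset E)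
  nonempty : ∀ Z ∈ hyperedges, Z.Nonempty
  subset : ∀ Z ∈ hyperedges, Z ⊆ verts
  atomic : ∀ x ∈ verts, {x} ∈ hyperedges

namespace Hypergraph

variable {E : Type} (H : Hypergraph E)

/-- The hypergraph `H_X` of the hyperedges contained in `X` is connected (and non-empty): there is
no non-trivial partition `X = A ∪ B` such that each of its hyperedges is contained in `A` or
in `B`. -/
def IsConnected (X : Finset E) : Prop :=
  X.Nonempty ∧ ∀ A B : Finset E, A.Nonempty → B.Nonempty → Disjoint A B →
    (∀ x, x ∈ X ↔ x ∈ A ∨ x ∈ B) → ∃ Z ∈ H.hyperedges, Z ⊆ X ∧ ¬ Z ⊆ A ∧ ¬ Z ⊆ B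

/-- `K` is the set of vertices of a connected component of the hypergraph `H_X`. -/
structure IsComponent (X K : Finset E) : Prop where
  subset : K ⊆ X
  connected : H.IsConnected K
  closed : ∀ Z ∈ H.hyperedges, Z ⊆ X → Z ⊆ K ∨ Disjoint Z K

end Hypergraph

/-- `Construct H X` is the type of constructs of the hypergraph `H_X`.  A construct is a non-planar
tree: its root vertex is decorated by a non-empty set `Y ⊆ X`, and the subtrees on the root vertex
are constructs of the connected components of `H_X \ Y`, one for each of these components (none
if `Y = X`). -/
inductive Construct {E : Type} [DecidableEq E] (H : Hypergraph E) : Finset E → Type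
  | mk {X : Finset E} (Y : Finset E) (hne : Y.Nonempty) (hsub : Y ⊆ X)
      (sub : ∀ K : Finset E, H.IsComponent (X \ Y) K → Construct H K) : Construct H X

namespace Construct

variable {E E₁ E₂ : Type} [DecidableEq E] [DecidableEq E₁] [DecidableEq E₂]
  {H : Hypergraph E} {H₁ : Hypergraph E₁} {H₂ : Hypergraph E₂}

/-- The maximal construct, with a single vertex. -/
def top (H : Hypergraph E) (X : Finset E) (hX : X.Nonempty) : Construct H X :=
  mk X hX (Finset.Subset.refl X) fun K hK => False.elim <| by
    obtain ⟨x, hx⟩ := hK.connected.1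
    have := hK.subset hx
    simp at this

open Classical in
/-- The number of vertices. -/
noncomputable def numVerts : ∀ {X : Finset E}, Construct H X → ℕ
  | X, mk Y _ _ sub => 1 + ∑ K ∈ (X \ Y).powerset,
      if hK : H.IsComponent (X \ Y) K then (sub K hK).numVerts else 0

open Classical in
/-- Renaming of the vertices of the hypergraph along a map that induces an isomorphism of
hypergraphs `(H₁)_X → H_X₁`.  (Every component `K` is then the image of a component, so that
the last two cases do not occur.) -/
noncomputable def rename (f : E₁ → E) :
    ∀ {X : Finset E₁}, Construct H₁ X → ∀ X₁ : Finset E, X.image f = X₁ → Construct H X₁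
  | X, mk Y hne hsub sub, _, h =>
      mk (Y.image f) (hne.image f) (h ▸ Finset.image_subset_image hsub) fun K hK =>
        if h₁ : H₁.IsComponent (X \ Y) ((X \ Y).filter fun x => f x ∈ K) then
          if h₂ : ((X \ Y).filter fun x => f x ∈ K).image f = K then
            (sub _ h₁).rename f K h₂
          else top H K hK.connected.1
        else top H K hK.connected.1

open Classical in
/-- The construct `C₁ •_i C₂`.  Here `H₁`, `H₂` and `H` are the edge-graphs of `T₁`, `T₂` and
`T₁ •_i T₂`, the maps `f` and `g` are the inclusions of the edges of `T₁` and of `T₂`, `C₂` is a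
construct of `H₂` with set of vertices `X₂`, and `C₁` is a construct of a connected subgraph
`(H₁)_X` that corresponds to a subtree containing the vertex `i`.  Let `Y` be the decoration of the
root of `C₁`.  The components of `H \ Y` are

* the set `K₀ ∪ X₂`, if there is a component `K₀` of `(H₁)_X \ Y` whose subtree contains the
  vertex `i`, in which case one proceeds recursively;
* all the other components of `(H₁)_X \ Y`, whose constructs are left as they are;
* the set `X₂`, if no component of `(H₁)_X \ Y` contains the vertex `i`, in which case `C₂` is
  grafted to the root of `C₁` (in particular if `C₁` is the maximal construct).

The two cases with value `top` do not occur. -/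
noncomputable def graft (f : E₁ → E) (g : E₂ → E) {X₂ : Finset E₂} (C₂ : Construct H₂ X₂) :
    ∀ {X : Finset E₁}, Construct H₁ X →
      ∀ X₁ : Finset E, X.image f ∪ X₂.image g = X₁ → Construct H X₁
  | X, mk Y hne hsub sub, _, h =>
      mk (Y.image f) (hne.image f)
        (h ▸ (Finset.image_subset_image hsub).trans Finset.subset_union_left) fun K hK =>
        if h₁ : H₁.IsComponent (X \ Y) ((X \ Y).filter fun x => f x ∈ K) then
          if h₂ : ((X \ Y).filter fun x => f x ∈ K).image f ∪ X₂.image g = K then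
            graft f g C₂ (sub _ h₁) K h₂
          else if h₃ : ((X \ Y).filter fun x => f x ∈ K).image f = K then
            (sub _ h₁).rename f K h₃
          else top H K hK.connected.1
        else if h₄ : X₂.image g = K then C₂.rename g K h₄
        else top H K hK.connected.1

end Construct

/-! ## The edge-graph of an operadic tree -/

namespace OpTree

variable {k l r : ℕ} {c : Fin k → ℕ+} {b : Fin l → ℕ+} {a : Fin r → ℕ+} {d e : ℕ+}

/-- The internal edges.  Each of them is the root of a unique vertex, which is not the root vertex;
the edge is named by the index of that vertex. -/
def edges (T : OpTree c d) : Finset (Fin k) := Finset.univ.erase T.root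

/-- The vertex `v` is adjacent to the edge named `x`. -/
def Adjacent (T : OpTree c d) (v x : Fin k) : Prop := v = x ∨ T.tree.IsParent v x

/-- The edge-graph `H_T`: the vertices are the internal edges of the tree, and two of them are
connected by an edge if they share a vertex of the tree. -/
def edgeGraph (T : OpTree c d) : Hypergraph (Fin k) where
  verts := T.edges
  hyperedges := {Z | (∃ x ∈ T.edges, Z = {x}) ∨ ∃ x ∈ T.edges, ∃ y ∈ T.edges,
    x ≠ y ∧ (∃ v, T.Adjacent v x ∧ T.Adjacent v y) ∧ Z = {x, y}}
  nonempty := by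
    rintro Z (⟨x, -, rfl⟩ | ⟨x, -, y, -, -, -, rfl⟩) <;> simp
  subset := by
    rintro Z (⟨x, hx, rfl⟩ | ⟨x, hx, y, hy, -, -, rfl⟩)
    · simpa using hx
    · intro z hz
      rcases Finset.mem_insert.mp hz with rfl | hz
      · exact hx
      · rwa [Finset.mem_singleton.mp hz]
  atomic x hx := Or.inl ⟨x, hx, rfl⟩

theorem edges_nonempty (T : OpTree c d) (hk : 2 ≤ k) : T.edges.Nonempty := by
  rw [← Finset.card_pos, edges, Finset.card_erase_of_mem (Finset.mem_univ _), Finset.card_univ,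
    Fintype.card_fin]
  omega

theorem edges_act (T : OpTree c d) (κ : Equiv.Perm (Fin k)) :
    T.edges.image κ.symm = (T.act κ).edges := by
  have h : (T.act κ).root = κ.symm T.root := by
    have h₁ := (T.act κ).rootLabel_eq
    have h₂ : (T.act κ).tree.rootLabel = some (κ.symm T.root) := by
      show (T.tree.map κ.symm).rootLabel = _
      rw [PTree.rootLabel_map, T.rootLabel_eq]; rfl
    exact Option.some.inj (h₁.symm.trans h₂)
  rw [edges, edges, h, Finset.image_erase κ.symm.injective, Finset.image_univ_equiv]

/-- The inclusion of the edges of `T₁` into those of `T₁ •_i T₂`: after the substitution, the edge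
that was the root of the vertex `i` is the root of the root vertex of `T₂`. -/
def edgeIncl (i : Fin k) (h : Ins c i b a) (T₂ : OpTree b e) (x : Fin k) : Fin r :=
  if hx : x = i then innerPos h.card i T₂.root else outerPos h.card i x hx

theorem root_comp (i : Fin k) (he : c i = e) (h : Ins c i b a) (T₁ : OpTree c d)
    (T₂ : OpTree b e) : (T₁.comp i he h T₂).root = edgeIncl i h T₂ T₁.root :=
  Option.some.inj ((T₁.comp i he h T₂).rootLabel_eq.symm.trans
    (PTree.isSome_subst _ _ _ _ _ _ _ T₁.rootLabel_eq T₂.rootLabel_eq))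

theorem edgeIncl_injective (i : Fin k) (h : Ins c i b a) (T₂ : OpTree b e) :
    Function.Injective (edgeIncl i h T₂) := by
  intro x y hxy
  unfold edgeIncl at hxy
  split at hxy <;> split at hxy
  · simp_all
  · exact absurd hxy.symm (outerPos_ne_innerPos _ _ _ _ _)
  · exact absurd hxy (outerPos_ne_innerPos _ _ _ _ _)
  · exact outerPos_inj _ _ _ _ _ _ hxy

theorem edges_comp (i : Fin k) (he : c i = e) (h : Ins c i b a) (T₁ : OpTree c d)
    (T₂ : OpTree b e) : T₁.edges.image (edgeIncl i h T₂) ∪ T₂.edges.image (innerPos h.card i) =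
      (T₁.comp i he h T₂).edges := by
  rw [edges, edges, edges, root_comp]
  ext p
  simp only [Finset.mem_union, Finset.mem_image, Finset.mem_erase, Finset.mem_univ, and_true]
  constructor
  · rintro (⟨x, hx, rfl⟩ | ⟨y, hy, rfl⟩)
    · exact fun q => hx (edgeIncl_injective i h T₂ q)
    · intro q
      unfold edgeIncl at q
      split at q
      · exact hy (innerPos_inj _ _ _ _ q)
      · exact outerPos_ne_innerPos _ _ _ _ _ q.symm
  · intro hp
    rcases pos_cases h.card i p with ⟨j, hj, rfl⟩ | ⟨j, rfl⟩
    · refine Or.inl ⟨j, ?_, dif_neg hj⟩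
      rintro rfl
      exact hp (dif_neg hj).symm
    · by_cases hjr : j = T₂.root
      · subst hjr
        refine Or.inl ⟨i, ?_, dif_pos rfl⟩
        intro q
        rw [← q] at hp
        exact hp (show edgeIncl i h T₂ i = _ from dif_pos rfl).symm
      · exact Or.inr ⟨j, hjr, rfl⟩

theorem edges_eq_empty (T : OpTree c d) (hk : ¬ 2 ≤ k) : T.edges = ∅ := by
  rw [← Finset.card_eq_zero, edges, Finset.card_erase_of_mem (Finset.mem_univ _),
    Finset.card_univ, Fintype.card_fin]
  omega

end OpTree

/-! ## The operad `O_∞` -/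

/-- The basis of `O_∞ (c_1, …, c_k; d)`: for `k ≥ 2`, the (classes of) triples `(T, σ, C)` of
an operadic tree `(T, σ)` and a construct `C : H_T`.  For `k = 1`, the tree is a corolla, without
internal edges, and there is no further datum; this is the identity operation of the colour
`c_1 = d`. -/
structure OInfBasis {k : ℕ} (c : Fin k → ℕ+) (d : ℕ+) where
  tree : OpTree c d
  con : 2 ≤ k → Construct tree.edgeGraph tree.edges

namespace OInfBasis

variable {k l r : ℕ} {c : Fin k → ℕ+} {b : Fin l → ℕ+} {a : Fin r → ℕ+} {d e : ℕ+}

/-- The generator `(T, σ, e(T))`. -/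
def gen (T : OpTree c d) : OInfBasis c d where
  tree := T
  con hk := Construct.top _ _ (T.edges_nonempty hk)

/-- The identity operation. -/
def one (n : ℕ+) : OInfBasis (fun _ : Fin 1 => n) n where
  tree := OpTree.corolla n
  con hk := absurd hk (by norm_num)

/-- `(T, σ, C) ^ κ = (T, σ ∘ κ, C)`.  (As the edges are named by the indices of the vertices, they
have to be renamed in `C`.) -/
noncomputable def act (x : OInfBasis c d) (κ : Equiv.Perm (Fin k)) : OInfBasis (c ∘ κ) d where
  tree := x.tree.act κ
  con hk := (x.con hk).rename κ.symm _ (x.tree.edges_act κ)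

/-- `(T₁, σ₁, C₁) ∘_i (T₂, σ₂, C₂) = (T₁ •_i T₂, σ₁ •_i σ₂, C₁ •_i C₂)`. If one of the trees is a
corolla, the construct of the other one is taken. -/
noncomputable def comp (i : Fin k) (he : c i = e) (h : Ins c i b a) (x : OInfBasis c d)
    (y : OInfBasis b e) : OInfBasis a d where
  tree := x.tree.comp i he h y.tree
  con hr :=
    if hk : 2 ≤ k then
      if hl : 2 ≤ l then
        Construct.graft (OpTree.edgeIncl i h y.tree) (innerPos h.card i) (y.con hl) (x.con hk) _
          (x.tree.edges_comp i he h y.tree)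
      else (x.con hk).rename (OpTree.edgeIncl i h y.tree) _ (by
        rw [← x.tree.edges_comp i he h y.tree, y.tree.edges_eq_empty hl, Finset.image_empty,
          Finset.union_empty])
    else (y.con (by have := h.card; omega)).rename (innerPos h.card i) _ (by
        rw [← x.tree.edges_comp i he h y.tree, x.tree.edges_eq_empty hk, Finset.image_empty,
          Finset.empty_union])

/-- The number of vertices of the construct. -/
noncomputable def numVerts (x : OInfBasis c d) : ℕ :=
  if hk : 2 ≤ k then (x.con hk).numVerts else 0

/-- The degree `|(T, σ, C)| = k - 1 - |v(C)|`. -/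
noncomputable def degree (x : OInfBasis c d) : ℤ := (k : ℤ) - 1 - x.numVerts

end OInfBasis

/-! ## Planar trees decorated by left-recursive operadic trees -/

/-- Planar rooted trees with `ℕ+`-coloured edges and with root of colour `d`, whose vertices are
decorated by left-recursive operadic trees with at least two vertices, and whose leaves are labelled
in `Fin k`, the leaf with label `i` having colour `c i`.  A vertex decorated by `T` has as many
inputs as `T` has vertices; their colours are the numbers of inputs of the vertices of `T`, and
the output colour is the number of inputs of `T`. -/
inductive FTree {k : ℕ} (c : Fin k → ℕ+) : ℕ+ → Type
  | leaf (i : Fin k) : FTree c (c i)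
  | node {m : ℕ} {a : Fin m → ℕ+} {d : ℕ+} (T : OpTree a d) (hm : 2 ≤ m)
      (hT : T.IsLeftRecursive) (ch : ∀ q : Fin m, FTree c (a q)) : FTree c d

namespace FTree

variable {k l r : ℕ} {c : Fin k → ℕ+} {b : Fin l → ℕ+} {a : Fin r → ℕ+} {d e : ℕ+}

/-- The number of leaves with label `i`. -/
def leafCount (i : Fin k) : ∀ {d : ℕ+}, FTree c d → ℕ
  | _, leaf j => if j = i then 1 else 0
  | _, node _ _ _ ch => ∑ q, (ch q).leafCount i

/-- Grafting of trees to the leaves of a tree. -/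
def bind (s : ∀ j : Fin k, FTree b (c j)) : ∀ {d : ℕ+}, FTree c d → FTree b d
  | _, leaf j => s j
  | _, node T hm hT ch => node T hm hT fun q => (ch q).bind s

/-- Transport along an equality of output colours. -/
def cast (h : d = e) (t : FTree c d) : FTree c e := h ▸ t

theorem leafCount_cast (h : d = e) (t : FTree c d) (i : Fin k) :
    (t.cast h).leafCount i = t.leafCount i := by
  subst h; rfl

theorem leafCount_bind (s : ∀ j : Fin k, FTree b (c j)) (t : FTree c d) (i : Fin l) :
    (t.bind s).leafCount i = ∑ j, t.leafCount j * (s j).leafCount i := by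
  induction t with
  | leaf j => simp [bind, leafCount]
  | node T hm hT ch ih =>
      simp only [bind, leafCount, ih, Finset.sum_mul]
      rw [Finset.sum_comm]

/-- The number of all edges and leaves, minus the root. -/
def numEdges : ∀ {d : ℕ+}, FTree c d → ℕ
  | _, leaf _ => 0
  | _, node _ _ _ ch => ∑ q, (1 + (ch q).numEdges)

/-- The number of all edges and leaves that are strictly on the right from the path from the
leaf `i` to the root (for a tree with exactly one leaf with label `i`). -/
def numRight (i : Fin k) : ∀ {d : ℕ+}, FTree c d → ℕ
  | _, leaf _ => 0
  | _, node _ _ _ ch => ∑ q, if 0 < (ch q).leafCount i then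
      (ch q).numRight i + ∑ q₁ ∈ Finset.Ioi q, (1 + (ch q₁).numEdges) else 0

end FTree

/-- Decorated trees whose leaves are labelled bijectively by `1, …, k`. -/
def DecTree {k : ℕ} (c : Fin k → ℕ+) (d : ℕ+) : Type :=
  {t : FTree c d // ∀ i, t.leafCount i = 1}

namespace DecTree

variable {k l r : ℕ} {c : Fin k → ℕ+} {b : Fin l → ℕ+} {a : Fin r → ℕ+} {d e : ℕ+}

/-- The trivial tree, without vertices. -/
def one (n : ℕ+) : DecTree (fun _ : Fin 1 => n) n :=
  ⟨FTree.leaf 0, fun i => by rw [FTree.leafCount, if_pos (Subsingleton.elim _ _)]⟩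

/-- The tree with a single vertex decorated by `T` and with leaves labelled from left to right. -/
def corolla (T : OpTree c d) (hk : 2 ≤ k) (hT : T.IsLeftRecursive) : DecTree c d :=
  ⟨FTree.node T hk hT fun q => FTree.leaf q, fun i => by simp [FTree.leafCount]⟩

/-- The right action of the symmetric group: the leaf with label `i` in the new tree is the one
that has label `κ i` in the old tree. -/
def act (t : DecTree c d) (κ : Equiv.Perm (Fin k)) : DecTree (c ∘ κ) d :=
  ⟨t.1.bind fun j => (FTree.leaf (c := c ∘ κ) (κ.symm j)).cast (by simp), fun i => by
    rw [FTree.leafCount_bind]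
    simp only [FTree.leafCount_cast, FTree.leafCount, t.2, one_mul]
    rw [Finset.sum_eq_single (κ i)] <;> simp +contextual [Equiv.symm_apply_eq]⟩

/-- Grafting of the tree `y` to the leaf `i` of the tree `x`. -/
def comp (i : Fin k) (he : c i = e) (h : Ins c i b a) (x : DecTree c d) (y : DecTree b e) :
    DecTree a d :=
  ⟨x.1.bind fun j =>
    if hj : j = i then
      (y.1.bind fun p => (FTree.leaf (c := a) (innerPos h.card i p)).cast (h.inner p)).cast
        (by rw [hj, he])
    else (FTree.leaf (c := a) (outerPos h.card i j hj)).cast (h.outer j hj), fun u => by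
    rw [FTree.leafCount_bind]
    simp only [x.2, one_mul]
    rcases pos_cases h.card i u with ⟨j, hj, rfl⟩ | ⟨j, rfl⟩
    · rw [Finset.sum_eq_single j]
      · rw [dif_neg hj, FTree.leafCount_cast, FTree.leafCount, if_pos rfl]
      · intro v _ hv
        by_cases hvi : v = i
        · rw [dif_pos hvi, FTree.leafCount_cast, FTree.leafCount_bind]
          refine Finset.sum_eq_zero fun p _ => ?_
          rw [FTree.leafCount_cast, FTree.leafCount,
            if_neg (outerPos_ne_innerPos h.card i j hj p).symm, mul_zero]
        · rw [dif_neg hvi, FTree.leafCount_cast, FTree.leafCount,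
            if_neg fun q => hv (outerPos_inj _ _ _ _ _ _ q)]
      · simp
    · rw [Finset.sum_eq_single i]
      · rw [dif_pos rfl, FTree.leafCount_cast, FTree.leafCount_bind, Finset.sum_eq_single j]
        · rw [FTree.leafCount_cast, FTree.leafCount, if_pos rfl, y.2]
        · intro p _ hp
          rw [FTree.leafCount_cast, FTree.leafCount,
            if_neg fun q => hp (innerPos_inj _ _ _ _ q), mul_zero]
        · simp
      · intro v _ hv
        rw [dif_neg hv, FTree.leafCount_cast, FTree.leafCount,
          if_neg (outerPos_ne_innerPos h.card i v hv j)]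
      · simp⟩

end DecTree

/-! ## The operads and collections of vector spaces -/

section Linear

variable (𝕜 : Type u) [Field 𝕜]

/-- The bilinear extension of a map defined on bases. -/
noncomputable def bilinearExt {A B M : Type} (m : A → B → M →₀ 𝕜) :
    (A →₀ 𝕜) →ₗ[𝕜] (B →₀ 𝕜) →ₗ[𝕜] (M →₀ 𝕜) :=
  Finsupp.linearCombination 𝕜 fun x => Finsupp.linearCombination 𝕜 fun y => m x y

/-- The symmetric collection of generators: for `k ≥ 2`, its space `(c_1, …, c_k; d)` is the direct
sum of copies of `𝕜` over all the operadic trees in `Tree (c_1, …, c_k; d)`; as a representation of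
the symmetric groups it is freely generated by the left-recursive operadic trees. -/
noncomputable def genCollection : Collection.{u, u} 𝕜 ℕ+ where
  Op {k} c d := {_T : OpTree c d // 2 ≤ k} →₀ 𝕜
  act κ := Finsupp.lmapDomain 𝕜 𝕜 fun T => ⟨T.1.act κ, T.2⟩

/-- Families of coefficients that the compositions of basis elements of `O_∞` may come with. -/
abbrev Coefficients : Type u :=
  ∀ (k l : ℕ) (c : Fin k → ℕ+) (b : Fin l → ℕ+) (d e : ℕ+),
    Fin k → OInfBasis c d → OInfBasis b e → 𝕜

/-- The operad `O_∞`: its operations are the linear combinations of triples `(T, σ, C)`, and the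
composition is `(T₁, σ₁, C₁) ∘_i (T₂, σ₂, C₂) = ± (T₁ •_i T₂, σ₁ •_i σ₂, C₁ •_i C₂)`, where the
sign is given by the family `s`. -/
noncomputable def OInf (s : Coefficients 𝕜) : OperadData.{u, u} 𝕜 ℕ+ where
  Op c d := OInfBasis c d →₀ 𝕜
  act κ := Finsupp.lmapDomain 𝕜 𝕜 fun x => x.act κ
  one n := Finsupp.single (OInfBasis.one n) 1
  comp i he h := bilinearExt 𝕜 fun x y =>
    Finsupp.single (x.comp i he h y) (s _ _ _ _ _ _ i x y)

/-- The trivial signs, for `O_∞` as an operad of vector spaces. -/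
def noSigns : Coefficients 𝕜 := fun _ _ _ _ _ _ _ _ _ => 1

/-- The signs of the graded operad `O_∞`, relative to a bijection `α` between triples `(T, σ, C)`
and decorated trees: the composition `x ∘_i y` has the sign `(-1) ^ ε`, where `ε` is the number of
edges and leaves of `α x` on the right of the leaf `i`, times the number of all edges and
leaves of `α y` minus the root. -/
def gradedSigns (α : ∀ (k : ℕ) (c : Fin k → ℕ+) (d : ℕ+), OInfBasis c d ≃ DecTree c d) :
    Coefficients 𝕜 :=
  fun k l c b d e i x y => (-1) ^ ((α k c d x).1.numRight i * (α l b e y).1.numEdges)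

/-- The operad of decorated planar trees, with grafting as composition. -/
noncomputable def decTreeOperad : OperadData.{u, u} 𝕜 ℕ+ where
  Op c d := DecTree c d →₀ 𝕜
  act κ := Finsupp.lmapDomain 𝕜 𝕜 fun x => x.act κ
  one n := Finsupp.single (DecTree.one n) 1
  comp i he h := bilinearExt 𝕜 fun x y => Finsupp.single (x.comp i he h y) 1

/-- The grading of the generators: an operadic tree with `k` vertices has degree `k - 2`. -/
noncomputable def genGrading : (genCollection 𝕜).Grading :=
  fun k _ _ p => if p = (k : ℤ) - 2 then ⊤ else ⊥

/-- The grading of `O_∞` by the degrees of the triples `(T, σ, C)`. -/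
noncomputable def oInfGrading (s : Coefficients 𝕜) : (OInf 𝕜 s).Grading :=
  fun _ c d p => Submodule.span 𝕜 {z : OInfBasis c d →₀ 𝕜 | ∃ x : OInfBasis c d,
    x.degree = p ∧ z = Finsupp.single x 1}

/-- The inclusion of the generators, which sends `(T, σ)` to `(T, σ, e(T))`. -/
noncomputable def genIncl (s : Coefficients 𝕜) :
    LinFamily (genCollection 𝕜) (OInf 𝕜 s).toCollection :=
  fun _ _ _ => Finsupp.lmapDomain 𝕜 𝕜 fun T => OInfBasis.gen T.1

/-- The linear extension of a map `α` from triples `(T, σ, C)` to decorated trees. -/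
noncomputable def linearExt
    (α : ∀ (k : ℕ) (c : Fin k → ℕ+) (d : ℕ+), OInfBasis c d ≃ DecTree c d) :
    LinFamily (OInf 𝕜 (noSigns 𝕜)).toCollection (decTreeOperad 𝕜).toCollection :=
  fun k c d => Finsupp.lmapDomain 𝕜 𝕜 (α k c d)

end Linear

end OInfty

/-! A decorated tree is an operadic tree that has been cut into pieces. Substituting the decorations
of `t` into each other gives the operadic tree `t.flat`. Its internal edges are of two kinds: those
inside `(ch q).flat` for a subtree `ch q` on an input of the root vertex, and the others, forming a
set `Y`, which are the internal edges of the decoration of the root vertex. Every vertex lies in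
exactly one piece, so adjacent edges outside `Y` lie in the same piece, and the components left
after the removal of `Y` are the non-empty edge sets of the pieces
(`OpTree.isComponent_edgeGraph_iff`). Recursively, `t` thus determines a construct, with one vertex
for each vertex of `t`. Conversely, given a construct with root decoration `Y`, contract the edges
outside `Y`. The contracted tree, with its vertices numbered left-recursively, decorates the root
vertex, and the contracted pieces carry the sub-constructs. Such a cut exists
(`PTree.exists_decomposition`) and is unique (`PTree.msubst_unique`), so the relation `FTree.IsCon`
is the graph of a bijection. Compatibility with composition and permutations need only be checked
for the relation: the recursion defining the composite of two constructs follows the path from the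
root of the decorated tree to the leaf `i`, and ends by grafting the second construct there
(`FTree.IsCon.graft`, `FTree.IsCon.rename`).

It remains to show that decorated trees form a free operad. The plain and the graded case are
treated together by means of a sign `σ` with `σ * σ = 1`. A tree is replaced by its word in prefix
notation, in which grafting is substitution for a letter, so that the operad laws become identities
between lists. The letters of a word correspond to the edges and leaves, the root included, and the
letters behind the leaf `i` are those to the right of its path; hence both factors of the exponent
in the composition sign are lengths of words, up to the letter of the root. To extend generators to
a morphism, a word is read from left to right and each generator is grafted to the first input that
is still pending. Composites are normalised by `σ ^ ((k - 1 - i) * |y|)`. With this normalisation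
nested compositions carry no sign (`TOp.comp_assoc`), while exchanging `y` with a generator of `m`
inputs on its right costs `|y| * ((m - 2) + (m - 1))` (`TOp.comp_parallel`), an odd multiple of
`|y|`. If `x` has the word `u, i, v`, the word of the composite is, up to labels, that of `x` with
the word of `y` in place of `i`. Reading the word of `y` amounts to composing with the value of `y`;
moving `y` past `v` costs `|y|` for each vertex of `v`, and the normalisation contributes `|y|` for
each leaf of `v`. Together this is `|y|` times the length of `v`. As `|y|` has the parity of the
number of edges of `y`, this is the prescribed sign (`TOp.isValue_comp`). For uniqueness, the same
evaluation, applied to the corollas in the operad of decorated trees itself, returns a non-zero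
multiple of the given tree with its leaves reordered (`eval_corollas`). Evaluation commutes with
morphisms, so a morphism is determined by its values on the left-recursive generators. -/

namespace OInfty

namespace PTree

variable {U V W : Type}

/-! ## Simultaneous substitution in planar trees -/

/-- Simultaneous substitution of the trees `s v` for all the vertices `v` of a tree. -/
def msubst (s : V → PTree W) : PTree V → PTree W
  | leaf => leaf
  | node v n ch => (s v).graft fun p => if hp : p < n then msubst s (ch ⟨p, hp⟩) else leaf

/-- The tree with a single vertex `v`, which has `n` inputs. -/
def corolla (v : V) (n : ℕ) : PTree V := node v n fun _ => leaf

theorem sum_Iio_add_lt {n : ℕ} (m : Fin n → ℕ) (j : Fin n) {p : ℕ} (hp : p < m j) :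
    (∑ q ∈ Finset.Iio j, m q) + p < ∑ q, m q := by
  have h : ∑ q ∈ Finset.Iic j, m q ≤ ∑ q, m q :=
    Finset.sum_le_sum_of_subset (Finset.subset_univ _)
  rw [← Finset.Iio_insert, Finset.sum_insert (by simp)] at h
  omega

theorem sum_Iio_eq_sum_range {n : ℕ} (F : ℕ → ℕ) (j : Fin n) :
    ∑ q ∈ Finset.Iio j, F q = ∑ q ∈ Finset.range j, F q := by
  have : (Finset.Iio j).map Fin.valEmbedding = Finset.range j := by
    rw [Fin.map_valEmbedding_Iio]; ext; simp
  rw [← this, Finset.sum_map]; rfl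

theorem sum_range_split_Iio {n : ℕ} (m : Fin n → ℕ) (F : ℕ → ℕ) (j : Fin n) :
    ∑ p ∈ Finset.range (∑ q ∈ Finset.Iio j, m q), F p =
      ∑ i ∈ Finset.Iio j, ∑ p ∈ Finset.range (m i), F ((∑ q ∈ Finset.Iio i, m q) + p) := by
  -- A partial sum is the full sum for the block sizes that are set to `0` from `j` on.
  have h := sum_range_split n (fun i => if i < j then m i else 0) F
  have e : ∀ S : Finset (Fin n), ∑ i ∈ S, (if i < j then m i else 0) =
      ∑ i ∈ S.filter (· < j), m i := fun S => (Finset.sum_filter _ _).symm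
  have e1 : Finset.univ.filter (· < j) = Finset.Iio j := by ext; simp
  rw [e, e1] at h
  rw [h, ← e1, Finset.sum_filter]
  refine Finset.sum_congr rfl fun i _ => ?_
  split_ifs with hi
  · refine Finset.sum_congr rfl fun p _ => ?_
    rw [e]
    congr 3
    ext q
    simp only [Finset.mem_filter, Finset.mem_Iio]
    exact ⟨fun h => h.1, fun h => ⟨h, h.trans hi⟩⟩
  · simp

theorem graft_leaf (t : PTree V) : t.graft (fun _ => leaf) = t := by
  induction t with
  | leaf => rfl
  | node v n ch ih => simp only [graft, ih]

theorem graft_congr (t : PTree V) {s s' : ℕ → PTree V} (h : ∀ p < t.leaves, s p = s' p) :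
    t.graft s = t.graft s' := by
  induction t generalizing s s' with
  | leaf => exact h 0 (by simp [leaves])
  | node v n ch ih =>
      simp only [graft]
      congr 1
      funext j
      exact ih j fun p hp => h _ (sum_Iio_add_lt (fun q => (ch q).leaves) j hp)

theorem corolla_graft (v : V) (n : ℕ) (s : ℕ → PTree V) :
    (corolla v n).graft s = node v n fun j => s j := by
  simp [corolla, graft, leaves]

theorem leaves_corolla (v : V) (n : ℕ) : (corolla v n).leaves = n := by
  simp [corolla, leaves]

theorem labels_corolla (v : V) (n : ℕ) : (corolla v n).labels = [v] := by
  simp [corolla, labels]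

theorem HasArities.corolla {a : V → ℕ} {v : V} {n : ℕ} (h : n = a v) :
    (corolla v n).HasArities a := ⟨h, fun _ => trivial⟩

/-- The leaf `q` of the tree grafted at position `p` is preceded by all the leaves of the trees at
earlier positions; this is the offset on the right. -/
theorem graft_graft (t : PTree V) (s u : ℕ → PTree V) :
    (t.graft s).graft u =
      t.graft fun p => (s p).graft fun q => u ((∑ p' ∈ Finset.range p, (s p').leaves) + q) := by
  induction t generalizing s u with
  | leaf => simp [graft]
  | node v n ch ih =>
      simp only [graft, ih]
      congr 1
      funext j
      congr 1
      funext p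
      congr 1
      funext q
      congr 1
      rw [Finset.sum_range_add, sum_range_split_Iio]
      simp only [leaves_graft]
      ring

theorem leaves_msubst {a : V → ℕ} {s : V → PTree W} (hs : ∀ v, (s v).leaves = a v) {t : PTree V}
    (ht : t.HasArities a) : (t.msubst s).leaves = t.leaves := by
  induction t with
  | leaf => rfl
  | node v n ch ih =>
      simp only [msubst, leaves_graft, leaves, hs, ← ht.1, Finset.sum_range]
      exact Finset.sum_congr rfl fun j _ => by simp [ih j (ht.2 j)]

theorem sum_range_dite {n : ℕ} {A : Type} (F : A → ℕ) (f : Fin n → A) (z : A) (p : Fin n) :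
    ∑ p' ∈ Finset.range p, F (if hp : p' < n then f ⟨p', hp⟩ else z) =
      ∑ q ∈ Finset.Iio p, F (f q) := by
  rw [← sum_Iio_eq_sum_range (fun p' => F (if hp : p' < n then f ⟨p', hp⟩ else z)) p]
  exact Finset.sum_congr rfl fun q _ => by simp

/-- Substitution preserves the number of leaves of every subtree, so the offsets agree on both
sides. This needs `s v` to have one leaf for each input of `v`: with fewer leaves subtrees would be
lost, with more the surplus would be padded by `leaf`. -/
theorem msubst_graft {a : V → ℕ} {s : V → PTree W} (hs : ∀ v, (s v).leaves = a v) {t : PTree V}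
    (ht : t.HasArities a) (u : ℕ → PTree V) :
    (t.graft u).msubst s = (t.msubst s).graft fun p => (u p).msubst s := by
  induction t generalizing u with
  | leaf => rfl
  | node v n ch ih =>
      simp only [graft, msubst]
      rw [graft_graft]
      refine graft_congr _ fun p hp => ?_
      rw [hs, ← ht.1] at hp
      rw [dif_pos hp, dif_pos hp, ih _ (ht.2 _)]
      congr 1
      funext q
      congr 2
      rw [sum_range_dite PTree.leaves (fun j => (ch j).msubst s) leaf ⟨p, hp⟩]
      congr 1
      exact Finset.sum_congr rfl fun q _ => (leaves_msubst hs (ht.2 q)).symm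

theorem HasArities.msubst {b : W → ℕ} {s : V → PTree W}
    (hb : ∀ v, (s v).HasArities b) (t : PTree V) : (t.msubst s).HasArities b := by
  induction t with
  | leaf => trivial
  | node v n ch ih =>
      refine (hb v).graft fun p => ?_
      split
      · exact ih _
      · trivial

theorem msubst_msubst {b : W → ℕ} {s : V → PTree W} {s' : W → PTree U}
    (hb : ∀ v, (s v).HasArities b) (hs' : ∀ w, (s' w).leaves = b w) (t : PTree V) :
    (t.msubst s).msubst s' = t.msubst fun v => (s v).msubst s' := by
  induction t with
  | leaf => rfl
  | node v n ch ih =>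
      simp only [msubst]
      rw [msubst_graft hs' (hb v)]
      congr 1
      funext p
      split
      · exact ih _
      · rfl

theorem msubst_corolla (s : V → PTree W) (v : V) (n : ℕ) : (corolla v n).msubst s = s v := by
  simp [corolla, msubst, graft_leaf]

theorem map_eq_msubst {a : V → ℕ} (f : V → W) {t : PTree V} (ht : t.HasArities a) :
    t.map f = t.msubst fun v => corolla (f v) (a v) := by
  induction t with
  | leaf => rfl
  | node v n ch ih =>
      obtain rfl := ht.1
      simp only [map, msubst, corolla_graft]
      congr 1
      funext j
      simp [ih j (ht.2 j)]

theorem msubst_congr {s s' : V → PTree W} {t : PTree V} (h : ∀ v ∈ t.labels, s v = s' v) :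
    t.msubst s = t.msubst s' := by
  induction t with
  | leaf => rfl
  | node v n ch ih =>
      simp only [msubst]
      rw [h v (by simp [labels])]
      congr 1
      funext p
      split
      · refine ih _ fun w hw => h w ?_
        simp only [labels, List.mem_cons, List.mem_flatten, List.mem_ofFn]
        exact Or.inr ⟨_, ⟨_, rfl⟩, hw⟩
      · rfl

theorem msubst_map (s : U → PTree W) (f : V → U) (t : PTree V) :
    (t.map f).msubst s = t.msubst fun v => s (f v) := by
  induction t with
  | leaf => rfl
  | node v n ch ih => simp only [map, msubst, ih]

/-- Substituting a corolla for a vertex only renames it, so the replacement of one vertex is a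
replacement of all of them. Partial composition of operadic trees is thereby governed by
`msubst_msubst`. -/
theorem subst_eq_msubst [DecidableEq V] {a : V → ℕ} (i : V) (t₂ : PTree W) (f : ∀ v, v ≠ i → U)
    (g : W → U) {t : PTree V} (ht : t.HasArities a) :
    PTree.subst i t₂ f g t =
      t.msubst fun v => if hv : v = i then t₂.map g else corolla (f v hv) (a v) := by
  induction t with
  | leaf => rfl
  | node v n ch ih =>
      obtain rfl := ht.1
      simp only [subst, msubst]
      by_cases hv : v = i
      · simp only [dif_pos hv]
        congr 1
        funext p
        split
        · exact ih _ (ht.2 _)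
        · rfl
      · simp only [dif_neg hv, corolla_graft]
        congr 1
        funext j
        simp [ih j (ht.2 j)]

theorem count_msubst [DecidableEq W] {a : V → ℕ} {s : V → PTree W} (hs : ∀ v, (s v).leaves = a v)
    (u : W) {t : PTree V} (ht : t.HasArities a) :
    (t.msubst s).labels.count u = (t.labels.map fun v => (s v).labels.count u).sum := by
  induction t with
  | leaf => rfl
  | node v n ch ih =>
      simp only [msubst, count_graft, hs, ← ht.1, labels, List.map_cons, List.sum_cons,
        Finset.sum_range]
      congr 1
      rw [List.map_flatten, List.sum_flatten, List.map_ofFn, List.map_ofFn, List.sum_ofFn]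
      exact Finset.sum_congr rfl fun j _ => by simp [ih j (ht.2 j)]

theorem mem_labels_msubst {a : V → ℕ} {s : V → PTree W} (hs : ∀ v, (s v).leaves = a v)
    {u : W} {t : PTree V} (ht : t.HasArities a) :
    u ∈ (t.msubst s).labels ↔ ∃ v ∈ t.labels, u ∈ (s v).labels := by
  classical
  rw [← List.count_pos_iff, count_msubst hs u ht, List.sum_pos_iff_exists_pos_nat]
  simp

theorem rootLabel_graft {t : PTree V} {v : V} (h : t.rootLabel = some v) (s : ℕ → PTree V) :
    (t.graft s).rootLabel = some v := by
  cases t with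
  | leaf => cases h
  | node w n ch => exact h

theorem rootLabel_msubst {s : V → PTree W} {t : PTree V} {v : V} {w : W}
    (h : t.rootLabel = some v) (hw : (s v).rootLabel = some w) :
    (t.msubst s).rootLabel = some w := by
  cases t with
  | leaf => cases h
  | node v' n ch =>
      obtain rfl : v' = v := Option.some.inj h
      exact rootLabel_graft hw _

theorem mem_labels_of_rootLabel {t : PTree V} {v : V} (h : t.rootLabel = some v) :
    v ∈ t.labels := by
  cases t with
  | leaf => cases h
  | node w n ch =>
      obtain rfl : w = v := Option.some.inj h
      simp [labels]

theorem mem_labels_node {v u : V} {n : ℕ} {ch : Fin n → PTree V} :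
    u ∈ (node v n ch).labels ↔ u = v ∨ ∃ j, u ∈ (ch j).labels := by
  simp only [labels, List.mem_cons, List.mem_flatten, List.mem_ofFn]
  constructor
  · rintro (h | ⟨_, ⟨j, rfl⟩, h⟩)
    · exact Or.inl h
    · exact Or.inr ⟨j, h⟩
  · rintro (h | ⟨j, h⟩)
    · exact Or.inl h
    · exact Or.inr ⟨_, ⟨j, rfl⟩, h⟩

/-! ## The parent relation -/

theorem IsParent.mem_left {t : PTree V} {p x : V} (h : t.IsParent p x) : p ∈ t.labels := by
  induction t with
  | leaf => exact h.elim
  | node v n ch ih =>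
      rw [mem_labels_node]
      rcases h with ⟨rfl, -⟩ | ⟨j, h⟩
      · exact Or.inl rfl
      · exact Or.inr ⟨j, ih j h⟩

theorem IsParent.mem_right {t : PTree V} {p x : V} (h : t.IsParent p x) : x ∈ t.labels := by
  induction t with
  | leaf => exact h.elim
  | node v n ch ih =>
      rw [mem_labels_node]
      rcases h with ⟨-, j, h⟩ | ⟨j, h⟩
      · exact Or.inr ⟨j, mem_labels_of_rootLabel h⟩
      · exact Or.inr ⟨j, ih j h⟩

theorem exists_isParent {t : PTree V} {x : V} (hx : x ∈ t.labels) (hr : t.rootLabel ≠ some x) :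
    ∃ p, t.IsParent p x := by
  induction t with
  | leaf => simp [labels] at hx
  | node v n ch ih =>
      rcases mem_labels_node.1 hx with rfl | ⟨j, hj⟩
      · exact absurd rfl hr
      · by_cases h : (ch j).rootLabel = some x
        · exact ⟨v, Or.inl ⟨rfl, j, h⟩⟩
        · obtain ⟨p, hp⟩ := ih j hj h
          exact ⟨p, Or.inr ⟨j, hp⟩⟩

theorem IsParent.graft_left {t : PTree V} {p x : V} (h : t.IsParent p x) (s : ℕ → PTree V) :
    (t.graft s).IsParent p x := by
  induction t generalizing s with
  | leaf => exact h.elim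
  | node v n ch ih =>
      rcases h with ⟨rfl, j, h⟩ | ⟨j, h⟩
      · exact Or.inl ⟨rfl, j, rootLabel_graft h _⟩
      · exact Or.inr ⟨j, ih j h _⟩

theorem exists_offset {n : ℕ} (m : Fin n → ℕ) {p : ℕ} (hp : p < ∑ j, m j) :
    ∃ (j : Fin n) (q : ℕ), q < m j ∧ p = (∑ i ∈ Finset.Iio j, m i) + q := by
  -- The block of `p` is found by applying `sum_range_split` to the indicator function of `p`: the
  -- total is `1`, but every block would contribute `0`.
  by_contra! hcon
  have h := sum_range_split n m (fun x => if x = p then 1 else 0)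
  rw [Finset.sum_ite_eq' (Finset.range _) p (fun _ => 1), if_pos (Finset.mem_range.2 hp)] at h
  rw [Finset.sum_eq_zero] at h
  · exact one_ne_zero h
  · intro j _
    refine Finset.sum_eq_zero fun q hq => if_neg fun e => ?_
    exact hcon j q (Finset.mem_range.1 hq) e.symm

theorem IsParent.graft_right {t : PTree V} {p x : V} {s : ℕ → PTree V} {j : ℕ}
    (hj : j < t.leaves) (h : (s j).IsParent p x) : (t.graft s).IsParent p x := by
  induction t generalizing s j with
  | leaf =>
      obtain rfl : j = 0 := by simpa [leaves] using hj
      exact h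
  | node v n ch ih =>
      obtain ⟨i, q, hq, rfl⟩ := exists_offset _ hj
      exact Or.inr ⟨i, ih i hq h⟩

theorem IsParent.of_graft {t : PTree V} {p x : V} {s : ℕ → PTree V}
    (h : (t.graft s).IsParent p x) : t.IsParent p x ∨ (∃ j < t.leaves, (s j).IsParent p x) ∨
      ∃ j < t.leaves, (s j).rootLabel = some x := by
  induction t generalizing s with
  | leaf => exact Or.inr (Or.inl ⟨0, by simp [leaves], h⟩)
  | node v n ch ih =>
      rcases h with ⟨rfl, j, h⟩ | ⟨j, h⟩
      · replace h : ((ch j).graft _).rootLabel = some x := h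
        cases hc : ch j with
        | leaf =>
            refine Or.inr (Or.inr ⟨(∑ q ∈ Finset.Iio j, (ch q).leaves) + 0, ?_, ?_⟩)
            · exact sum_Iio_add_lt (fun q => (ch q).leaves) j (by simp [hc, leaves])
            · rw [hc] at h; exact h
        | node w l ch' =>
            rw [hc] at h
            exact Or.inl (Or.inl ⟨rfl, j, by rw [hc]; exact h⟩)
      · rcases ih j h with h | ⟨q, hq, h⟩ | ⟨q, hq, h⟩
        · exact Or.inl (Or.inr ⟨j, h⟩)
        · exact Or.inr (Or.inl ⟨_, sum_Iio_add_lt (fun q => (ch q).leaves) j hq, h⟩)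
        · exact Or.inr (Or.inr ⟨_, sum_Iio_add_lt (fun q => (ch q).leaves) j hq, h⟩)

theorem IsParent.msubst {a : V → ℕ} {s : V → PTree W} (hs : ∀ v, (s v).leaves = a v)
    {t : PTree V} (ht : t.HasArities a) {v : V} (hv : v ∈ t.labels) {p x : W}
    (h : (s v).IsParent p x) : (t.msubst s).IsParent p x := by
  induction t with
  | leaf => simp [labels] at hv
  | node w n ch ih =>
      rcases mem_labels_node.1 hv with rfl | ⟨j, hj⟩
      · exact h.graft_left _
      · refine IsParent.graft_right (j := j) (by rw [hs, ← ht.1]; exact j.2) ?_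
        simpa using ih j (ht.2 j) hj

/-- An edge of the outer tree becomes the edge below the root vertex of a piece and takes its name
from that vertex. No piece is a bare leaf, so the root vertex of a substituted subtree is that of
its lowest piece. -/
theorem IsParent.of_msubst {s : V → PTree W} (hroot : ∀ v, (s v).rootLabel.isSome) {t : PTree V}
    {p x : W} (h : (t.msubst s).IsParent p x) :
    (∃ v ∈ t.labels, (s v).IsParent p x) ∨ ∃ v ∈ t.labels, (s v).rootLabel = some x := by
  induction t with
  | leaf => exact h.elim
  | node w n ch ih =>
      rcases h.of_graft with h | ⟨j, -, h⟩ | ⟨j, -, h⟩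
      · exact Or.inl ⟨w, by simp [labels], h⟩
      · split at h
        · rcases ih _ h with ⟨v, hv, h⟩ | ⟨v, hv, h⟩
          · exact Or.inl ⟨v, mem_labels_node.2 (Or.inr ⟨_, hv⟩), h⟩
          · exact Or.inr ⟨v, mem_labels_node.2 (Or.inr ⟨_, hv⟩), h⟩
        · exact h.elim
      · split at h
        · rename_i hj
          cases hc : ch ⟨j, hj⟩ with
          | leaf => rw [hc] at h; cases h
          | node u l ch' =>
              rw [hc] at h
              obtain ⟨r, hr⟩ := Option.isSome_iff_exists.1 (hroot u)
              have := rootLabel_graft hr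
                (fun p => if hp : p < l then (ch' ⟨p, hp⟩).msubst s else leaf)
              refine Or.inr ⟨u, mem_labels_node.2 (Or.inr ⟨⟨j, hj⟩, ?_⟩), ?_⟩
              · rw [hc]; simp [labels]
              · rw [hr, ← h]; exact this.symm
        · cases h

end PTree

end OInfty

/-! ### Full subtrees, and the connected components of edge-graphs. -/

namespace OInfty

namespace PTree

variable {V W : Type}

theorem rootLabel_ne_of_isParent {t : PTree V} (hn : t.labels.Nodup) {p x : V}
    (h : t.IsParent p x) : t.rootLabel ≠ some x := by
  cases t with
  | leaf => exact h.elim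
  | node v n ch =>
      intro e
      obtain rfl : v = x := Option.some.inj e
      rw [labels, List.nodup_cons] at hn
      apply hn.1
      rw [List.mem_flatten]
      rcases h with ⟨-, j, h⟩ | ⟨j, h⟩
      · exact ⟨_, List.mem_ofFn.2 ⟨j, rfl⟩, mem_labels_of_rootLabel h⟩
      · exact ⟨_, List.mem_ofFn.2 ⟨j, rfl⟩, h.mem_right⟩

/-- `S` is a full subtree of `A`: the parents of the vertices of `S` other than its root vertex
are the same in `S` and in `A`. -/
def Sub (S A : PTree V) : Prop :=
  ∀ x ∈ S.labels, S.rootLabel ≠ some x → ∀ p, A.IsParent p x ↔ S.IsParent p x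

theorem Sub.refl (S : PTree V) : S.Sub S := fun _ _ _ _ => Iff.rfl

/-- As labels are distinct in `B`, a vertex with a parent in `B` cannot be labelled like the root of
`B`, so the second inclusion applies to it. -/
theorem Sub.trans {S B A : PTree V} (h₁ : S.Sub B) (h₂ : B.Sub A) (hn : B.labels.Nodup) :
    S.Sub A := by
  intro x hx hr p
  obtain ⟨q, hq⟩ := exists_isParent hx hr
  have hq' := (h₁ x hx hr q).2 hq
  rw [← h₁ x hx hr p]
  exact h₂ x hq'.mem_right (rootLabel_ne_of_isParent hn hq') p

/-- The internal edges of a tree, named by their upper vertices. -/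
def edges [DecidableEq V] (S : PTree V) : Finset V :=
  S.labels.toFinset.filter fun v => S.rootLabel ≠ some v

theorem mem_edges [DecidableEq V] {S : PTree V} {v : V} :
    v ∈ S.edges ↔ v ∈ S.labels ∧ S.rootLabel ≠ some v := by
  simp [edges]

theorem mem_edges_iff_isParent [DecidableEq V] {S : PTree V} (hn : S.labels.Nodup) {v : V} :
    v ∈ S.edges ↔ ∃ p, S.IsParent p v := by
  rw [mem_edges]
  constructor
  · rintro ⟨h, hr⟩
    exact exists_isParent h hr
  · rintro ⟨p, hp⟩
    exact ⟨hp.mem_right, rootLabel_ne_of_isParent hn hp⟩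

theorem prop_iff_root {P : V → Prop} {S : PTree V} (h : ∀ p x, S.IsParent p x → (P p ↔ P x))
    {w x : V} (hw : S.rootLabel = some w) (hx : x ∈ S.labels) : P w ↔ P x := by
  induction S generalizing w with
  | leaf => cases hw
  | node v n ch ih =>
      obtain rfl : v = w := Option.some.inj hw
      rcases mem_labels_node.1 hx with rfl | ⟨j, hj⟩
      · exact Iff.rfl
      · cases hc : (ch j).rootLabel with
        | none =>
            cases hc' : ch j with
            | leaf => rw [hc'] at hj; simp [labels] at hj
            | node _ _ _ => rw [hc'] at hc; cases hc
        | some u =>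
            rw [h v u (Or.inl ⟨rfl, j, hc⟩)]
            exact ih j (fun p x hp => h p x (Or.inr ⟨j, hp⟩)) hc hj

/-- This is the connectedness of the edge-graph of a tree in elementary form: a predicate that
cannot tell apart siblings, nor an edge from the one below it, is constant on edges. Each edge is
compared with the edge at the root vertex that lies below it. -/
theorem prop_iff_of_isParent {P : V → Prop} {S : PTree V}
    (h₁ : ∀ p x y, S.IsParent p x → S.IsParent p y → (P x ↔ P y))
    (h₂ : ∀ q p x, S.IsParent q p → S.IsParent p x → (P p ↔ P x))
    {p x q y : V} (hx : S.IsParent p x) (hy : S.IsParent q y) : P x ↔ P y := by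
  cases S with
  | leaf => exact hx.elim
  | node v n ch =>
      have key : ∀ x p, (node v n ch).IsParent p x → ∃ w, (node v n ch).IsParent v w ∧
          (P w ↔ P x) := by
        intro x p hp
        have : ∃ j, x ∈ (ch j).labels := by
          rcases hp with ⟨-, j, h⟩ | ⟨j, h⟩
          · exact ⟨j, mem_labels_of_rootLabel h⟩
          · exact ⟨j, h.mem_right⟩
        obtain ⟨j, hj⟩ := this
        cases hc : (ch j).rootLabel with
        | none =>
            cases hc' : ch j with
            | leaf => rw [hc'] at hj; simp [labels] at hj
            | node _ _ _ => rw [hc'] at hc; cases hc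
        | some u =>
            refine ⟨u, Or.inl ⟨rfl, j, hc⟩, prop_iff_root (S := ch j) ?_ hc hj⟩
            intro p' x' h'
            by_cases hr : (ch j).rootLabel = some p'
            · exact h₂ v p' x' (Or.inl ⟨rfl, j, hr⟩) (Or.inr ⟨j, h'⟩)
            · obtain ⟨q', hq'⟩ := exists_isParent h'.mem_left hr
              exact h₂ q' p' x' (Or.inr ⟨j, hq'⟩) (Or.inr ⟨j, h'⟩)
      obtain ⟨w, hw, e⟩ := key x p hx
      obtain ⟨w', hw', e'⟩ := key y q hy
      rw [← e, ← e']
      exact h₁ v w w' hw hw'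

/-- The multiplicity of a label is the sum of its multiplicities in the pieces, and two pieces
containing it would contribute at least `2`. -/
theorem disjoint_of_nodup_msubst {a : V → ℕ} {s : V → PTree W} (hs : ∀ v, (s v).leaves = a v)
    {t : PTree V} (ht : t.HasArities a) (hn : (t.msubst s).labels.Nodup) {v v' : V}
    (hv : v ∈ t.labels) (hv' : v' ∈ t.labels) {x : W} (hx : x ∈ (s v).labels)
    (hx' : x ∈ (s v').labels) : v = v' := by
  classical
  by_contra hne
  have h := List.nodup_iff_count_le_one.1 hn x
  rw [count_msubst hs x ht] at h
  have h1 := List.count_pos_iff.2 hx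
  have h2 := List.count_pos_iff.2 hx'
  have hp := (List.perm_cons_erase hv).map (fun v => (s v).labels.count x)
  have hp' := (List.perm_cons_erase ((List.mem_erase_of_ne (Ne.symm hne)).2 hv')).map
    (fun v => (s v).labels.count x)
  rw [hp.sum_eq, List.map_cons, List.sum_cons, hp'.sum_eq, List.map_cons, List.sum_cons] at h
  omega

theorem nodup_of_nodup_msubst {a : V → ℕ} {s : V → PTree W} (hs : ∀ v, (s v).leaves = a v)
    {t : PTree V} (ht : t.HasArities a) (hn : (t.msubst s).labels.Nodup) {v : V}
    (hv : v ∈ t.labels) : (s v).labels.Nodup := by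
  classical
  refine List.nodup_iff_count_le_one.2 fun x => ?_
  refine le_trans ?_ (List.nodup_iff_count_le_one.1 hn x)
  rw [count_msubst hs x ht]
  exact List.single_le_sum (by simp) _ (List.mem_map.2 ⟨v, hv, rfl⟩)

/-- An edge below `x` that did not come from the piece `s v` would lie in another piece or below the
root of one; both are excluded, as `x` occurs in `s v` only and is not its root. -/
theorem sub_msubst {a : V → ℕ} {s : V → PTree W} (hs : ∀ v, (s v).leaves = a v)
    (hroot : ∀ v, (s v).rootLabel.isSome) {t : PTree V} (ht : t.HasArities a)
    (hn : (t.msubst s).labels.Nodup) {v : V} (hv : v ∈ t.labels) :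
    (s v).Sub (t.msubst s) := by
  intro x hx hr p
  refine ⟨fun h => ?_, fun h => h.msubst hs ht hv⟩
  rcases h.of_msubst hroot with ⟨v', hv', h⟩ | ⟨v', hv', h⟩
  · rwa [disjoint_of_nodup_msubst hs ht hn hv hv' hx h.mem_right]
  · rw [disjoint_of_nodup_msubst hs ht hn hv hv' hx (mem_labels_of_rootLabel h)] at hr
    exact absurd h hr

theorem edges_corolla [DecidableEq V] (v : V) (n : ℕ) : (corolla v n).edges = ∅ := by
  ext x
  simp only [mem_edges, labels_corolla, List.mem_singleton, Finset.notMem_empty, iff_false,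
    not_and, not_not]
  rintro rfl
  rfl

end PTree

namespace Hypergraph

variable {E : Type} {H : Hypergraph E}

/-- If `K` were not contained in `L`, then `K ∩ L` and `K \ L` would be a partition of `K` that no
hyperedge crosses, since `L` is closed under hyperedges. -/
theorem IsComponent.eq_of_inter {X K L : Finset E} (hK : H.IsComponent X K)
    (hL : H.IsComponent X L) {x : E} (hx : x ∈ K) (hx' : x ∈ L) : K = L := by
  classical
  have key : ∀ K L : Finset E, H.IsComponent X K → H.IsComponent X L → x ∈ K → x ∈ L →
      K ⊆ L := by
    intro K L hK hL hx hx' y hy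
    by_contra hyL
    obtain ⟨Z, hZ, hZK, h₁, h₂⟩ := hK.connected.2 (K ∩ L) (K \ L)
      ⟨x, Finset.mem_inter.2 ⟨hx, hx'⟩⟩ ⟨y, Finset.mem_sdiff.2 ⟨hy, hyL⟩⟩
      (Finset.disjoint_left.2 fun z hz hz' =>
        (Finset.mem_sdiff.1 hz').2 (Finset.mem_inter.1 hz).2)
      (fun z => by simp only [Finset.mem_inter, Finset.mem_sdiff]; tauto)
    rcases hL.closed Z hZ (hZK.trans hK.subset) with h | h
    · exact h₁ (Finset.subset_inter hZK h)
    · exact h₂ fun z hz => Finset.mem_sdiff.2 ⟨hZK hz, Finset.disjoint_left.1 h hz⟩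
  exact (key K L hK hL hx hx').antisymm (key L K hL hK hx' hx)

theorem isComponent_iff_of_partition {ι : Type} {X : Finset E} (F : ι → Finset E)
    (hX : ∀ x, x ∈ X ↔ ∃ q, x ∈ F q) (hdisj : ∀ q q' x, x ∈ F q → x ∈ F q' → q = q')
    (hconn : ∀ q, (F q).Nonempty → H.IsConnected (F q))
    (hedge : ∀ Z ∈ H.hyperedges, Z ⊆ X → ∃ q, Z ⊆ F q) (K : Finset E) :
    H.IsComponent X K ↔ K.Nonempty ∧ ∃ q, K = F q := by
  have key : ∀ q, (F q).Nonempty → H.IsComponent X (F q) := by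
    intro q hq
    refine ⟨fun x hx => (hX x).2 ⟨q, hx⟩, hconn q hq, fun Z hZ hZX => ?_⟩
    obtain ⟨q', hq'⟩ := hedge Z hZ hZX
    by_cases h : q = q'
    · subst h; exact Or.inl hq'
    · exact Or.inr (Finset.disjoint_left.2 fun x hx hx' => h (hdisj q q' x hx' (hq' hx)))
  constructor
  · intro hK
    obtain ⟨x, hx⟩ := hK.connected.1
    obtain ⟨q, hq⟩ := (hX x).1 (hK.subset hx)
    exact ⟨⟨x, hx⟩, q, hK.eq_of_inter (key q ⟨x, hq⟩) hx hq⟩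
  · rintro ⟨hne, q, rfl⟩
    exact key q hne

end Hypergraph

namespace OpTree

variable {k : ℕ} {c : Fin k → ℕ+} {d : ℕ+}

theorem nodup_labels (A : OpTree c d) : A.tree.labels.Nodup :=
  List.nodup_iff_count_le_one.2 fun v => (A.bij v).le

theorem mem_labels (A : OpTree c d) (v : Fin k) : v ∈ A.tree.labels :=
  List.count_pos_iff.1 (by rw [A.bij v]; exact one_pos)

theorem edges_eq (A : OpTree c d) : A.edges = A.tree.edges := by
  ext v
  simp only [edges, Finset.mem_erase, Finset.mem_univ, and_true, PTree.mem_edges, A.mem_labels,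
    true_and, A.rootLabel_eq, ne_eq, Option.some.injEq]
  exact ⟨fun h e => h e.symm, fun h e => h e.symm⟩

theorem edges_subset_of_sub (A : OpTree c d) {S : PTree (Fin k)} (hS : S.Sub A.tree) :
    S.edges ⊆ A.edges := by
  intro x hx
  rw [PTree.mem_edges] at hx
  obtain ⟨p, hp⟩ := PTree.exists_isParent hx.1 hx.2
  rw [edges_eq, PTree.mem_edges_iff_isParent A.nodup_labels]
  exact ⟨p, (hS x hx.1 hx.2 p).2 hp⟩

/-- Membership in one half of a partition that no hyperedge crosses is a predicate invariant under
adjacency, hence constant on the edges of `S`. -/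
theorem isConnected_edges (A : OpTree c d) {S : PTree (Fin k)} (hS : S.Sub A.tree)
    (hn : S.labels.Nodup) (hne : S.edges.Nonempty) : A.edgeGraph.IsConnected S.edges := by
  refine ⟨hne, fun P Q hP hQ hd hPQ => ?_⟩
  by_contra! hcon
  have hpair : ∀ x ∈ S.edges, ∀ y ∈ S.edges, (∃ v, A.Adjacent v x ∧ A.Adjacent v y) →
      (x ∈ P ↔ y ∈ P) := by
    intro x hx y hy hv
    by_cases hxy : x = y
    · rw [hxy]
    have hsub : ({x, y} : Finset (Fin k)) ⊆ S.edges := by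
      intro z hz
      rcases Finset.mem_insert.1 hz with rfl | hz
      · exact hx
      · rwa [Finset.mem_singleton.1 hz]
    have hA := A.edges_subset_of_sub hS
    have h := hcon {x, y} (Or.inr ⟨x, hA hx, y, hA hy, hxy, hv, rfl⟩) hsub
    by_cases hP' : ({x, y} : Finset (Fin k)) ⊆ P
    · exact ⟨fun _ => hP' (by simp), fun _ => hP' (by simp)⟩
    · have hQ' := h hP'
      have h1 : x ∈ Q := hQ' (by simp)
      have h2 : y ∈ Q := hQ' (by simp)
      exact ⟨fun h => absurd h1 (Finset.disjoint_left.1 hd h),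
        fun h => absurd h2 (Finset.disjoint_left.1 hd h)⟩
  have hmem : ∀ {p x}, S.IsParent p x → x ∈ S.edges := fun h =>
    (PTree.mem_edges_iff_isParent hn).2 ⟨_, h⟩
  have hadj : ∀ {p x}, S.IsParent p x → A.Adjacent p x := fun h => by
    have := PTree.mem_edges.1 (hmem h)
    exact Or.inr ((hS _ this.1 this.2 _).2 h)
  obtain ⟨x, hx⟩ := hP
  obtain ⟨y, hy⟩ := hQ
  obtain ⟨p, hp⟩ := (PTree.mem_edges_iff_isParent hn).1 ((hPQ x).2 (Or.inl hx))
  obtain ⟨q, hq⟩ := (PTree.mem_edges_iff_isParent hn).1 ((hPQ y).2 (Or.inr hy))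
  have := PTree.prop_iff_of_isParent (P := (· ∈ P)) (S := S)
    (fun p x y hx hy => hpair x (hmem hx) y (hmem hy) ⟨p, hadj hx, hadj hy⟩)
    (fun q p x hp hx => hpair p (hmem hp) x (hmem hx) ⟨p, Or.inl rfl, hadj hx⟩) hp hq
  exact Finset.disjoint_left.1 hd (this.1 hx) hy

/-- Pieces are full subtrees, so both ends of an edge of a piece belong to the piece. Adjacent edges
from two pieces would share a vertex of both, contradicting the distinctness of labels. So no
hyperedge joins two pieces, and each piece is connected. -/
theorem isComponent_edgeGraph_iff (A : OpTree c d) {m : ℕ} {a : Fin m → ℕ}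
    {s : Fin m → PTree (Fin k)} (hs : ∀ q, (s q).leaves = a q)
    (hroot : ∀ q, (s q).rootLabel.isSome) {T : PTree (Fin m)} (hT : T.HasArities a)
    (hmem : ∀ q, q ∈ T.labels) (hn : (T.msubst s).labels.Nodup)
    (hA : (T.msubst s).Sub A.tree) {X : Finset (Fin k)}
    (hX : ∀ x, x ∈ X ↔ ∃ q, x ∈ (s q).edges) (K : Finset (Fin k)) :
    A.edgeGraph.IsComponent X K ↔ K.Nonempty ∧ ∃ q, K = (s q).edges := by
  have hsub : ∀ q, (s q).Sub A.tree := fun q =>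
    (PTree.sub_msubst hs hroot hT hn (hmem q)).trans hA hn
  have hdisj : ∀ q q' x, x ∈ (s q).labels → x ∈ (s q').labels → q = q' := fun q q' x hx hx' =>
    PTree.disjoint_of_nodup_msubst hs hT hn (hmem q) (hmem q') hx hx'
  refine Hypergraph.isComponent_iff_of_partition (fun q => (s q).edges) hX ?_ ?_ ?_ K
  · exact fun q q' x hx hx' => hdisj q q' x (PTree.mem_edges.1 hx).1 (PTree.mem_edges.1 hx').1
  · exact fun q hq => A.isConnected_edges (hsub q)
      (PTree.nodup_of_nodup_msubst hs hT hn (hmem q)) hq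
  · rintro Z (⟨x, -, rfl⟩ | ⟨x, -, y, -, -, ⟨v, hvx, hvy⟩, rfl⟩) hZ
    · obtain ⟨q, hq⟩ := (hX x).1 (hZ (by simp))
      exact ⟨q, by simpa using hq⟩
    · obtain ⟨q, hq⟩ := (hX x).1 (hZ (by simp))
      obtain ⟨q', hq'⟩ := (hX y).1 (hZ (by simp))
      have key : ∀ q x, x ∈ (s q).edges → A.Adjacent v x → v ∈ (s q).labels := by
        intro q x hx hv
        rw [PTree.mem_edges] at hx
        rcases hv with rfl | hv
        · exact hx.1
        · exact ((hsub q x hx.1 hx.2 v).1 hv).mem_left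
      obtain rfl := hdisj q q' v (key q x hq hvx) (key q' y hq' hvy)
      refine ⟨q, fun z hz => ?_⟩
      rcases Finset.mem_insert.1 hz with rfl | hz
      · exact hq
      · rwa [Finset.mem_singleton.1 hz]

end OpTree

end OInfty

/-! ### From decorated trees to operadic trees with constructs. -/

namespace OInfty

namespace PTree

variable {V W : Type}

theorem rootLabel_msubst_isSome {s : V → PTree W} (hroot : ∀ v, (s v).rootLabel.isSome)
    {t : PTree V} (h : t.rootLabel.isSome) : (t.msubst s).rootLabel.isSome := by
  obtain ⟨v, hv⟩ := Option.isSome_iff_exists.1 h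
  obtain ⟨w, hw⟩ := Option.isSome_iff_exists.1 (hroot v)
  rw [rootLabel_msubst hv hw]; rfl

/-- Edges are named by their upper vertices: an edge between two pieces bears the name of the root
of the upper one, and an edge inside a piece never bears the name of a root. -/
theorem mem_edges_msubst [DecidableEq W] {a : V → ℕ} {s : V → PTree W}
    (hs : ∀ v, (s v).leaves = a v) (hroot : ∀ v, (s v).rootLabel.isSome) {t : PTree V}
    (ht : t.HasArities a) (hmem : ∀ v, v ∈ t.labels) (hn : (t.msubst s).labels.Nodup) (x : W) :
    (x ∈ (t.msubst s).edges ∧ ¬ ∃ v, (s v).rootLabel = some x) ↔ ∃ v, x ∈ (s v).edges := by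
  constructor
  · rintro ⟨hx, hr⟩
    obtain ⟨v, -, hv⟩ := (mem_labels_msubst hs ht).1 (mem_edges.1 hx).1
    exact ⟨v, mem_edges.2 ⟨hv, fun e => hr ⟨v, e⟩⟩⟩
  · rintro ⟨v, hv⟩
    rw [mem_edges] at hv
    have hnr : ¬ ∃ v, (s v).rootLabel = some x := by
      rintro ⟨v', hv'⟩
      obtain rfl := disjoint_of_nodup_msubst hs ht hn (hmem v) (hmem v') hv.1
        (mem_labels_of_rootLabel hv')
      exact hv.2 hv'
    refine ⟨mem_edges.2 ⟨(mem_labels_msubst hs ht).2 ⟨v, hmem v, hv.1⟩, fun e => hnr ?_⟩, hnr⟩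
    cases t with
    | leaf => cases e
    | node w n ch =>
        obtain ⟨r, hr⟩ := Option.isSome_iff_exists.1 (hroot w)
        have : ((node w n ch).msubst s).rootLabel = some r :=
          rootLabel_msubst (t := node w n ch) rfl hr
        exact ⟨w, by rw [hr, ← this, e]⟩

end PTree

namespace FTree

variable {k l r : ℕ} {c : Fin k → ℕ+} {b : Fin l → ℕ+} {a : Fin r → ℕ+} {d e : ℕ+}

/-- The operadic tree that is obtained from a decorated tree by substituting the decorations
into each other. -/
def flat : ∀ {d : ℕ+}, FTree c d → PTree (Fin k)
  | _, leaf i => PTree.corolla i (c i)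
  | _, node T _ _ ch => T.tree.msubst fun q => (ch q).flat

theorem leaves_flat (t : FTree c d) : t.flat.leaves = d := by
  induction t with
  | leaf i => exact PTree.leaves_corolla _ _
  | node T hm hT ch ih =>
      rw [flat, PTree.leaves_msubst ih T.arities, T.leaves]

theorem hasArities_flat (t : FTree c d) : t.flat.HasArities fun i => (c i : ℕ) := by
  induction t with
  | leaf i => exact PTree.HasArities.corolla rfl
  | node T hm hT ch ih => exact PTree.HasArities.msubst ih _

theorem isSome_flat (t : FTree c d) : t.flat.rootLabel.isSome := by
  induction t with
  | leaf i => rfl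
  | node T hm hT ch ih => exact PTree.rootLabel_msubst_isSome ih T.isSome

theorem count_flat (t : FTree c d) (v : Fin k) : t.flat.labels.count v = t.leafCount v := by
  induction t with
  | leaf i => simp [flat, PTree.labels_corolla, leafCount, List.count_singleton]
  | node T hm hT ch ih =>
      rw [flat, PTree.count_msubst (fun q => (ch q).leaves_flat) v T.arities,
        T.sum_labels, leafCount]
      exact Finset.sum_congr rfl fun q _ => ih q

theorem flat_cast (h : d = e) (t : FTree c d) : (t.cast h).flat = t.flat := by
  subst h; rfl

/-- A leaf flattens to a corolla whose vertex carries the label of the leaf, so grafting at the leaf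
becomes substitution for that vertex; the rest is associativity of substitution. -/
theorem flat_bind (s : ∀ j : Fin k, FTree b (c j)) (t : FTree c d) :
    (t.bind s).flat = t.flat.msubst fun j => (s j).flat := by
  induction t with
  | leaf i => rw [bind, flat, PTree.msubst_corolla]
  | node T hm hT ch ih =>
      simp only [bind, flat, ih]
      rw [PTree.msubst_msubst (fun q => (ch q).hasArities_flat) fun j => (s j).leaves_flat]

/-- The number of vertices. -/
def numNodes : ∀ {d : ℕ+}, FTree c d → ℕ
  | _, leaf _ => 0
  | _, node _ _ _ ch => 1 + ∑ q, (ch q).numNodes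

/-- The construct `C` of the set of edges `X` of the operadic tree `t.flat` is the one that is
given by the decorated tree `t`: the root of `C` is decorated by those edges that are not edges of
the subtrees given by the inputs of the root vertex of `t`. -/
def IsCon (H : Hypergraph (Fin k)) : ∀ {d : ℕ+}, FTree c d → ∀ X, Construct H X → Prop
  | _, leaf _, _, _ => False
  | _, node _ _ _ ch, X, Construct.mk Y _ _ sub =>
      (∀ y, y ∈ Y ↔ y ∈ X ∧ ∃ q, (ch q).flat.rootLabel = some y) ∧
      ∀ q K hK, K = (ch q).flat.edges → (ch q).IsCon H K (sub K hK)

/-- The tree `t.flat` is a full subtree of `A`. -/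
structure FullIn (t : FTree c d) {a : Fin k → ℕ+} {e : ℕ+} (A : OpTree a e) : Prop where
  nodup : t.flat.labels.Nodup
  sub : t.flat.Sub A.tree

section Node

variable {m : ℕ} {a₀ : Fin m → ℕ+} {T : OpTree a₀ d} {hm : 2 ≤ m} {hT : T.IsLeftRecursive}
  {ch : ∀ q : Fin m, FTree c (a₀ q)} {a : Fin k → ℕ+} {A : OpTree a e}

theorem FullIn.child (h : (node T hm hT ch).FullIn A) (q : Fin m) : (ch q).FullIn A where
  nodup := PTree.nodup_of_nodup_msubst (fun q => (ch q).leaves_flat) T.arities h.nodup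
    (T.mem_labels q)
  sub := (PTree.sub_msubst (fun q => (ch q).leaves_flat) (fun q => (ch q).isSome_flat) T.arities
    h.nodup (T.mem_labels q)).trans h.sub h.nodup

theorem mem_labels_node (x : Fin k) :
    x ∈ (node T hm hT ch).flat.labels ↔ ∃ q, x ∈ (ch q).flat.labels := by
  rw [flat, PTree.mem_labels_msubst (fun q => (ch q).leaves_flat) T.arities]
  simp [T.mem_labels]

theorem disjoint_of_nodup (h : (node T hm hT ch).flat.labels.Nodup) {q q' : Fin m} {x : Fin k}
    (hx : x ∈ (ch q).flat.labels) (hx' : x ∈ (ch q').flat.labels) : q = q' :=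
  PTree.disjoint_of_nodup_msubst (fun q => (ch q).leaves_flat) T.arities h (T.mem_labels q)
    (T.mem_labels q') hx hx'

theorem mem_edges_sdiff (h : (node T hm hT ch).flat.labels.Nodup) {X Y : Finset (Fin k)}
    (hX : X = (node T hm hT ch).flat.edges)
    (hY : ∀ y, y ∈ Y ↔ y ∈ X ∧ ∃ q, (ch q).flat.rootLabel = some y) (x : Fin k) :
    x ∈ X \ Y ↔ ∃ q, x ∈ (ch q).flat.edges := by
  rw [← PTree.mem_edges_msubst (fun q => (ch q).leaves_flat) (fun q => (ch q).isSome_flat)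
    T.arities T.mem_labels h x, Finset.mem_sdiff, hY, hX]
  rw [flat]
  tauto

theorem isComponent_iff (h : (node T hm hT ch).FullIn A) {X Y : Finset (Fin k)}
    (hX : X = (node T hm hT ch).flat.edges)
    (hY : ∀ y, y ∈ Y ↔ y ∈ X ∧ ∃ q, (ch q).flat.rootLabel = some y) (K : Finset (Fin k)) :
    A.edgeGraph.IsComponent (X \ Y) K ↔ K.Nonempty ∧ ∃ q, K = (ch q).flat.edges :=
  A.isComponent_edgeGraph_iff (fun q => (ch q).leaves_flat) (fun q => (ch q).isSome_flat)
    T.arities T.mem_labels h.nodup h.sub (mem_edges_sdiff h.nodup hX hY) K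

theorem rootLabel_node : (node T hm hT ch).flat.rootLabel = (ch T.root).flat.rootLabel := by
  obtain ⟨r, hr⟩ := Option.isSome_iff_exists.1 (ch T.root).isSome_flat
  rw [hr, flat, PTree.rootLabel_msubst T.rootLabel_eq hr]

theorem rootLabel_mem_edges (h : (node T hm hT ch).flat.labels.Nodup) {q : Fin m} {y : Fin k}
    (hq : q ≠ T.root) (hy : (ch q).flat.rootLabel = some y) :
    y ∈ (node T hm hT ch).flat.edges := by
  refine PTree.mem_edges.2 ⟨(mem_labels_node y).2 ⟨q, PTree.mem_labels_of_rootLabel hy⟩,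
    fun e => hq ?_⟩
  rw [rootLabel_node] at e
  exact disjoint_of_nodup h (PTree.mem_labels_of_rootLabel hy) (PTree.mem_labels_of_rootLabel e)

/-- The decoration has at least two vertices, so some child is not placed at its root vertex, and
the root of that child is an edge. Hence only leaves have flattenings without edges. -/
theorem exists_root_edge (h : (node T hm hT ch).flat.labels.Nodup) :
    ∃ y ∈ (node T hm hT ch).flat.edges, ∃ q, (ch q).flat.rootLabel = some y := by
  have : Nontrivial (Fin m) := Fin.nontrivial_iff_two_le.2 hm
  obtain ⟨q, hq⟩ := exists_ne T.root
  obtain ⟨y, hy⟩ := Option.isSome_iff_exists.1 (ch q).isSome_flat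
  exact ⟨y, rootLabel_mem_edges h hq hy, q, hy⟩

end Node

theorem numNodes_eq_zero {t : FTree c d} (hn : t.flat.labels.Nodup)
    (h : ¬ t.flat.edges.Nonempty) : t.numNodes = 0 := by
  cases t with
  | leaf i => rfl
  | node T hm hT ch =>
      obtain ⟨y, hy, -⟩ := exists_root_edge hn
      exact absurd ⟨y, hy⟩ h

theorem IsCon.unique {a : Fin k → ℕ+} {A : OpTree a e} {t : FTree c d} (ht : t.FullIn A)
    {X : Finset (Fin k)} (hX : X = t.flat.edges) {C C' : Construct A.edgeGraph X}
    (h : t.IsCon A.edgeGraph X C) (h' : t.IsCon A.edgeGraph X C') : C = C' := by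
  induction t generalizing X with
  | leaf i => exact h.elim
  | node T hm hT ch ih =>
      obtain ⟨Y, hne, hsub, sub⟩ := C
      obtain ⟨Y', hne', hsub', sub'⟩ := C'
      obtain ⟨h1, h2⟩ := h
      obtain ⟨h1', h2'⟩ := h'
      obtain rfl : Y = Y' := by ext y; rw [h1, h1']
      congr 1
      funext K hK
      obtain ⟨-, q, hq⟩ := (isComponent_iff ht hX h1 K).1 hK
      exact ih q (ht.child q) hq (h2 q K hK hq) (h2' q K hK hq)

theorem exists_isCon {a : Fin k → ℕ+} {A : OpTree a e} {t : FTree c d} (ht : t.FullIn A)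
    {X : Finset (Fin k)} (hX : X = t.flat.edges) (hne : X.Nonempty) :
    ∃ C : Construct A.edgeGraph X, t.IsCon A.edgeGraph X C := by
  classical
  induction t generalizing X with
  | leaf i =>
      rw [hX, flat, PTree.edges_corolla] at hne
      exact absurd hne Finset.not_nonempty_empty
  | node T hm hT ch ih =>
      let Y := X.filter fun y => ∃ q, (ch q).flat.rootLabel = some y
      have hY : ∀ y, y ∈ Y ↔ y ∈ X ∧ ∃ q, (ch q).flat.rootLabel = some y := fun y =>
        Finset.mem_filter
      have key : ∀ K, A.edgeGraph.IsComponent (X \ Y) K → ∃ C : Construct A.edgeGraph K,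
          ∀ q, K = (ch q).flat.edges → (ch q).IsCon A.edgeGraph K C := by
        intro K hK
        obtain ⟨hKne, q, hq⟩ := (isComponent_iff ht hX hY K).1 hK
        obtain ⟨C, hC⟩ := ih q (ht.child q) hq hKne
        refine ⟨C, fun q' hq' => ?_⟩
        -- A component is non-empty and therefore belongs to only one child, so the chosen `C`
        -- serves every `q'`.
        obtain ⟨x, hx⟩ := hKne
        have e1 := hx
        have e2 := hx
        rw [hq] at e1
        rw [hq'] at e2
        obtain rfl := disjoint_of_nodup ht.nodup (PTree.mem_edges.1 e1).1 (PTree.mem_edges.1 e2).1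
        exact hC
      choose sub hsub using key
      obtain ⟨y, hy, q, hq⟩ := exists_root_edge ht.nodup
      exact ⟨Construct.mk Y ⟨y, (hY y).2 ⟨hX ▸ hy, q, hq⟩⟩ (Finset.filter_subset _ _) sub, hY,
        fun q K hK hq => hsub K hK q hq⟩

theorem IsCon.numVerts {a : Fin k → ℕ+} {A : OpTree a e} {t : FTree c d} (ht : t.FullIn A)
    {X : Finset (Fin k)} (hX : X = t.flat.edges) {C : Construct A.edgeGraph X}
    (h : t.IsCon A.edgeGraph X C) : C.numVerts = t.numNodes := by
  classical
  induction t generalizing X with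
  | leaf i => exact h.elim
  | node T hm hT ch ih =>
      obtain ⟨Y, hne, hsub, sub⟩ := C
      obtain ⟨h1, h2⟩ := h
      rw [Construct.numVerts, numNodes]
      congr 1
      have hc := isComponent_iff ht hX h1
      -- Components correspond to the children with edges; the other children are leaves, which have
      -- no vertices and give no component.
      rw [← Finset.sum_filter_add_sum_filter_not Finset.univ (fun q => (ch q).flat.edges.Nonempty)
        (fun q => (ch q).numNodes)]
      rw [Finset.sum_eq_zero (s := Finset.univ.filter fun q => ¬ (ch q).flat.edges.Nonempty),
        add_zero]
      · symm
        refine Finset.sum_of_injOn (fun q => (ch q).flat.edges) ?_ ?_ ?_ ?_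
        · intro q hq q' hq' e
          obtain ⟨x, hx⟩ := (Finset.mem_filter.1 hq).2
          have hx' := hx
          simp only at e
          rw [e] at hx'
          exact disjoint_of_nodup ht.nodup (PTree.mem_edges.1 hx).1 (PTree.mem_edges.1 hx').1
        · intro q hq
          exact Finset.mem_coe.2 (Finset.mem_powerset.2
            ((hc _).2 ⟨(Finset.mem_filter.1 hq).2, q, rfl⟩).subset)
        · intro K _ hK
          rw [dif_neg]
          intro hK'
          obtain ⟨hne, q, rfl⟩ := (hc K).1 hK'
          exact hK ⟨q, by simpa using hne, rfl⟩
        · intro q hq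
          have hK := (hc _).2 ⟨(Finset.mem_filter.1 hq).2, q, rfl⟩
          rw [dif_pos hK]
          exact (ih q (ht.child q) rfl (h2 q _ hK rfl)).symm
      · intro q hq
        exact numNodes_eq_zero (ht.child q).nodup (Finset.mem_filter.1 hq).2

end FTree

end OInfty

/-! ### Unique reading of lists, and relabelling of trees. -/

namespace OInfty

/-- If each block can be split off from whatever follows it, then so can a sequence of blocks.
Allowing arbitrary tails is what makes inductions over trees go through. -/
theorem flatten_ofFn_append_cancel {α : Type*} : ∀ (n : ℕ) (A A' : Fin n → List α)
    (P : Fin n → Prop), (∀ j r r', A j ++ r = A' j ++ r' → P j ∧ r = r') → ∀ r r',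
    (List.ofFn A).flatten ++ r = (List.ofFn A').flatten ++ r' → (∀ j, P j) ∧ r = r'
  | 0, _, _, _, _, _, _, h => ⟨fun j => j.elim0, by simpa using h⟩
  | n + 1, A, A', P, hP, r, r', h => by
      rw [List.ofFn_succ, List.ofFn_succ, List.flatten_cons, List.flatten_cons, List.append_assoc,
        List.append_assoc] at h
      obtain ⟨h0, h⟩ := hP 0 _ _ h
      obtain ⟨h1, h⟩ := flatten_ofFn_append_cancel n _ _ (fun j => P j.succ)
        (fun j => hP j.succ) _ _ h
      exact ⟨Fin.cases h0 h1, h⟩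

theorem exists_eq_flatten_of_map {α β : Type*} (f : α → β) : ∀ (n : ℕ) (A : Fin n → List β)
    (l : List α), l.map f = (List.ofFn A).flatten →
    ∃ B : Fin n → List α, l = (List.ofFn B).flatten ∧ ∀ j, (B j).map f = A j
  | 0, A, l, h => ⟨fun j => j.elim0, by simpa using h, fun j => j.elim0⟩
  | n + 1, A, l, h => by
      rw [List.ofFn_succ, List.flatten_cons, List.map_eq_append_iff] at h
      obtain ⟨l₁, l₂, rfl, h1, h2⟩ := h
      obtain ⟨B, rfl, hB⟩ := exists_eq_flatten_of_map f n _ l₂ h2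
      refine ⟨Fin.cons l₁ B, by simp [List.ofFn_succ], Fin.cases h1 hB⟩

namespace PTree

variable {V W I I' : Type}

/-- Equality after relabelling fixes the shape, which the list of labels then fills in the
left-recursive order. -/
theorem eq_of_map_eq_of_labels_append {f g : V → W} {t t' : PTree V} (h : t.map f = t'.map g)
    {r r' : List V} (hl : t.labels ++ r = t'.labels ++ r') : t = t' ∧ r = r' := by
  induction t generalizing t' r r' with
  | leaf =>
      cases t' with
      | leaf => exact ⟨rfl, hl⟩
      | node v n ch => cases h
  | node v n ch ih =>
      cases t' with
      | leaf => cases h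
      | node v' n' ch' =>
          simp only [map, node.injEq] at h
          obtain ⟨-, rfl, h⟩ := h
          simp only [labels, List.cons_append, List.cons.injEq] at hl
          obtain ⟨rfl, hl⟩ := hl
          have h := congrFun (eq_of_heq h)
          obtain ⟨h1, h2⟩ := flatten_ofFn_append_cancel n _ _ (fun j => ch j = ch' j)
            (fun j r r' e => ih j (h j) e) _ _ hl
          exact ⟨by rw [funext h1], h2⟩

theorem eq_of_map_eq_of_labels {f g : V → W} {t t' : PTree V} (h : t.map f = t'.map g)
    (hl : t.labels = t'.labels) : t = t' :=
  (eq_of_map_eq_of_labels_append h (r := []) (r' := []) (by rw [hl])).1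

theorem exists_relabel (f : V → W) (t : PTree W) (l : List V) (h : l.map f = t.labels) :
    ∃ t' : PTree V, t'.labels = l ∧ t'.map f = t := by
  induction t generalizing l with
  | leaf => exact ⟨leaf, by simpa [labels] using h.symm, rfl⟩
  | node w n ch ih =>
      rw [labels, List.map_eq_cons_iff] at h
      obtain ⟨v, l', rfl, rfl, h⟩ := h
      obtain ⟨B, rfl, hB⟩ := exists_eq_flatten_of_map f n _ l' h
      choose t' h1 h2 using fun j => ih j (B j) (hB j)
      exact ⟨node v n t', by simp [labels, h1], by simp [map, h2]⟩

/-! ## Cutting trees -/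

/-- Each branch has to be cut at its first vertex in `Y`: a vertex outside `Y` cannot be the root of
a grafted tree, and a vertex in `Y` cannot belong to `P`. -/
theorem graft_unique {Y : Set V} {P P' : PTree V} {s s' : ℕ → PTree V}
    (hP : ∀ v ∈ P.labels, v ∉ Y) (hP' : ∀ v ∈ P'.labels, v ∉ Y)
    (hs : ∀ j < P.leaves, s j = leaf ∨ ∃ y ∈ Y, (s j).rootLabel = some y)
    (hs' : ∀ j < P'.leaves, s' j = leaf ∨ ∃ y ∈ Y, (s' j).rootLabel = some y)
    (h : P.graft s = P'.graft s') : P = P' ∧ ∀ j < P.leaves, s j = s' j := by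
  induction P generalizing P' s s' with
  | leaf =>
      cases P' with
      | leaf =>
          refine ⟨rfl, fun j hj => ?_⟩
          obtain rfl : j = 0 := by simpa [leaves] using hj
          exact h
      | node v n ch =>
          exfalso
          change s 0 = _ at h
          rcases hs 0 (by simp [leaves]) with h0 | ⟨y, hy, h0⟩
          · rw [h0] at h; cases h
          · rw [h] at h0
            obtain rfl : v = y := Option.some.inj h0
            exact hP' v (by simp [labels]) hy
  | node v n ch ih =>
      cases P' with
      | leaf =>
          exfalso
          change _ = s' 0 at h
          rcases hs' 0 (by simp [leaves]) with h0 | ⟨y, hy, h0⟩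
          · rw [h0] at h; cases h
          · rw [← h] at h0
            obtain rfl : v = y := Option.some.inj h0
            exact hP v (by simp [labels]) hy
      | node v' n' ch' =>
          simp only [graft, node.injEq] at h
          obtain ⟨rfl, rfl, h⟩ := h
          have h := congrFun (eq_of_heq h)
          have hch : ∀ j, ch j = ch' j ∧ ∀ p < (ch j).leaves,
              s ((∑ q ∈ Finset.Iio j, (ch q).leaves) + p) =
                s' ((∑ q ∈ Finset.Iio j, (ch' q).leaves) + p) := fun j =>
            ih j (fun w hw => hP w (mem_labels_node.2 (Or.inr ⟨j, hw⟩)))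
              (fun w hw => hP' w (mem_labels_node.2 (Or.inr ⟨j, hw⟩)))
              (fun p hp => hs _ (sum_Iio_add_lt (fun q => (ch q).leaves) j hp))
              (fun p hp => hs' _ (sum_Iio_add_lt (fun q => (ch' q).leaves) j hp)) (h j)
          obtain rfl : ch = ch' := funext fun j => (hch j).1
          refine ⟨rfl, fun j hj => ?_⟩
          obtain ⟨i, q, hq, rfl⟩ := exists_offset _ hj
          exact (hch i).2 q hq

/-- The root vertex is exempt from the condition, because a piece above a cut has its root label in
`Y`. -/
theorem graft_unique_of_root {Y : Set V} {P P' : PTree V} {s s' : ℕ → PTree V}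
    (hr : P.rootLabel.isSome) (hr' : P'.rootLabel.isSome)
    (hP : ∀ p v, P.IsParent p v → v ∉ Y) (hP' : ∀ p v, P'.IsParent p v → v ∉ Y)
    (hs : ∀ j < P.leaves, s j = leaf ∨ ∃ y ∈ Y, (s j).rootLabel = some y)
    (hs' : ∀ j < P'.leaves, s' j = leaf ∨ ∃ y ∈ Y, (s' j).rootLabel = some y)
    (h : P.graft s = P'.graft s') : P = P' ∧ ∀ j < P.leaves, s j = s' j := by
  have key : ∀ {v n} {ch : Fin n → PTree V}, (∀ p u, (node v n ch).IsParent p u → u ∉ Y) →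
      ∀ j, ∀ u ∈ (ch j).labels, u ∉ Y := by
    intro v n ch hp j u hu
    by_cases hr : (ch j).rootLabel = some u
    · exact hp v u (Or.inl ⟨rfl, j, hr⟩)
    · obtain ⟨p, h⟩ := exists_isParent hu hr
      exact hp p u (Or.inr ⟨j, h⟩)
  cases P with
  | leaf => cases hr
  | node v n ch =>
      cases P' with
      | leaf => cases hr'
      | node v' n' ch' =>
          simp only [graft, node.injEq] at h
          obtain ⟨rfl, rfl, h⟩ := h
          have h := congrFun (eq_of_heq h)
          have hch : ∀ j, ch j = ch' j ∧ ∀ p < (ch j).leaves,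
              s ((∑ q ∈ Finset.Iio j, (ch q).leaves) + p) =
                s' ((∑ q ∈ Finset.Iio j, (ch' q).leaves) + p) := fun j =>
            graft_unique (key hP j) (key hP' j)
              (fun p hp => hs _ (sum_Iio_add_lt (fun q => (ch q).leaves) j hp))
              (fun p hp => hs' _ (sum_Iio_add_lt (fun q => (ch' q).leaves) j hp)) (h j)
          obtain rfl : ch = ch' := funext fun j => (hch j).1
          refine ⟨rfl, fun j hj => ?_⟩
          obtain ⟨i, q, hq, rfl⟩ := exists_offset _ hj
          exact (hch i).2 q hq

/-- The lowest piece is everything up to the first cuts, hence determined by `Y`; induction treats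
what lies above it. The two index types are unrelated, so the trees of pieces are compared after
labelling each vertex by its piece. -/
theorem msubst_unique {Y : Set V} {a : I → ℕ} {a' : I' → ℕ} {s : I → PTree V} {s' : I' → PTree V}
    (hs : ∀ q, (s q).leaves = a q) (hs' : ∀ q, (s' q).leaves = a' q)
    (hr : ∀ q, (s q).rootLabel.isSome) (hr' : ∀ q, (s' q).rootLabel.isSome)
    (hY : ∀ q p v, (s q).IsParent p v → v ∉ Y) (hY' : ∀ q p v, (s' q).IsParent p v → v ∉ Y)
    {T : PTree I} {T' : PTree I'} (hT : T.HasArities a) (hT' : T'.HasArities a')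
    (hp : ∀ p q, T.IsParent p q → ∃ y ∈ Y, (s q).rootLabel = some y)
    (hp' : ∀ p q, T'.IsParent p q → ∃ y ∈ Y, (s' q).rootLabel = some y)
    (h : T.msubst s = T'.msubst s') : T.map s = T'.map s' := by
  induction T generalizing T' with
  | leaf =>
      cases T' with
      | leaf => rfl
      | node v n ch =>
          have := rootLabel_msubst_isSome hr' (t := node v n ch) rfl
          rw [← h] at this
          cases this
  | node v n ch ih =>
      cases T' with
      | leaf =>
          have := rootLabel_msubst_isSome hr (t := node v n ch) rfl
          rw [h] at this
          cases this
      | node v' n' ch' =>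
          have key : ∀ {J : Type} {s : J → PTree V} {n : ℕ} {ch : Fin n → PTree J} {v : J},
              (∀ q, (s q).rootLabel.isSome) →
              (∀ p q, (node v n ch).IsParent p q → ∃ y ∈ Y, (s q).rootLabel = some y) →
              ∀ j, (if hj : j < n then (ch ⟨j, hj⟩).msubst s else leaf) = leaf ∨ ∃ y ∈ Y,
                (if hj : j < n then (ch ⟨j, hj⟩).msubst s else leaf).rootLabel = some y := by
            intro J s n ch v hr hp j
            split
            · rename_i hj
              cases hc : ch ⟨j, hj⟩ with
              | leaf => exact Or.inl rfl
              | node u l e =>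
                  obtain ⟨y, hy, hu⟩ := hp v u (Or.inl ⟨rfl, ⟨j, hj⟩, by rw [hc]; rfl⟩)
                  exact Or.inr ⟨y, hy, rootLabel_msubst rfl hu⟩
            · exact Or.inl rfl
          obtain ⟨e1, e2⟩ := graft_unique_of_root (hr v) (hr' v') (hY v) (hY' v')
            (fun j _ => key hr hp j) (fun j _ => key hr' hp' j) h
          obtain rfl : n = n' := by rw [hT.1, hT'.1, ← hs, ← hs', e1]
          simp only [map]
          rw [e1]
          congr 1
          funext j
          refine ih j (hT.2 j) (hT'.2 j) (fun p q hpq => hp p q (Or.inr ⟨j, hpq⟩))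
            (fun p q hpq => hp' p q (Or.inr ⟨j, hpq⟩)) ?_
          have := e2 j (by rw [hs, ← hT.1]; exact j.2)
          simpa using this

/-- Cutting the subtrees on a vertex one by one gives a sequence of upper parts for each of them;
`graft` expects these concatenated at the offsets given by the numbers of leaves. The second clause
controls the values at all positions, including the irrelevant ones. -/
theorem exists_glue {A : Type} {n : ℕ} (m : Fin n → ℕ) (f : Fin n → ℕ → A) (z : A) :
    ∃ s : ℕ → A, (∀ j p, p < m j → s ((∑ q ∈ Finset.Iio j, m q) + p) = f j p) ∧
      ∀ i, s i = z ∨ ∃ j p, s i = f j p := by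
  classical
  have hlt : ∀ j j' : Fin n, j < j' → ∀ p p', p < m j →
      (∑ q ∈ Finset.Iio j, m q) + p ≠ (∑ q ∈ Finset.Iio j', m q) + p' := by
    intro j j' hj p p' hp
    have : ∑ q ∈ Finset.Iic j, m q ≤ ∑ q ∈ Finset.Iio j', m q :=
      Finset.sum_le_sum_of_subset fun x hx =>
        Finset.mem_Iio.2 (lt_of_le_of_lt (Finset.mem_Iic.1 hx) hj)
    rw [← Finset.Iio_insert, Finset.sum_insert (by simp)] at this
    omega
  refine ⟨fun i => if h : ∃ j p, p < m j ∧ i = (∑ q ∈ Finset.Iio j, m q) + p then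
    f h.choose h.choose_spec.choose else z, fun j p hp => ?_, fun i => ?_⟩
  · have h : ∃ j' p', p' < m j' ∧
        (∑ q ∈ Finset.Iio j, m q) + p = (∑ q ∈ Finset.Iio j', m q) + p' := ⟨j, p, hp, rfl⟩
    simp only
    rw [dif_pos h]
    obtain ⟨h1, h2⟩ := h.choose_spec.choose_spec
    generalize h.choose_spec.choose = p' at h1 h2
    generalize h.choose = j' at h1 h2
    rcases lt_trichotomy j j' with hj | hj | hj
    · exact absurd h2 (hlt _ _ hj _ _ hp)
    · subst hj
      rw [show p' = p by omega]
    · exact absurd h2.symm (hlt _ _ hj _ _ h1)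
  · simp only
    split
    · exact Or.inr ⟨_, _, rfl⟩
    · exact Or.inl rfl

theorem exists_cut (Y : Set V) (T : PTree V) : ∃ (P : PTree V) (s : ℕ → PTree V),
    T = P.graft s ∧ (∀ v ∈ P.labels, v ∉ Y) ∧
      ∀ j, s j = leaf ∨ ∃ y ∈ Y, (s j).rootLabel = some y := by
  induction T with
  | leaf => exact ⟨leaf, fun _ => leaf, rfl, by simp [labels], fun _ => Or.inl rfl⟩
  | node v n ch ih =>
      by_cases hv : v ∈ Y
      · exact ⟨leaf, fun _ => node v n ch, rfl, by simp [labels], fun _ => Or.inr ⟨v, hv, rfl⟩⟩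
      · choose P s h1 h2 h3 using ih
        obtain ⟨u, hu, hu'⟩ := exists_glue (fun j => (P j).leaves) s leaf
        refine ⟨node v n P, u, ?_, ?_, ?_⟩
        · simp only [graft]
          congr 1
          funext j
          rw [h1 j]
          exact graft_congr _ fun p hp => (hu j p hp).symm
        · intro w hw
          rcases mem_labels_node.1 hw with rfl | ⟨j, hj⟩
          · exact hv
          · exact h2 j w hj
        · intro i
          rcases hu' i with h | ⟨j, p, h⟩
          · exact Or.inl h
          · rw [h]; exact h3 j p

theorem exists_cut_root (Y : Set V) (v : V) (n : ℕ) (ch : Fin n → PTree V) :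
    ∃ (P : PTree V) (s : ℕ → PTree V), node v n ch = P.graft s ∧ P.rootLabel = some v ∧
      (∀ p u, P.IsParent p u → u ∉ Y) ∧
      ∀ j, s j = leaf ∨ ∃ y ∈ Y, (s j).rootLabel = some y := by
  choose P s h1 h2 h3 using fun j => exists_cut Y (ch j)
  obtain ⟨u, hu, hu'⟩ := exists_glue (fun j => (P j).leaves) s leaf
  refine ⟨node v n P, u, ?_, rfl, ?_, ?_⟩
  · simp only [graft]
    congr 1
    funext j
    rw [h1 j]
    exact graft_congr _ fun p hp => (hu j p hp).symm
  · rintro p w (⟨-, j, h⟩ | ⟨j, h⟩)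
    · exact h2 j w (mem_labels_of_rootLabel h)
    · exact h2 j w h.mem_right
  · intro i
    rcases hu' i with h | ⟨j, p, h⟩
    · exact Or.inl h
    · rw [h]; exact h3 j p

theorem HasArities.of_graft {a : V → ℕ} {t : PTree V} {s : ℕ → PTree V}
    (h : (t.graft s).HasArities a) : t.HasArities a ∧ ∀ p < t.leaves, (s p).HasArities a := by
  induction t generalizing s with
  | leaf =>
      refine ⟨trivial, fun p hp => ?_⟩
      obtain rfl : p = 0 := by simpa [leaves] using hp
      exact h
  | node v n ch ih =>
      refine ⟨⟨h.1, fun j => (ih j (h.2 j)).1⟩, fun p hp => ?_⟩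
      obtain ⟨i, q, hq, rfl⟩ := exists_offset _ hp
      exact (ih i (h.2 i)).2 q hq

theorem length_labels_node (v : V) (n : ℕ) (ch : Fin n → PTree V) :
    (node v n ch).labels.length = 1 + ∑ j, (ch j).labels.length := by
  simp only [labels, List.length_cons, List.length_flatten, List.map_ofFn, List.sum_ofFn,
    Function.comp_apply]
  ring

theorem length_labels_graft (t : PTree V) (s : ℕ → PTree V) :
    (t.graft s).labels.length =
      t.labels.length + ∑ p ∈ Finset.range t.leaves, (s p).labels.length := by
  induction t generalizing s with
  | leaf => simp [graft, leaves, labels]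
  | node v n ch ih =>
      simp only [graft, length_labels_node, ih, leaves, Finset.sum_add_distrib]
      rw [sum_range_split n (fun j => (ch j).leaves) (fun p => (s p).labels.length)]
      ring

/-- A tree is obtained by substitution from the tree that results from the contraction of all the
internal edges that are not in `Y`. -/
theorem exists_decomposition (Y : Set V) {a : V → ℕ} (T : PTree V) (hT : T.HasArities a) :
    ∃ D : PTree (PTree V), T = D.msubst id ∧ D.rootLabel.isSome = T.rootLabel.isSome ∧
      D.HasArities leaves ∧
      (∀ S ∈ D.labels, S.rootLabel.isSome ∧ S.HasArities a ∧ ∀ p u, S.IsParent p u → u ∉ Y) ∧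
      ∀ R S, D.IsParent R S → ∃ y ∈ Y, S.rootLabel = some y := by
  -- The trees above the first cuts are not immediate subtrees, so the induction is on the number of
  -- vertices. In `D`, each vertex is labelled by the piece contracted to it.
  induction hN : T.labels.length using Nat.strong_induction_on generalizing T with
  | _ N ih =>
  cases T with
  | leaf => exact ⟨leaf, rfl, rfl, trivial, by simp [labels], fun R S h => h.elim⟩
  | node v n ch =>
      obtain ⟨P, s, h1, h2, h3, h4⟩ := exists_cut_root Y v n ch
      rw [h1] at hT hN
      obtain ⟨hP, hs⟩ := hT.of_graft
      have hlen : ∀ j < P.leaves, (s j).labels.length < N := by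
        intro j hj
        have hpos : 0 < P.labels.length :=
          List.length_pos_of_mem (mem_labels_of_rootLabel h2)
        rw [length_labels_graft] at hN
        have := Finset.single_le_sum (f := fun p => (s p).labels.length)
          (fun _ _ => Nat.zero_le _) (Finset.mem_range.2 hj)
        omega
      choose D e1 e2 e3 e4 e5 using
        fun j : Fin P.leaves => ih _ (hlen j j.2) (s j) (hs j j.2) rfl
      refine ⟨node P P.leaves D, ?_, rfl, ⟨rfl, e3⟩, ?_, ?_⟩
      · rw [h1, msubst]
        refine graft_congr _ fun p hp => ?_
        rw [dif_pos hp]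
        exact e1 ⟨p, hp⟩
      · intro S hS
        rcases mem_labels_node.1 hS with rfl | ⟨j, hj⟩
        · exact ⟨by rw [h2]; rfl, hP, h3⟩
        · exact e4 j S hj
      · rintro R S (⟨-, j, h⟩ | ⟨j, h⟩)
        · rcases h4 j with h0 | ⟨y, hy, h0⟩
          · have := e2 j
            rw [h0, h] at this
            cases this
          · refine ⟨y, hy, ?_⟩
            have := e1 j
            obtain ⟨z, hz⟩ := Option.isSome_iff_exists.1
              (e4 j S (mem_labels_of_rootLabel h)).1
            rw [← h0, e1 j, rootLabel_msubst h hz, hz]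
        · exact e5 j R S h

theorem IsParent.map {f : V → W} {t : PTree V} {p x : V} (h : t.IsParent p x) :
    (t.map f).IsParent (f p) (f x) := by
  induction t with
  | leaf => exact h
  | node v n ch ih =>
      rcases h with ⟨rfl, j, h⟩ | ⟨j, h⟩
      · exact Or.inl ⟨rfl, j, by rw [rootLabel_map, h]; rfl⟩
      · exact Or.inr ⟨j, ih j h⟩

theorem HasArities.of_map {a : V → ℕ} {a₁ : W → ℕ} {f : V → W} (hf : ∀ v, a₁ (f v) = a v)
    {t : PTree V} (h : (t.map f).HasArities a₁) : t.HasArities a := by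
  induction t with
  | leaf => trivial
  | node v n ch ih => exact ⟨h.1.trans (hf v), fun j => ih j (h.2 j)⟩

theorem leaves_pos {a : V → ℕ} (ha : ∀ v, 0 < a v) {t : PTree V} (ht : t.HasArities a) :
    0 < t.leaves := by
  induction t with
  | leaf => exact one_pos
  | node v n ch ih =>
      have hn : 0 < n := ht.1 ▸ ha v
      exact Finset.sum_pos (fun j _ => ih j (ht.2 j)) ⟨⟨0, hn⟩, Finset.mem_univ _⟩

end PTree

end OInfty

/-! ### Decorated trees and constructs determine each other. -/

namespace OInfty

theorem PTree.exists_eq_corolla {V : Type} [DecidableEq V] {a : V → ℕ} {S : PTree V}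
    (hS : S.HasArities a) (hr : S.rootLabel.isSome) (hn : S.labels.Nodup) (he : S.edges = ∅) :
    ∃ v, S = PTree.corolla v (a v) := by
  cases S with
  | leaf => cases hr
  | node v n ch =>
      have hch : ch = fun _ => PTree.leaf := by
        funext j
        cases hc : ch j with
        | leaf => rfl
        | node u m e =>
            have : u ∈ (PTree.node v n ch).edges :=
              (PTree.mem_edges_iff_isParent hn).2 ⟨v, Or.inl ⟨rfl, j, by rw [hc]; rfl⟩⟩
            rw [he] at this
            simp at this
      subst hch
      obtain rfl : n = a v := hS.1
      exact ⟨v, rfl⟩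

theorem OpTree.ext_tree {k : ℕ} {c : Fin k → ℕ+} {d : ℕ+} {T T' : OpTree c d}
    (h : T.tree = T'.tree) : T = T' := by
  cases T; cases T'; cases h; rfl

namespace FTree

variable {k l r : ℕ} {c : Fin k → ℕ+} {b : Fin l → ℕ+} {a : Fin r → ℕ+} {d e : ℕ+}

theorem eq_of_flat_eq {t : FTree c d} {t' : FTree c e} (h : t.flat = t'.flat) : d = e :=
  PNat.eq (by rw [← leaves_flat t, h, leaves_flat])

/-- A common construct forces both trees to cut the flattening along the same edges. It is asked for
only if there are edges at all, so that the hypothesis passes to children that are leaves. The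
equality is heterogeneous as the output colours are not known to agree beforehand. -/
theorem IsCon.injective {a : Fin k → ℕ+} {A : OpTree a e} {d d' : ℕ+} {t : FTree c d}
    {t' : FTree c d'} (ht : t.FullIn A) (h : t.flat = t'.flat)
    (hC : ∀ X, X = t.flat.edges → X.Nonempty → ∃ C : Construct A.edgeGraph X,
      t.IsCon A.edgeGraph X C ∧ t'.IsCon A.edgeGraph X C) : HEq t t' := by
  induction t generalizing d' with
  | leaf i =>
      cases t' with
      | leaf j =>
          simp only [flat, PTree.corolla, PTree.node.injEq] at h
          obtain rfl := h.1
          rfl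
      | node T' hm' hT' ch' =>
          have hn := ht.nodup
          rw [h] at hn
          obtain ⟨y, hy, -⟩ := exists_root_edge hn
          rw [← h, flat, PTree.edges_corolla] at hy
          simp at hy
  | @node m a₀ d T hm hT ch ih =>
      have hd := eq_of_flat_eq h
      have ht' : t'.FullIn A := ⟨h ▸ ht.nodup, h ▸ ht.sub⟩
      cases t' with
      | leaf j =>
          obtain ⟨y, hy, -⟩ := exists_root_edge ht.nodup
          rw [h, flat, PTree.edges_corolla] at hy
          simp at hy
      | @node m' a₀' _ T' hm' hT' ch' =>
          obtain ⟨y, hy, -⟩ := exists_root_edge ht.nodup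
          obtain ⟨⟨Y, hne, hsub, sub⟩, ⟨h1, h2⟩, ⟨h1', h2'⟩⟩ := hC _ rfl ⟨y, hy⟩
          have key : T.tree.map (fun q => (ch q).flat) = T'.tree.map fun q => (ch' q).flat := by
            refine PTree.msubst_unique (Y := {y | y ∈ Y}) (fun q => (ch q).leaves_flat)
              (fun q => (ch' q).leaves_flat) (fun q => (ch q).isSome_flat)
              (fun q => (ch' q).isSome_flat) ?_ ?_ T.arities T'.arities ?_ ?_ h
            · intro q p v hv
              exact (Finset.mem_sdiff.1 ((mem_edges_sdiff ht.nodup rfl h1 v).2 ⟨q,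
                (PTree.mem_edges_iff_isParent (ht.child q).nodup).2 ⟨p, hv⟩⟩)).2
            · intro q p v hv
              exact (Finset.mem_sdiff.1 ((mem_edges_sdiff ht'.nodup (congrArg _ h) h1' v).2 ⟨q,
                (PTree.mem_edges_iff_isParent (ht'.child q).nodup).2 ⟨p, hv⟩⟩)).2
            · intro p q hpq
              obtain ⟨y, hy⟩ := Option.isSome_iff_exists.1 (ch q).isSome_flat
              refine ⟨y, (h1 y).2 ⟨rootLabel_mem_edges ht.nodup ?_ hy, q, hy⟩, hy⟩
              rintro rfl
              exact PTree.rootLabel_ne_of_isParent T.nodup_labels hpq T.rootLabel_eq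
            · intro p q hpq
              obtain ⟨y, hy⟩ := Option.isSome_iff_exists.1 (ch' q).isSome_flat
              refine ⟨y, (h1' y).2 ⟨h ▸ rootLabel_mem_edges ht'.nodup ?_ hy, q, hy⟩, hy⟩
              rintro rfl
              exact PTree.rootLabel_ne_of_isParent T'.nodup_labels hpq T'.rootLabel_eq
          -- Both root decorations are left-recursive, so the lists of labels enumerate the pieces
          -- in the order of the inputs; comparing them gives `m = m'` and identifies the pieces one
          -- by one.
          have hl := congrArg PTree.labels key
          rw [PTree.labels_map, PTree.labels_map, hT, hT'] at hl
          obtain rfl : m = m' := by simpa using congrArg List.length hl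
          rw [List.map_inj_left] at hl
          have hfl : ∀ q, (ch q).flat = (ch' q).flat := fun q => hl q (List.mem_finRange q)
          obtain rfl : a₀ = a₀' := funext fun q => eq_of_flat_eq (hfl q)
          subst hd
          obtain rfl : T = T' :=
            OpTree.ext_tree (PTree.eq_of_map_eq_of_labels key (hT.trans hT'.symm))
          obtain rfl : ch = ch' := by
            funext q
            refine eq_of_heq (ih q (ht.child q) (hfl q) fun X hX hXne => ?_)
            have hK := (isComponent_iff ht rfl h1 X).2 ⟨hXne, q, hX⟩
            exact ⟨sub X hK, h2 q X hK hX, h2' q X hK (hX.trans (by rw [hfl q]))⟩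
          rfl

theorem exists_flat_eq_of_edges_eq_empty {S : PTree (Fin k)}
    (hS : S.HasArities fun v => (c v : ℕ)) (hr : S.rootLabel.isSome) (hn : S.labels.Nodup)
    (he : S.edges = ∅) (hd : S.leaves = d) : ∃ t : FTree c d, t.flat = S := by
  obtain ⟨v, rfl⟩ := PTree.exists_eq_corolla hS hr hn he
  have hcd : c v = d := PNat.eq (by rw [← hd, PTree.leaves_corolla])
  exact ⟨(leaf v).cast hcd, by rw [flat_cast, flat]⟩

/-- Cutting `S` along the root decoration gives the decoration of the root vertex; pieces with edges
are components, treated by induction, and pieces without edges are leaves. The ambient tree `A`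
stays fixed, because sub-constructs are constructs of the same edge-graph. -/
theorem exists_isCon_of_construct {A : OpTree c e} {X : Finset (Fin k)}
    (C : Construct A.edgeGraph X) {d : ℕ+} {S : PTree (Fin k)}
    (hS : S.HasArities fun v => (c v : ℕ)) (hr : S.rootLabel.isSome) (hn : S.labels.Nodup)
    (hsub : S.Sub A.tree) (hd : S.leaves = d) (hX : X = S.edges) :
    ∃ t : FTree c d, t.flat = S ∧ t.IsCon A.edgeGraph X C := by
  induction C generalizing d S with
  | @mk X Y hne hYX sub ih =>
      obtain ⟨D, h1, h2, h3, h4, h5⟩ := PTree.exists_decomposition {y | y ∈ Y} S hS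
      -- Numbering the pieces in the order in which `D` lists them makes the contracted tree
      -- left-recursive.
      obtain ⟨m, s, T₀, hl, hT₀, hsD⟩ : ∃ (m : ℕ) (s : Fin m → PTree (Fin k)) (T₀ : PTree (Fin m)),
          T₀.labels = List.finRange m ∧ T₀.map s = D ∧ ∀ q, s q ∈ D.labels := by
        obtain ⟨T₀, hl, hT₀⟩ := PTree.exists_relabel D.labels.get D (List.finRange _) (by simp)
        exact ⟨_, _, T₀, hl, hT₀, fun q => List.get_mem _ _⟩
      have h4 := fun q => h4 (s q) (hsD q)
      have hapos : ∀ q, 0 < (s q).leaves := fun q =>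
        PTree.leaves_pos (fun v => (c v).pos) (h4 q).2.1
      let a : Fin m → ℕ+ := fun q => ⟨(s q).leaves, hapos q⟩
      have hST : S = T₀.msubst s := by
        rw [h1, ← hT₀, PTree.msubst_map]; rfl
      have har : T₀.HasArities fun q => (a q : ℕ) :=
        PTree.HasArities.of_map (a₁ := PTree.leaves) (f := s) (fun q => rfl) (hT₀ ▸ h3)
      have hs : ∀ q, (s q).leaves = (a q : ℕ) := fun q => rfl
      have hroot : ∀ q, (s q).rootLabel.isSome := fun q => (h4 q).1
      have hmem : ∀ q, q ∈ T₀.labels := fun q => by rw [hl]; exact List.mem_finRange q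
      have hTsome : T₀.rootLabel.isSome := by
        rw [← hT₀, PTree.rootLabel_map, Option.isSome_map] at h2
        rw [h2, hr]
      let T : OpTree a d :=
        { tree := T₀
          isSome := hTsome
          bij := fun v => by
            rw [hl]
            exact List.count_eq_one_of_mem (List.nodup_finRange _) (List.mem_finRange v)
          arities := har
          leaves := by rw [← hd, hST, PTree.leaves_msubst hs har] }
      have hn' := hn
      rw [hST] at hn'
      have hsn : ∀ q, (s q).labels.Nodup := fun q =>
        PTree.nodup_of_nodup_msubst hs har hn' (hmem q)
      have hssub : ∀ q, (s q).Sub A.tree := fun q =>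
        (PTree.sub_msubst hs hroot har hn' (hmem q)).trans (hST ▸ hsub) hn'
      have hY : ∀ y, y ∈ Y ↔ y ∈ X ∧ ∃ q, (s q).rootLabel = some y := by
        intro y
        constructor
        · intro hy
          refine ⟨hYX hy, ?_⟩
          have hyS := hYX hy
          rw [hX, PTree.mem_edges, hST, PTree.mem_labels_msubst hs har] at hyS
          obtain ⟨⟨q, -, hq⟩, -⟩ := hyS
          refine ⟨q, ?_⟩
          by_contra hne
          obtain ⟨p, hp⟩ := PTree.exists_isParent hq hne
          exact (h4 q).2.2 p y hp hy
        · rintro ⟨hyX, q, hq⟩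
          by_cases hqr : T₀.rootLabel = some q
          · rw [hX, PTree.mem_edges, hST, PTree.rootLabel_msubst hqr hq] at hyX
            exact absurd rfl hyX.2
          · obtain ⟨p, hp⟩ := PTree.exists_isParent (hmem q) hqr
            have := hp.map (f := s)
            rw [hT₀] at this
            obtain ⟨z, hz, hz'⟩ := h5 _ _ this
            rw [hq] at hz'
            obtain rfl := Option.some.inj hz'
            exact hz
      have hXY : ∀ x, x ∈ X \ Y ↔ ∃ q, x ∈ (s q).edges := by
        intro x
        rw [← PTree.mem_edges_msubst hs hroot har hmem hn' x, Finset.mem_sdiff, hY, ← hST, hX]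
        tauto
      have hcomp := A.isComponent_edgeGraph_iff hs hroot har hmem hn' (hST ▸ hsub) hXY
      -- An element of `Y` is an edge below a piece other than the root piece.
      have hm2 : 2 ≤ m := by
        obtain ⟨y, hy⟩ := hne
        obtain ⟨hyX, q, hq⟩ := (hY y).1 hy
        have : Nontrivial (Fin m) := by
          refine ⟨q, T.root, ?_⟩
          rintro rfl
          rw [hX, PTree.mem_edges, hST, PTree.rootLabel_msubst T.rootLabel_eq hq] at hyX
          exact hyX.2 rfl
        exact Fin.nontrivial_iff_two_le.1 this
      have hch : ∀ q, ∃ t : FTree c (a q), t.flat = s q ∧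
          ∀ K hK, K = (s q).edges → t.IsCon A.edgeGraph K (sub K hK) := by
        intro q
        by_cases hq : (s q).edges.Nonempty
        · have hK := (hcomp (s q).edges).2 ⟨hq, q, rfl⟩
          obtain ⟨t, ht1, ht2⟩ := ih _ hK (d := a q) (h4 q).2.1 (hroot q) (hsn q) (hssub q) rfl rfl
          refine ⟨t, ht1, ?_⟩
          rintro K hK rfl
          exact ht2
        · obtain ⟨t, ht⟩ := exists_flat_eq_of_edges_eq_empty (d := a q) (h4 q).2.1 (hroot q)
            (hsn q) (Finset.not_nonempty_iff_eq_empty.1 hq) rfl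
          refine ⟨t, ht, ?_⟩
          rintro K hK rfl
          exact absurd hK.connected.1 hq
      choose ch hch1 hch2 using hch
      refine ⟨node T hm2 hl ch, ?_, ?_, ?_⟩
      · rw [hST]
        exact PTree.msubst_congr fun q _ => hch1 q
      · simpa only [hch1] using hY
      · intro q K hK hKq
        exact hch2 q K hK (by rw [hKq, hch1])

end FTree

end OInfty

/-! ### Renaming and grafting of constructs in terms of decorated trees. -/

namespace OInfty

namespace FTree

variable {k l r : ℕ} {c : Fin k → ℕ+} {b : Fin l → ℕ+} {a : Fin r → ℕ+} {d e : ℕ+}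

theorem mem_labels_flat_bind (s : ∀ j : Fin k, FTree a (c j)) (t : FTree c d) (x : Fin r) :
    x ∈ (t.bind s).flat.labels ↔ ∃ j ∈ t.flat.labels, x ∈ (s j).flat.labels := by
  rw [flat_bind, PTree.mem_labels_msubst (fun j => (s j).leaves_flat) t.hasArities_flat]

theorem rootLabel_flat_bind {s : ∀ j : Fin k, FTree a (c j)} {t : FTree c d} {f : Fin k → Fin r}
    (hs : ∀ j ∈ t.flat.labels, (s j).flat.rootLabel = some (f j)) :
    (t.bind s).flat.rootLabel = t.flat.rootLabel.map f := by
  obtain ⟨ρ, hρ⟩ := Option.isSome_iff_exists.1 t.isSome_flat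
  rw [hρ, flat_bind, PTree.rootLabel_msubst hρ (hs ρ (PTree.mem_labels_of_rootLabel hρ))]
  rfl

/-- What is substituted for the vertex `j` has the root `f j`, so the old edge `j` is renamed to `f
j`. By `hdisj`, these names are not used for edges inside the substituted trees. -/
theorem mem_edges_flat_bind {s : ∀ j : Fin k, FTree a (c j)} {t : FTree c d}
    {f : Fin k → Fin r} (hf : Function.Injective f)
    (hs : ∀ j ∈ t.flat.labels, (s j).flat.rootLabel = some (f j))
    (hdisj : ∀ j ∈ t.flat.labels, ∀ x, f x ∉ (s j).flat.edges) (x : Fin r) :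
    x ∈ (t.bind s).flat.edges ↔ x ∈ t.flat.edges.image f ∨
      ∃ j ∈ t.flat.labels, x ∈ (s j).flat.edges := by
  obtain ⟨ρ, hρ⟩ := Option.isSome_iff_exists.1 t.isSome_flat
  rw [PTree.mem_edges, mem_labels_flat_bind, rootLabel_flat_bind hs, hρ]
  simp only [Finset.mem_image, PTree.mem_edges, Option.map_some, hρ]
  constructor
  · rintro ⟨⟨j, hj, hx⟩, hne⟩
    by_cases hr : (s j).flat.rootLabel = some x
    · rw [hs j hj] at hr
      obtain rfl := Option.some.inj hr
      exact Or.inl ⟨j, ⟨hj, fun e => hne (by rw [Option.some.inj e])⟩, rfl⟩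
    · exact Or.inr ⟨j, hj, hx, hr⟩
  · rintro (⟨j, ⟨hj, hne⟩, rfl⟩ | ⟨j, hj, hx, hr⟩)
    · exact ⟨⟨j, hj, PTree.mem_labels_of_rootLabel (hs j hj)⟩,
        fun e => hne (by rw [hf (Option.some.inj e)])⟩
    · refine ⟨⟨j, hj, hx⟩, fun e => ?_⟩
      obtain rfl := Option.some.inj e
      exact hdisj j hj ρ (PTree.mem_edges.2 ⟨hx, hr⟩)

theorem edges_flat_bind_corolla {s : ∀ j : Fin k, FTree a (c j)} {t : FTree c d}
    {f : Fin k → Fin r} (hf : Function.Injective f)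
    (hs : ∀ j ∈ t.flat.labels, (s j).flat = PTree.corolla (f j) (c j)) :
    (t.bind s).flat.edges = t.flat.edges.image f := by
  ext x
  rw [mem_edges_flat_bind hf (fun j hj => by rw [hs j hj]; rfl)
    (fun j hj x => by rw [hs j hj, PTree.edges_corolla]; simp)]
  refine ⟨?_, Or.inl⟩
  rintro (h | ⟨j, hj, hx⟩)
  · exact h
  · rw [hs j hj, PTree.edges_corolla] at hx
    simp at hx

theorem edges_flat_bind_of_mem {s : ∀ j : Fin k, FTree a (c j)} {t : FTree c d}
    {f : Fin k → Fin r} (hf : Function.Injective f) {i : Fin k} (hi : i ∈ t.flat.labels)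
    (hs : ∀ j ≠ i, (s j).flat = PTree.corolla (f j) (c j))
    (hi' : (s i).flat.rootLabel = some (f i)) (hdisj : ∀ x, f x ∉ (s i).flat.edges) :
    (t.bind s).flat.edges = t.flat.edges.image f ∪ (s i).flat.edges := by
  ext x
  rw [mem_edges_flat_bind hf, Finset.mem_union]
  · refine or_congr_right ⟨?_, fun h => ⟨i, hi, h⟩⟩
    rintro ⟨j, hj, hx⟩
    by_cases hji : j = i
    · exact hji ▸ hx
    · rw [hs j hji, PTree.edges_corolla] at hx
      simp at hx
  · intro j _
    by_cases hji : j = i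
    · rw [hji]; exact hi'
    · rw [hs j hji]; rfl
  · intro j _ x
    by_cases hji : j = i
    · rw [hji]; exact hdisj x
    · rw [hs j hji, PTree.edges_corolla]; simp

theorem filter_image_eq {f : Fin k → Fin r} (hf : Function.Injective f) {X F : Finset (Fin k)}
    {Z : Finset (Fin r)} (hF : F ⊆ X) (hZ : ∀ x, f x ∉ Z) :
    (X.filter fun x => f x ∈ F.image f ∪ Z) = F := by
  ext x
  simp only [Finset.mem_filter, Finset.mem_union, Finset.mem_image, hZ, or_false]
  constructor
  · rintro ⟨-, y, hy, e⟩
    exact hf e ▸ hy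
  · exact fun h => ⟨hF h, x, h, rfl⟩

/-- An injective renaming carries the edge set of each child to that of the renamed child, so the
default branches of `Construct.rename` are not reached. The `s j` need only flatten to corollas,
which covers permutations as well as composition with an identity. -/
theorem IsCon.rename {A₁ : OpTree c e} {e' : ℕ+} {A : OpTree a e'} {f : Fin k → Fin r}
    (hf : Function.Injective f) {s : ∀ j : Fin k, FTree a (c j)} {t : FTree c d}
    (ht : t.FullIn A₁) (hs : ∀ j ∈ t.flat.labels, (s j).flat = PTree.corolla (f j) (c j))
    {X : Finset (Fin k)} (hX : X = t.flat.edges) {C : Construct A₁.edgeGraph X}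
    (hC : t.IsCon A₁.edgeGraph X C) {X₁ : Finset (Fin r)} (hX₁ : X.image f = X₁) :
    (t.bind s).IsCon A.edgeGraph X₁ (C.rename f X₁ hX₁) := by
  classical
  induction t generalizing X X₁ with
  | leaf i => exact hC.elim
  | node T hm hT ch ih =>
      obtain ⟨Y, hne, hsub, sub⟩ := C
      obtain ⟨h1, h2⟩ := hC
      have hsq : ∀ q, ∀ j ∈ (ch q).flat.labels, (s j).flat = PTree.corolla (f j) (c j) :=
        fun q j hj => hs j ((mem_labels_node j).2 ⟨q, hj⟩)
      have hsq' : ∀ q, ((ch q).bind s).flat.rootLabel = (ch q).flat.rootLabel.map f := fun q =>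
        rootLabel_flat_bind fun j hj => by rw [hsq q j hj]; rfl
      refine ⟨fun y => ?_, fun q K hK hKq => ?_⟩
      · simp only [hsq', Finset.mem_image, h1, ← hX₁, Option.map_eq_some_iff]
        constructor
        · rintro ⟨x, ⟨hx, q, hq⟩, rfl⟩
          exact ⟨⟨x, hx, rfl⟩, q, x, hq, rfl⟩
        · rintro ⟨⟨x, hx, rfl⟩, q, x', hq, e⟩
          exact ⟨x, ⟨hx, q, hf e ▸ hq⟩, rfl⟩
      · rw [edges_flat_bind_corolla hf (hsq q)] at hKq
        have hss : (ch q).flat.edges ⊆ X \ Y := fun x hx =>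
          (mem_edges_sdiff ht.nodup hX h1 x).2 ⟨q, hx⟩
        have hfil : ((X \ Y).filter fun x => f x ∈ K) = (ch q).flat.edges := by
          have := filter_image_eq hf hss (Z := ∅) (by simp)
          rwa [Finset.union_empty, ← hKq] at this
        have hne' : (ch q).flat.edges.Nonempty := by
          have := hK.connected.1
          rw [hKq, Finset.image_nonempty] at this
          exact this
        have h₁ : A₁.edgeGraph.IsComponent (X \ Y) ((X \ Y).filter fun x => f x ∈ K) := by
          rw [isComponent_iff ht hX h1, hfil]
          exact ⟨hne', q, rfl⟩
        have h₂ : ((X \ Y).filter fun x => f x ∈ K).image f = K := by rw [hfil, hKq]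
        have := ih q (ht.child q) (hsq q) hfil (h2 q _ h₁ hfil) h₂
        simp only
        rw [dif_pos h₁, dif_pos h₂]
        exact this

theorem isCon_bind_of_edges_eq_empty {H : Hypergraph (Fin r)} {s : ∀ j : Fin k, FTree a (c j)}
    {t : FTree c d} (hn : t.flat.labels.Nodup) (he : t.flat.edges = ∅) {i : Fin k}
    (hi : i ∈ t.flat.labels) {K : Finset (Fin r)} {C : Construct H K}
    (h : (s i).IsCon H K C) : (t.bind s).IsCon H K C := by
  cases t with
  | leaf j =>
      rw [flat, PTree.labels_corolla, List.mem_singleton] at hi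
      subst hi
      exact h
  | node T hm hT ch =>
      obtain ⟨y, hy, -⟩ := exists_root_edge hn
      rw [he] at hy
      simp at hy

/-- The recursion in `Construct.graft` climbs along the path to the leaf `i`: at each vertex, the
component to be enlarged is given by the child that contains `i`. -/
theorem IsCon.graft {A₁ : OpTree c e} {e₂ e' : ℕ+} {A₂ : OpTree b e₂} {A : OpTree a e'}
    {f : Fin k → Fin r} (hf : Function.Injective f) {g : Fin l → Fin r} {i : Fin k}
    {s : ∀ j : Fin k, FTree a (c j)} {t : FTree c d} (ht : t.FullIn A₁)
    (hi : i ∈ t.flat.labels) (hs : ∀ j ≠ i, (s j).flat = PTree.corolla (f j) (c j))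
    (hi' : (s i).flat.rootLabel = some (f i)) {X₂ : Finset (Fin l)}
    {C₂ : Construct A₂.edgeGraph X₂} (hX₂ : (s i).flat.edges = X₂.image g)
    (hne₂ : X₂.Nonempty) (hdisj : ∀ x, f x ∉ X₂.image g)
    (hC₂ : ∀ K h, (s i).IsCon A.edgeGraph K (C₂.rename g K h))
    {X : Finset (Fin k)} (hX : X = t.flat.edges) {C : Construct A₁.edgeGraph X}
    (hC : t.IsCon A₁.edgeGraph X C) {X₁ : Finset (Fin r)}
    (hX₁ : X.image f ∪ X₂.image g = X₁) :
    (t.bind s).IsCon A.edgeGraph X₁ (Construct.graft f g C₂ C X₁ hX₁) := by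
  classical
  induction t generalizing X X₁ with
  | leaf i => exact hC.elim
  | node T hm hT ch ih =>
      obtain ⟨Y, hne, hsub, sub⟩ := C
      obtain ⟨h1, h2⟩ := hC
      have hroot : ∀ j, (s j).flat.rootLabel = some (f j) := fun j => by
        by_cases hji : j = i
        · rw [hji]; exact hi'
        · rw [hs j hji]; rfl
      have hsq' : ∀ q, ((ch q).bind s).flat.rootLabel = (ch q).flat.rootLabel.map f := fun q =>
        rootLabel_flat_bind fun j _ => hroot j
      refine ⟨fun y => ?_, fun q K hK hKq => ?_⟩
      · simp only [hsq', Finset.mem_image, h1, ← hX₁, Option.map_eq_some_iff, Finset.mem_union]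
        constructor
        · rintro ⟨x, ⟨hx, q, hq⟩, rfl⟩
          exact ⟨Or.inl ⟨x, hx, rfl⟩, q, x, hq, rfl⟩
        · rintro ⟨⟨x, hx, rfl⟩ | h, q, x', hq, e⟩
          · exact ⟨x, ⟨hx, q, hf e ▸ hq⟩, rfl⟩
          · subst e
            exact absurd (Finset.mem_image.2 h) (hdisj x')
      · have hss : (ch q).flat.edges ⊆ X \ Y := fun x hx =>
          (mem_edges_sdiff ht.nodup hX h1 x).2 ⟨q, hx⟩
        by_cases hiq : i ∈ (ch q).flat.labels
        · rw [edges_flat_bind_of_mem hf hiq hs hi' (hX₂ ▸ hdisj), hX₂] at hKq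
          have hfil : ((X \ Y).filter fun x => f x ∈ K) = (ch q).flat.edges := by
            have := filter_image_eq hf hss hdisj
            rwa [← hKq] at this
          simp only
          -- This child contains the leaf `i`. If it has edges, they form a component that absorbs
          -- `X₂`, and the recursion continues there.
          by_cases hne' : (ch q).flat.edges.Nonempty
          · have h₁ : A₁.edgeGraph.IsComponent (X \ Y) ((X \ Y).filter fun x => f x ∈ K) := by
              rw [isComponent_iff ht hX h1, hfil]
              exact ⟨hne', q, rfl⟩
            have h₂ : ((X \ Y).filter fun x => f x ∈ K).image f ∪ X₂.image g = K := by
              rw [hfil, hKq]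
            have := ih q (ht.child q) hiq hfil (h2 q _ h₁ hfil) h₂
            rw [dif_pos h₁, dif_pos h₂]
            exact this
          -- Without edges, the child is the leaf `i` itself; the new component is `X₂` alone, and
          -- `C₂` is grafted here.
          · have h₁ : ¬ A₁.edgeGraph.IsComponent (X \ Y) ((X \ Y).filter fun x => f x ∈ K) := by
              rw [hfil]
              exact fun h => hne' h.connected.1
            have h₄ : X₂.image g = K := by
              rw [hKq, Finset.not_nonempty_iff_eq_empty.1 hne', Finset.image_empty,
                Finset.empty_union]
            rw [dif_neg h₁, dif_pos h₄]
            exact isCon_bind_of_edges_eq_empty (ht.child q).nodup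
              (Finset.not_nonempty_iff_eq_empty.1 hne') hiq (hC₂ K h₄)
        -- A child without the leaf `i` is only renamed. That `X₂` is non-empty excludes the branch
        -- that would absorb it.
        · have hsq : ∀ j ∈ (ch q).flat.labels, (s j).flat = PTree.corolla (f j) (c j) :=
            fun j hj => hs j fun e => hiq (e ▸ hj)
          rw [edges_flat_bind_corolla hf hsq] at hKq
          have hfil : ((X \ Y).filter fun x => f x ∈ K) = (ch q).flat.edges := by
            have := filter_image_eq hf hss (Z := ∅) (by simp)
            rwa [Finset.union_empty, ← hKq] at this
          have hne' : (ch q).flat.edges.Nonempty := by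
            have := hK.connected.1
            rw [hKq, Finset.image_nonempty] at this
            exact this
          have h₁ : A₁.edgeGraph.IsComponent (X \ Y) ((X \ Y).filter fun x => f x ∈ K) := by
            rw [isComponent_iff ht hX h1, hfil]
            exact ⟨hne', q, rfl⟩
          have h₂ : ((X \ Y).filter fun x => f x ∈ K).image f ∪ X₂.image g ≠ K := by
            rw [hfil, hKq]
            intro e
            obtain ⟨z, hz⟩ := hne₂
            have hz' := Finset.mem_image_of_mem g hz
            have := e ▸ Finset.mem_union_right (s := (ch q).flat.edges.image f) hz'
            obtain ⟨y, -, hy⟩ := Finset.mem_image.1 this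
            exact hdisj y (hy ▸ hz')
          have h₃ : ((X \ Y).filter fun x => f x ∈ K).image f = K := by rw [hfil, hKq]
          have := (h2 q _ h₁ hfil).rename (A := A) hf (ht.child q) hsq hfil h₃
          simp only
          rw [dif_pos h₁, dif_neg h₂, dif_pos h₃]
          exact this

end FTree

end OInfty

/-! ### The bijection and its compatibility with the operad structure. -/

namespace OInfty

namespace PTree

theorem map_id {V : Type} (t : PTree V) : t.map id = t := by
  induction t with
  | leaf => rfl
  | node v n ch ih => simp only [map, ih, id]

end PTree

namespace FTree

theorem isCon_cast {k : ℕ} {c : Fin k → ℕ+} {d e : ℕ+} (h : d = e) {t : FTree c d}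
    {H : Hypergraph (Fin k)} {X : Finset (Fin k)} {C : Construct H X} :
    (t.cast h).IsCon H X C ↔ t.IsCon H X C := by
  subst h; rfl

end FTree

namespace OInfBasis

variable {k l r : ℕ} {c : Fin k → ℕ+} {b : Fin l → ℕ+} {a : Fin r → ℕ+} {d e : ℕ+}

/-- The decorated tree `t` represents the triple `x = (T, σ, C)`. -/
def Matches (x : OInfBasis c d) (t : DecTree c d) : Prop :=
  t.1.flat = x.tree.tree ∧ ∀ hk, t.1.IsCon x.tree.edgeGraph x.tree.edges (x.con hk)

theorem fullIn_of_flat_eq {t : FTree c d} {A : OpTree c d} (h : t.flat = A.tree) :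
    t.FullIn A :=
  ⟨h ▸ A.nodup_labels, h ▸ PTree.Sub.refl _⟩

theorem edges_eq_of_flat_eq {t : FTree c d} {A : OpTree c d} (h : t.flat = A.tree) :
    A.edges = t.flat.edges := by
  rw [h, A.edges_eq]

theorem exists_matches (t : DecTree c d) : ∃ x : OInfBasis c d, x.Matches t := by
  let A : OpTree c d :=
    { tree := t.1.flat
      isSome := t.1.isSome_flat
      bij := fun v => by rw [t.1.count_flat, t.2]
      arities := t.1.hasArities_flat
      leaves := t.1.leaves_flat }
  have key : ∀ hk : 2 ≤ k, ∃ C : Construct A.edgeGraph A.edges, t.1.IsCon A.edgeGraph A.edges C :=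
    fun hk => FTree.exists_isCon (A := A) (fullIn_of_flat_eq rfl) (edges_eq_of_flat_eq rfl)
      (A.edges_nonempty hk)
  choose C hC using key
  exact ⟨⟨A, C⟩, rfl, hC⟩

theorem Matches.eq_left {x y : OInfBasis c d} {t : DecTree c d} (hx : x.Matches t)
    (hy : y.Matches t) : x = y := by
  obtain ⟨T, C⟩ := x
  obtain ⟨T', C'⟩ := y
  obtain rfl : T = T' := OpTree.ext_tree (hx.1.symm.trans hy.1)
  congr 1
  funext hk
  exact (hx.2 hk).unique (fullIn_of_flat_eq hx.1) (edges_eq_of_flat_eq hx.1) (hy.2 hk)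

theorem exists_matches_right (x : OInfBasis c d) : ∃ t : DecTree c d, x.Matches t := by
  have key : ∃ t : FTree c d, t.flat = x.tree.tree ∧
      ∀ hk, t.IsCon x.tree.edgeGraph x.tree.edges (x.con hk) := by
    by_cases hk : 2 ≤ k
    · obtain ⟨t, h1, h2⟩ := FTree.exists_isCon_of_construct (x.con hk) x.tree.arities
        x.tree.isSome x.tree.nodup_labels (PTree.Sub.refl _) x.tree.leaves x.tree.edges_eq
      exact ⟨t, h1, fun _ => h2⟩
    · obtain ⟨t, ht⟩ := FTree.exists_flat_eq_of_edges_eq_empty x.tree.arities x.tree.isSome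
        x.tree.nodup_labels (by rw [← x.tree.edges_eq, x.tree.edges_eq_empty hk]) x.tree.leaves
      exact ⟨t, ht, fun h => absurd h hk⟩
  obtain ⟨t, h1, h2⟩ := key
  exact ⟨⟨t, fun i => by rw [← t.count_flat, h1, x.tree.bij]⟩, h1, h2⟩

theorem Matches.eq_right {x : OInfBasis c d} {t t' : DecTree c d} (ht : x.Matches t)
    (ht' : x.Matches t') : t = t' := by
  refine Subtype.ext (eq_of_heq (FTree.IsCon.injective (fullIn_of_flat_eq ht.1)
    (ht.1.trans ht'.1.symm) ?_))
  rintro X hX hne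
  rw [← edges_eq_of_flat_eq ht.1] at hX
  subst hX
  have hk : 2 ≤ k := by
    by_contra hk
    rw [x.tree.edges_eq_empty hk] at hne
    exact Finset.not_nonempty_empty hne
  exact ⟨x.con hk, ht.2 hk, ht'.2 hk⟩

theorem matches_gen (T : OpTree c d) (hk : 2 ≤ k) (hT : T.IsLeftRecursive) :
    (gen T).Matches (DecTree.corolla T hk hT) := by
  refine ⟨?_, fun _ => ⟨fun y => ?_, fun q K hK hKq => ?_⟩⟩
  · exact (PTree.map_eq_msubst id T.arities).symm.trans (PTree.map_id _)
  · exact ⟨fun h => ⟨h, y, rfl⟩, fun h => h.1⟩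
  · have := hK.connected.1
    rw [hKq, FTree.flat, PTree.edges_corolla] at this
    exact absurd this Finset.not_nonempty_empty

theorem matches_one (n : ℕ+) : (one n).Matches (DecTree.one n) :=
  ⟨rfl, fun hk => absurd hk (by norm_num)⟩

theorem flat_leaf_cast {i : Fin k} (h : c i = d) :
    ((FTree.leaf i).cast h : FTree c d).flat = PTree.corolla i d := by
  rw [FTree.flat_cast, FTree.flat, h]

theorem Matches.act {x : OInfBasis c d} {t : DecTree c d} (h : x.Matches t)
    (κ : Equiv.Perm (Fin k)) : (x.act κ).Matches (t.act κ) := by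
  refine ⟨?_, fun hk => ?_⟩
  · change (t.1.bind _).flat = x.tree.tree.map κ.symm
    rw [FTree.flat_bind, ← h.1, PTree.map_eq_msubst κ.symm t.1.hasArities_flat]
    exact PTree.msubst_congr fun j _ => flat_leaf_cast _
  · exact (h.2 hk).rename κ.symm.injective (fullIn_of_flat_eq h.1)
      (fun j _ => flat_leaf_cast _) (edges_eq_of_flat_eq h.1) _

/-- The tree grafted at `j` flattens to a corolla for `j ≠ i` and to the renamed tree of `y` for `j
= i`, so the flattening is the substituted tree. The construct is a graft unless one of the factors
is an identity. -/
theorem Matches.comp {x : OInfBasis c d} {y : OInfBasis b e} {t : DecTree c d} {u : DecTree b e}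
    (hx : x.Matches t) (hy : y.Matches u) (i : Fin k) (he : c i = e) (h : Ins c i b a) :
    (x.comp i he h y).Matches (t.comp i he h u) := by
  set s : ∀ j : Fin k, FTree a (c j) := fun j =>
    if hj : j = i then
      (u.1.bind fun p => (FTree.leaf (c := a) (innerPos h.card i p)).cast (h.inner p)).cast
        (by rw [hj, he])
    else (FTree.leaf (c := a) (outerPos h.card i j hj)).cast (h.outer j hj) with hs
  have hinner : ∀ p : Fin l, ((FTree.leaf (c := a) (innerPos h.card i p)).cast (h.inner p) :
      FTree a (b p)).flat = PTree.corolla (innerPos h.card i p) (b p) := fun p => flat_leaf_cast _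
  have hs0 : ∀ (j) (hj : j ≠ i), (s j).flat = PTree.corolla (outerPos h.card i j hj) (c j) := by
    intro j hj
    rw [hs]
    simp only
    rw [dif_neg hj, flat_leaf_cast]
  have hs1 : (s i).flat = y.tree.tree.map (innerPos h.card i) := by
    rw [hs]
    simp only
    rw [dif_pos trivial, FTree.flat_cast, FTree.flat_bind, ← hy.1,
      PTree.map_eq_msubst _ u.1.hasArities_flat]
    exact PTree.msubst_congr fun p _ => hinner p
  have hflat : (t.1.bind s).flat = (x.comp i he h y).tree.tree := by
    change _ = PTree.subst i y.tree.tree (outerPos h.card i) (innerPos h.card i) x.tree.tree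
    rw [FTree.flat_bind, PTree.subst_eq_msubst i _ _ _ x.tree.arities, hx.1]
    refine PTree.msubst_congr fun j _ => ?_
    by_cases hj : j = i
    · subst hj
      rw [dif_pos rfl, hs1]
    · rw [dif_neg hj, hs0 j hj]
  have hmem : i ∈ t.1.flat.labels := by rw [hx.1]; exact x.tree.mem_labels i
  have hsi : ∀ hl : 2 ≤ l, ∀ K (hK : y.tree.edges.image (innerPos h.card i) = K),
      (s i).IsCon (x.comp i he h y).tree.edgeGraph K ((y.con hl).rename _ K hK) := by
    intro hl K hK
    have := (hy.2 hl).rename (A := (x.comp i he h y).tree)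
      (f := innerPos h.card i) (fun p q => innerPos_inj _ _ _ _) (fullIn_of_flat_eq hy.1)
      (fun j _ => hinner j) (edges_eq_of_flat_eq hy.1) hK
    rw [hs]
    simp only
    rw [dif_pos trivial, FTree.isCon_cast]
    exact this
  refine ⟨hflat, fun hr => ?_⟩
  change (t.1.bind s).IsCon _ _ _
  have hinc : ∀ j ≠ i, (s j).flat = PTree.corolla (OpTree.edgeIncl i h y.tree j) (c j) :=
    fun j hj => by rw [hs0 j hj, OpTree.edgeIncl, dif_neg hj]
  have hii : OpTree.edgeIncl i h y.tree i = innerPos h.card i y.tree.root := dif_pos rfl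
  unfold OInfBasis.comp
  simp only
  by_cases hk : 2 ≤ k
  · rw [dif_pos hk]
    by_cases hl : 2 ≤ l
    · rw [dif_pos hl]
      refine (hx.2 hk).graft (OpTree.edgeIncl_injective i h y.tree) (fullIn_of_flat_eq hx.1) hmem
        hinc ?_ ?_ (y.tree.edges_nonempty hl) ?_ (hsi hl) (edges_eq_of_flat_eq hx.1) _
      · rw [hs1, PTree.rootLabel_map, y.tree.rootLabel_eq, hii]; rfl
      · rw [hs]
        simp only
        rw [dif_pos trivial, FTree.flat_cast,
          FTree.edges_flat_bind_corolla (fun p q => innerPos_inj _ _ _ _) (fun j _ => hinner j),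
          edges_eq_of_flat_eq hy.1]
      · intro z hz
        obtain ⟨w, hw, e⟩ := Finset.mem_image.1 hz
        by_cases hzi : z = i
        · subst hzi
          rw [hii] at e
          obtain rfl := innerPos_inj _ _ _ _ e
          exact Finset.notMem_erase _ _ hw
        · rw [OpTree.edgeIncl, dif_neg hzi] at e
          exact outerPos_ne_innerPos _ _ _ _ _ e.symm
    · rw [dif_neg hl]
      refine (hx.2 hk).rename (OpTree.edgeIncl_injective i h y.tree) (fullIn_of_flat_eq hx.1)
        (fun j _ => ?_) (edges_eq_of_flat_eq hx.1) _
      -- The second factor is a corolla here, and its only vertex gives the leaf `i` its new name.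
      by_cases hj : j = i
      · subst hj
        obtain ⟨v, hv⟩ := PTree.exists_eq_corolla y.tree.arities y.tree.isSome
          y.tree.nodup_labels (by rw [← y.tree.edges_eq, y.tree.edges_eq_empty hl])
        have hroot : y.tree.root = v := by
          have := y.tree.rootLabel_eq
          rw [hv] at this
          exact (Option.some.inj this).symm
        have hbv : (b v : ℕ) = c j := by
          rw [he, ← y.tree.leaves, hv, PTree.leaves_corolla]
        rw [hii, hroot, hs1, hv, ← hbv]
        rfl
      · exact hinc j hj
  · rw [dif_neg hk]
    -- The first factor is an identity, so its decorated tree is the leaf `i`, and only `y` remains.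
    refine FTree.isCon_bind_of_edges_eq_empty (fullIn_of_flat_eq hx.1).nodup ?_ hmem
      (hsi _ _ _)
    rw [← edges_eq_of_flat_eq hx.1, x.tree.edges_eq_empty hk]

/-- The bijection between triples `(T, σ, C)` and decorated trees. -/
noncomputable def equivDecTree : OInfBasis c d ≃ DecTree c d :=
  Equiv.ofBijective (fun x => (exists_matches_right x).choose)
    ⟨fun x y hxy => by
      have hx := (exists_matches_right x).choose_spec
      have hy := (exists_matches_right y).choose_spec
      simp only at hxy
      rw [← hxy] at hy
      exact hx.eq_left hy,
    fun t => by
      obtain ⟨x, hx⟩ := exists_matches t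
      exact ⟨x, (exists_matches_right x).choose_spec.eq_right hx⟩⟩

theorem matches_equivDecTree (x : OInfBasis c d) : x.Matches (equivDecTree x) :=
  (exists_matches_right x).choose_spec

/-- The bijection is obtained by choice; all that is known about it comes from the uniqueness of the
matching tree. -/
theorem Matches.equivDecTree_eq {x : OInfBasis c d} {t : DecTree c d} (h : x.Matches t) :
    equivDecTree x = t :=
  (matches_equivDecTree x).eq_right h

theorem equivDecTree_gen (T : OpTree c d) (hk : 2 ≤ k) (hT : T.IsLeftRecursive) :
    equivDecTree (gen T) = DecTree.corolla T hk hT :=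
  (matches_gen T hk hT).equivDecTree_eq

theorem equivDecTree_one (n : ℕ+) : equivDecTree (one n) = DecTree.one n :=
  (matches_one n).equivDecTree_eq

theorem equivDecTree_act (x : OInfBasis c d) (κ : Equiv.Perm (Fin k)) :
    equivDecTree (x.act κ) = (equivDecTree x).act κ :=
  ((matches_equivDecTree x).act κ).equivDecTree_eq

theorem equivDecTree_comp (x : OInfBasis c d) (y : OInfBasis b e) (i : Fin k) (he : c i = e)
    (h : Ins c i b a) :
    equivDecTree (x.comp i he h y) = (equivDecTree x).comp i he h (equivDecTree y) :=
  ((matches_equivDecTree x).comp (matches_equivDecTree y) i he h).equivDecTree_eq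

theorem numVerts_eq_numNodes (x : OInfBasis c d) : x.numVerts = (equivDecTree x).1.numNodes := by
  have h := matches_equivDecTree x
  unfold numVerts
  split
  · rename_i hk
    exact (h.2 hk).numVerts (fullIn_of_flat_eq h.1) (edges_eq_of_flat_eq h.1)
  · rename_i hk
    rw [FTree.numNodes_eq_zero (fullIn_of_flat_eq h.1).nodup]
    rw [← edges_eq_of_flat_eq h.1, x.tree.edges_eq_empty hk]
    exact Finset.not_nonempty_empty

end OInfBasis

end OInfty

namespace OInfty

/-! ## Decorated trees as words in prefix notation -/

/-- The letters of the prefix notation of decorated trees. -/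
inductive Letter (V : Type) : Type
  | lf (v : V) : Letter V
  | nd {m : ℕ} {a : Fin m → ℕ+} {d : ℕ+} (T : OpTree a d) (hm : 2 ≤ m) : Letter V

namespace Letter

variable {U V W : Type}

/-- Substitution of words for the leaves. -/
def bind (s : V → List (Letter W)) : Letter V → List (Letter W)
  | lf v => s v
  | nd T hm => [nd T hm]

/-- The label of a leaf. -/
def label? : Letter V → Option V
  | lf v => some v
  | nd _ _ => none

/-- The number of inputs of a vertex; leaves count for `0`. -/
def arity : Letter V → ℕ
  | lf _ => 0
  | nd (m := m) _ _ => m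

/-- Forget the labels of the leaves. -/
def erase : Letter V → Letter Unit
  | lf _ => lf ()
  | nd T hm => nd T hm

/-- Is the letter a vertex? -/
def isNode : Letter V → ℕ
  | lf _ => 0
  | nd _ _ => 1

end Letter

open Letter

section Words

variable {U V W : Type}

/-- The labels of the leaves of a word. -/
def lfs (w : List (Letter V)) : List V := w.filterMap label?

/-- The number of letters after the first leaf with label `i`. -/
def after [DecidableEq V] (i : V) : List (Letter V) → ℕ
  | [] => 0
  | lf v :: w => if v = i then w.length else after i w
  | nd _ _ :: w => after i w

/-- The number of vertices in a word. -/
def nodeCount (w : List (Letter V)) : ℕ := (w.map isNode).sum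

/-- The total number of inputs of the vertices in a word. -/
def arityCount (w : List (Letter V)) : ℕ := (w.map arity).sum

theorem lfs_append (w w' : List (Letter V)) : lfs (w ++ w') = lfs w ++ lfs w' :=
  List.filterMap_append

theorem lfs_cons_lf (v : V) (w : List (Letter V)) : lfs (lf v :: w) = v :: lfs w := by
  simp [lfs, label?]

theorem lfs_cons_nd {m : ℕ} {a : Fin m → ℕ+} {d : ℕ+} (T : OpTree a d) (hm : 2 ≤ m)
    (w : List (Letter V)) : lfs (nd T hm :: w) = lfs w :=
  List.filterMap_cons_none rfl

theorem lf_mem_iff {w : List (Letter V)} {v : V} : lf v ∈ w ↔ v ∈ lfs w := by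
  simp only [lfs, List.mem_filterMap]
  constructor
  · exact fun h => ⟨_, h, rfl⟩
  · rintro ⟨x, hx, h⟩
    cases x with
    | lf v' => cases h; exact hx
    | nd T hm => cases h

theorem length_eq_nodeCount_add (w : List (Letter V)) :
    w.length = nodeCount w + (lfs w).length := by
  induction w with
  | nil => rfl
  | cons x w ih =>
      cases x with
      | lf v => rw [lfs_cons_lf]; simp [nodeCount, isNode, ih] at *; omega
      | nd T hm => rw [lfs_cons_nd]; simp [nodeCount, isNode, ih] at *; omega

theorem after_append_of_mem [DecidableEq V] {i : V} {w : List (Letter V)} (h : lf i ∈ w)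
    (w' : List (Letter V)) : after i (w ++ w') = after i w + w'.length := by
  induction w with
  | nil => simp at h
  | cons x w ih =>
      cases x with
      | lf v =>
          simp only [List.cons_append, after]
          split
          · simp
          · rename_i hv
            refine ih ?_
            simpa [Ne.symm hv] using h
      | nd T hm =>
          simp only [List.cons_append, after]
          exact ih (by simpa using h)

theorem after_append_of_notMem [DecidableEq V] {i : V} {w : List (Letter V)} (h : lf i ∉ w)
    (w' : List (Letter V)) : after i (w ++ w') = after i w' := by
  induction w with
  | nil => rfl
  | cons x w ih =>
      simp only [List.mem_cons, not_or] at h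
      cases x with
      | lf v =>
          simp only [List.cons_append, after]
          rw [if_neg (fun e => h.1 (by rw [e])), ih h.2]
      | nd T hm => exact ih h.2

theorem after_eq_length [DecidableEq V] {i : V} {u : List (Letter V)} (h : i ∉ lfs u)
    (v : List (Letter V)) : after i (u ++ lf i :: v) = v.length := by
  rw [after_append_of_notMem (fun hh => h (lf_mem_iff.1 hh)), after, if_pos rfl]

theorem exists_split {i : V} {w : List (Letter V)} (h : (lfs w).Nodup) (hi : i ∈ lfs w) :
    ∃ u v, w = u ++ lf i :: v ∧ i ∉ lfs u ∧ i ∉ lfs v := by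
  obtain ⟨u, v, rfl⟩ := List.append_of_mem (lf_mem_iff.2 hi)
  rw [lfs_append, lfs_cons_lf, List.nodup_append] at h
  refine ⟨u, v, rfl, fun hu => h.2.2 i hu i (by simp) rfl, ?_⟩
  exact (List.nodup_cons.1 h.2.1).1

theorem flatMap_bind_bind (w : List (Letter U)) (s : U → List (Letter V))
    (s' : V → List (Letter W)) :
    (w.flatMap (Letter.bind s)).flatMap (Letter.bind s') =
      w.flatMap (Letter.bind fun j => (s j).flatMap (Letter.bind s')) := by
  rw [List.flatMap_assoc]
  congr 1
  funext x
  cases x <;> simp [Letter.bind]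

theorem flatMap_bind_lf (w : List (Letter V)) : w.flatMap (Letter.bind fun j => [lf j]) = w := by
  induction w with
  | nil => rfl
  | cons x w ih => cases x <;> simp [Letter.bind, ih]

theorem flatMap_bind_one (v : V) (s : V → List (Letter W)) :
    [lf v].flatMap (Letter.bind s) = s v := by
  simp [Letter.bind]

theorem lfs_flatMap (w : List (Letter V)) (s : V → List (Letter W)) :
    lfs (w.flatMap (Letter.bind s)) = (lfs w).flatMap fun j => lfs (s j) := by
  induction w with
  | nil => rfl
  | cons x w ih =>
      cases x with
      | lf v => rw [List.flatMap_cons, lfs_append, ih, lfs_cons_lf, List.flatMap_cons]; rfl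
      | nd T hm =>
          rw [List.flatMap_cons, lfs_append, ih, lfs_cons_nd]
          simp [Letter.bind, lfs, label?]

theorem eq_of_erase_eq {w w' : List (Letter V)} (h : w.map erase = w'.map erase)
    (hl : lfs w = lfs w') : w = w' := by
  induction w generalizing w' with
  | nil => simpa using h.symm
  | cons x w ih =>
      cases w' with
      | nil => simp at h
      | cons x' w' =>
          rw [List.map_cons, List.map_cons, List.cons.injEq] at h
          cases x with
          | lf v =>
              cases x' with
              | lf v' =>
                  rw [lfs_cons_lf, lfs_cons_lf, List.cons.injEq] at hl
                  rw [hl.1, ih h.2 hl.2]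
              | nd T' hm' => cases h.1
          | nd T hm =>
              cases x' with
              | lf v' => cases h.1
              | nd T' hm' =>
                  rw [lfs_cons_nd, lfs_cons_nd] at hl
                  rw [ih h.2 hl]
                  have := h.1
                  simp only [erase, Letter.nd.injEq] at this
                  obtain ⟨rfl, h1, rfl, h2⟩ := this
                  obtain rfl := eq_of_heq h1
                  obtain rfl := eq_of_heq h2
                  rfl

end Words

namespace FTree

variable {k l r : ℕ} {c : Fin k → ℕ+} {b : Fin l → ℕ+} {a : Fin r → ℕ+} {d e : ℕ+}

/-- The prefix notation of a decorated tree. -/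
def word : ∀ {d : ℕ+}, FTree c d → List (Letter (Fin k))
  | _, leaf i => [lf i]
  | _, node T hm _ ch => nd T hm :: (List.ofFn fun q => (ch q).word).flatten

theorem word_cast (h : d = e) (t : FTree c d) : (t.cast h).word = t.word := by
  subst h; rfl

theorem word_bind (s : ∀ j : Fin k, FTree b (c j)) (t : FTree c d) :
    (t.bind s).word = t.word.flatMap (Letter.bind fun j => (s j).word) := by
  induction t with
  | leaf i => simp [bind, word, Letter.bind]
  | node T hm hT ch ih =>
      simp only [bind, word, ih, List.flatMap_cons, Letter.bind, List.flatten_eq_flatMap,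
        List.flatMap_assoc, List.singleton_append]
      congr 1
      rw [← List.flatten_eq_flatMap, List.flatMap_def, List.map_ofFn]
      rfl

/-- A letter records the number of inputs of its vertex, so prefix notation needs no brackets. It
also determines the colours, and therefore the output colours need not be assumed equal. -/
theorem word_append_cancel {t : FTree c d} {t' : FTree c e} {r r' : List (Letter (Fin k))}
    (h : t.word ++ r = t'.word ++ r') :
    (⟨d, t⟩ : Σ d, FTree c d) = ⟨e, t'⟩ ∧ r = r' := by
  induction t generalizing e r r' with
  | leaf i =>
      cases t' with
      | leaf j =>
          simp only [word, List.singleton_append, List.cons.injEq, Letter.lf.injEq] at h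
          obtain ⟨rfl, rfl⟩ := h
          exact ⟨rfl, rfl⟩
      | node T' hm' hT' ch' => simp [word] at h
  | node T hm hT ch ih =>
      cases t' with
      | leaf j => simp [word] at h
      | node T' hm' hT' ch' =>
          simp only [word, List.cons_append, List.cons.injEq, Letter.nd.injEq] at h
          obtain ⟨⟨rfl, h1, rfl, h2⟩, h3⟩ := h
          obtain rfl := eq_of_heq h1
          obtain rfl := eq_of_heq h2
          obtain ⟨h4, h5⟩ := flatten_ofFn_append_cancel _ _ _ (fun j => ch j = ch' j)
            (fun j r r' e => by
              obtain ⟨h6, h7⟩ := ih j e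
              exact ⟨by simpa using h6, h7⟩) _ _ h3
          obtain rfl : ch = ch' := funext h4
          exact ⟨rfl, h5⟩

theorem word_injective {t t' : FTree c d} (h : t.word = t'.word) : t = t' := by
  have := (word_append_cancel (t := t) (t' := t') (r := []) (r' := []) (by rw [h])).1
  simpa using this

theorem count_lfs_word (t : FTree c d) (i : Fin k) : (lfs t.word).count i = t.leafCount i := by
  induction t with
  | leaf j => simp [word, lfs, label?, leafCount, List.count_singleton]
  | node T hm hT ch ih =>
      rw [word, lfs_cons_nd, leafCount]
      simp only [lfs, List.filterMap_flatten, List.map_ofFn]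
      rw [List.count_flatten, List.map_ofFn, List.sum_ofFn]
      exact Finset.sum_congr rfl fun q _ => ih q

theorem length_word (t : FTree c d) : t.word.length = t.numEdges + 1 := by
  induction t with
  | leaf j => rfl
  | node T hm hT ch ih =>
      simp only [word, List.length_cons, List.length_flatten, List.map_ofFn, List.sum_ofFn,
        Function.comp_apply, ih, numEdges]
      congr 1
      exact Finset.sum_congr rfl fun q _ => add_comm _ _

theorem nodeCount_word (t : FTree c d) : nodeCount t.word = t.numNodes := by
  induction t with
  | leaf j => rfl
  | node T hm hT ch ih =>
      simp only [word, nodeCount, List.map_cons, List.sum_cons, List.map_flatten,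
        List.sum_flatten, List.map_ofFn, List.sum_ofFn, numNodes] at ih ⊢
      congr 1
      exact Finset.sum_congr rfl fun q _ => ih q

theorem arityCount_word (t : FTree c d) : arityCount t.word = t.numEdges := by
  induction t with
  | leaf j => rfl
  | @node m _ _ T hm hT ch ih =>
      simp only [word, arityCount, List.map_cons, List.sum_cons, List.map_flatten,
        List.sum_flatten, List.map_ofFn, List.sum_ofFn, numEdges, Finset.sum_add_distrib] at ih ⊢
      congr 1
      · simp [arity]
      · exact Finset.sum_congr rfl fun q _ => ih q

-- Behind the leaf `i` in block `q` come the rest of that block and all the later blocks. If `i`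
-- does not occur, both sides are `0`.
open Classical in
theorem _root_.OInfty.after_flatten {V : Type} [DecidableEq V] (i : V) :
    ∀ (n : ℕ) (A : Fin n → List (Letter V)),
    (∀ q q', lf i ∈ A q → lf i ∈ A q' → q = q') →
    after i (List.ofFn A).flatten = ∑ q, if lf i ∈ A q then
      after i (A q) + ∑ q₁ ∈ Finset.Ioi q, (A q₁).length else 0
  | 0, A, _ => rfl
  | n + 1, A, h => by
      rw [List.ofFn_succ, List.flatten_cons, Fin.sum_univ_succ]
      simp only [Fin.sum_Ioi_zero, Fin.sum_Ioi_succ]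
      by_cases h0 : lf i ∈ A 0
      · have hz : ∀ q : Fin n, lf i ∉ A q.succ := fun q hq => Fin.succ_ne_zero q (h _ _ hq h0)
        rw [after_append_of_mem h0, if_pos h0]
        simp [List.length_flatten, List.map_ofFn, List.sum_ofFn, hz]
      · rw [after_append_of_notMem h0, if_neg h0, zero_add,
          after_flatten i n (fun q => A q.succ)
            (fun q q' hq hq' => Fin.succ_injective _ (h _ _ hq hq'))]

/-- A letter stands for the edge below a vertex or for a leaf. Those on the path to `i` or to its
left are written no later than `i`, those to its right come afterwards. -/
theorem numRight_eq_after {i : Fin k} {t : FTree c d} (h : t.leafCount i ≤ 1) :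
    t.numRight i = after i t.word := by
  induction t with
  | leaf j => simp [numRight, word, after]
  | node T hm hT ch ih =>
      rw [leafCount] at h
      have hmem : ∀ q, lf i ∈ (ch q).word ↔ 0 < (ch q).leafCount i := fun q => by
        rw [lf_mem_iff, ← List.count_pos_iff, count_lfs_word]
      rw [numRight, word, after, after_flatten]
      · refine Finset.sum_congr rfl fun q _ => ?_
        simp only [hmem, length_word]
        rw [ih q ((Finset.single_le_sum (f := fun q => (ch q).leafCount i)
          (fun _ _ => Nat.zero_le _) (Finset.mem_univ q)).trans h)]
        simp only [add_comm]
      · intro q q' hq hq'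
        rw [hmem] at hq hq'
        by_contra hne
        have := Finset.add_le_sum (f := fun q => (ch q).leafCount i)
          (fun _ _ => Nat.zero_le _) (Finset.mem_univ q) (Finset.mem_univ q') hne
        omega

end FTree

namespace DecTree

variable {k l r : ℕ} {c : Fin k → ℕ+} {b : Fin l → ℕ+} {a : Fin r → ℕ+} {d e : ℕ+}

/-- The prefix notation of a decorated tree. -/
def word (t : DecTree c d) : List (Letter (Fin k)) := t.1.word

theorem ext_word {t t' : DecTree c d} (h : t.word = t'.word) : t = t' :=
  Subtype.ext (FTree.word_injective h)

theorem count_lfs (t : DecTree c d) (i : Fin k) : (lfs t.word).count i = 1 := by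
  rw [word, FTree.count_lfs_word, t.2]

theorem nodup_lfs (t : DecTree c d) : (lfs t.word).Nodup :=
  List.nodup_iff_count_le_one.2 fun i => (t.count_lfs i).le

theorem mem_lfs (t : DecTree c d) (i : Fin k) : i ∈ lfs t.word :=
  List.count_pos_iff.1 (by rw [t.count_lfs i]; exact one_pos)

theorem numRight_eq (t : DecTree c d) (i : Fin k) : t.1.numRight i = after i t.word :=
  FTree.numRight_eq_after (t.2 i).le

theorem exists_split (t : DecTree c d) (i : Fin k) :
    ∃ u v, t.word = u ++ lf i :: v ∧ i ∉ lfs u ∧ i ∉ lfs v :=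
  OInfty.exists_split t.nodup_lfs (t.mem_lfs i)

theorem word_one (n : ℕ+) : (one n).word = [lf 0] := rfl

theorem word_act (t : DecTree c d) (κ : Equiv.Perm (Fin k)) :
    (t.act κ).word = t.word.flatMap (Letter.bind fun j => [lf (κ.symm j)]) := by
  unfold act word
  simp only
  rw [FTree.word_bind]
  simp only [FTree.word_cast, FTree.word]

/-- The word that is substituted for the leaf `j` of the first factor of a composition. -/
def compWord (h : r + 1 = k + l) (i : Fin k) (w : List (Letter (Fin l))) (j : Fin k) :
    List (Letter (Fin r)) :=
  if hj : j = i then w.flatMap (Letter.bind fun p => [lf (innerPos h i p)])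
  else [lf (outerPos h i j hj)]

theorem compWord_self (h : r + 1 = k + l) (i : Fin k) (w : List (Letter (Fin l))) :
    compWord h i w i = w.flatMap (Letter.bind fun p => [lf (innerPos h i p)]) := dif_pos rfl

theorem compWord_of_ne (h : r + 1 = k + l) (i : Fin k) (w : List (Letter (Fin l))) {j : Fin k}
    (hj : j ≠ i) : compWord h i w j = [lf (outerPos h i j hj)] := dif_neg hj

/-- As trees are determined by their words, this reduces the laws of an operad to associativity of
substitution in words and arithmetic of positions. -/
theorem word_comp (i : Fin k) (he : c i = e) (h : Ins c i b a) (x : DecTree c d)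
    (y : DecTree b e) :
    (x.comp i he h y).word = x.word.flatMap (Letter.bind (compWord h.card i y.word)) := by
  unfold comp word
  simp only
  rw [FTree.word_bind]
  congr 2
  funext j
  unfold compWord
  split
  · rw [FTree.word_cast, FTree.word_bind]
    simp only [FTree.word_cast, FTree.word]
  · rw [FTree.word_cast, FTree.word]

end DecTree

end OInfty

/-! ### Operad laws for decorated trees, and counting of edges under grafting. -/

namespace OInfty

open Letter

section Positions

variable {k l m r s t : ℕ}

theorem outerPos_innerPos_outerPos (h : r + 1 = k + l) (h₁ : t + 1 = r + m) (h₂ : s + 1 = l + m)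
    (h₃ : t + 1 = k + s) (i q : Fin k) (hq : q ≠ i) (j : Fin l)
    (hne : outerPos h i q hq ≠ innerPos h i j) :
    outerPos h₁ (innerPos h i j) (outerPos h i q hq) hne = outerPos h₃ i q hq := by
  have a1 : (q : ℕ) ≠ i := fun e => hq (Fin.ext e)
  apply Fin.ext
  simp only [outerPos_val, Fin.lt_def]
  simp only [innerPos]
  have := j.2
  split_ifs <;> omega

theorem outerPos_innerPos_innerPos (h : r + 1 = k + l) (h₁ : t + 1 = r + m) (h₂ : s + 1 = l + m)
    (h₃ : t + 1 = k + s) (i : Fin k) (j p : Fin l) (hp : p ≠ j)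
    (hne : innerPos h i p ≠ innerPos h i j) :
    outerPos h₁ (innerPos h i j) (innerPos h i p) hne = innerPos h₃ i (outerPos h₂ j p hp) := by
  have a1 : (p : ℕ) ≠ j := fun e => hp (Fin.ext e)
  apply Fin.ext
  simp only [outerPos_val, innerPos, Fin.lt_def]
  have := j.2
  have := p.2
  split_ifs <;> omega

theorem innerPos_innerPos (h : r + 1 = k + l) (h₁ : t + 1 = r + m) (h₂ : s + 1 = l + m)
    (h₃ : t + 1 = k + s) (i : Fin k) (j : Fin l) (p : Fin m) :
    innerPos h₁ (innerPos h i j) p = innerPos h₃ i (innerPos h₂ j p) := by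
  apply Fin.ext
  simp only [innerPos]
  omega

theorem outerPos_outerPos (h : r + 1 = k + l) (h₁ : s + 1 = k + m) (h₂ : t + 1 = r + m)
    (h₃ : t + 1 = s + l) (i j q : Fin k) (hij : j ≠ i) (hqi : q ≠ i) (hqj : q ≠ j)
    (hne : outerPos h i q hqi ≠ outerPos h i j hij)
    (hne' : outerPos h₁ j q hqj ≠ outerPos h₁ j i hij.symm) :
    outerPos h₂ (outerPos h i j hij) (outerPos h i q hqi) hne =
      outerPos h₃ (outerPos h₁ j i hij.symm) (outerPos h₁ j q hqj) hne' := by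
  have a1 : (q : ℕ) ≠ i := fun e => hqi (Fin.ext e)
  have a2 : (q : ℕ) ≠ j := fun e => hqj (Fin.ext e)
  have a3 : (j : ℕ) ≠ i := fun e => hij (Fin.ext e)
  apply Fin.ext
  simp only [outerPos_val, Fin.lt_def]
  have := i.2
  have := j.2
  have := q.2
  split_ifs <;> omega

theorem outerPos_innerPos (h : r + 1 = k + l) (h₁ : s + 1 = k + m) (h₂ : t + 1 = r + m)
    (h₃ : t + 1 = s + l) (i j : Fin k) (hij : j ≠ i) (p : Fin l)
    (hne : innerPos h i p ≠ outerPos h i j hij) :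
    outerPos h₂ (outerPos h i j hij) (innerPos h i p) hne =
      innerPos h₃ (outerPos h₁ j i hij.symm) p := by
  have a3 : (j : ℕ) ≠ i := fun e => hij (Fin.ext e)
  apply Fin.ext
  simp only [outerPos_val, innerPos, Fin.lt_def]
  have := i.2
  have := j.2
  have := p.2
  split_ifs <;> omega

end Positions

theorem map_erase_flatMap {V W : Type} {w : List (Letter V)} {s : V → List (Letter W)}
    (h : ∀ j ∈ lfs w, (s j).map erase = [lf ()]) :
    (w.flatMap (Letter.bind s)).map erase = w.map erase := by
  induction w with
  | nil => rfl
  | cons x w ih =>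
      rw [List.flatMap_cons, List.map_append, List.map_cons]
      cases x with
      | lf v =>
          rw [lfs_cons_lf] at h
          rw [ih fun j hj => h j (by simp [hj])]
          simp only [Letter.bind]
          rw [h v (by simp)]
          rfl
      | nd T hm =>
          rw [lfs_cons_nd] at h
          rw [ih h]
          rfl

theorem length_flatMap_bind {V W : Type} {w : List (Letter V)} {s : V → List (Letter W)}
    (h : ∀ j ∈ lfs w, (s j).map erase = [lf ()]) :
    (w.flatMap (Letter.bind s)).length = w.length := by
  simpa using congrArg List.length (map_erase_flatMap h)

namespace DecTree

section Laws

variable {k l m r s t : ℕ} {c : Fin k → ℕ+} {b : Fin l → ℕ+} {b₁ : Fin m → ℕ+} {a : Fin r → ℕ+}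
  {a₁ : Fin s → ℕ+} {a₂ : Fin t → ℕ+} {d e e₁ : ℕ+}

theorem act_one (x : DecTree c d) : x.act (1 : Equiv.Perm (Fin k)) = x := by
  refine ext_word ?_
  rw [word_act]
  exact flatMap_bind_lf _

theorem act_act (κ lam : Equiv.Perm (Fin k)) (x : DecTree c d) :
    (x.act κ).act lam = x.act (κ * lam) := by
  refine ext_word ?_
  rw [word_act, word_act, flatMap_bind_bind]
  exact (word_act x (κ * lam)).symm

theorem one_comp (h : Ins (fun _ : Fin 1 => e) 0 b b) (y : DecTree b e) :
    (one e).comp 0 rfl h y = y := by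
  refine ext_word ?_
  rw [word_comp, word_one, flatMap_bind_one, compWord_self]
  conv_rhs => rw [← flatMap_bind_lf y.word]
  congr 2
  funext p
  congr 2
  exact Fin.ext (by simp [innerPos])

theorem comp_one (i : Fin k) (he : c i = e) (h : Ins c i (fun _ : Fin 1 => e) c)
    (x : DecTree c d) : x.comp i he h (one e) = x := by
  refine ext_word ?_
  rw [word_comp, word_one]
  conv_rhs => rw [← flatMap_bind_lf x.word]
  congr 2
  funext j
  by_cases hj : j = i
  · subst hj
    rw [compWord_self, flatMap_bind_one]
    congr 2
  · rw [compWord_of_ne _ _ _ hj]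
    congr 2
    apply Fin.ext
    rw [outerPos_val]
    split_ifs <;> omega

theorem assoc (i : Fin k) (j : Fin l) (hi : c i = e)
    (hj : b j = e₁) (hcb : Ins c i b a) (hj₁ : a (innerPos hcb.card i j) = e₁)
    (h₁ : Ins a (innerPos hcb.card i j) b₁ a₂) (h₂ : Ins b j b₁ a₁) (h₃ : Ins c i a₁ a₂)
    (x : DecTree c d) (y : DecTree b e) (z : DecTree b₁ e₁) :
    (x.comp i hi hcb y).comp _ hj₁ h₁ z = x.comp i hi h₃ (y.comp j hj h₂ z) := by
  refine ext_word ?_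
  simp only [word_comp]
  rw [flatMap_bind_bind]
  congr 2
  funext q
  by_cases hq : q = i
  · subst hq
    rw [compWord_self, compWord_self, flatMap_bind_bind, flatMap_bind_bind]
    congr 2
    funext p
    rw [flatMap_bind_one]
    by_cases hp : p = j
    · subst hp
      rw [compWord_self, compWord_self, flatMap_bind_bind]
      congr 2
      funext p'
      rw [flatMap_bind_one, innerPos_innerPos _ _ h₂.card h₃.card]
    · rw [compWord_of_ne _ _ _ hp, compWord_of_ne, flatMap_bind_one,
        outerPos_innerPos_innerPos _ _ h₂.card h₃.card]
      exact fun e => hp (innerPos_inj _ _ _ _ e)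
  · rw [compWord_of_ne _ _ _ hq, compWord_of_ne _ _ _ hq, flatMap_bind_one, compWord_of_ne,
      outerPos_innerPos_outerPos _ _ h₂.card h₃.card]
    exact outerPos_ne_innerPos _ _ _ _ _

theorem parallel (i j : Fin k) (hij : j ≠ i) (hi : c i = e)
    (hj : c j = e₁) (h : Ins c i b a) (h₁ : Ins c j b₁ a₁)
    (hj₂ : a (outerPos h.card i j hij) = e₁) (hi₂ : a₁ (outerPos h₁.card j i hij.symm) = e)
    (h₂ : Ins a (outerPos h.card i j hij) b₁ a₂) (h₃ : Ins a₁ (outerPos h₁.card j i hij.symm) b a₂)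
    (x : DecTree c d) (y : DecTree b e) (z : DecTree b₁ e₁) :
    (x.comp i hi h y).comp _ hj₂ h₂ z = (x.comp j hj h₁ z).comp _ hi₂ h₃ y := by
  refine ext_word ?_
  simp only [word_comp]
  rw [flatMap_bind_bind, flatMap_bind_bind]
  congr 2
  funext q
  by_cases hq : q = i
  · subst hq
    rw [compWord_self, compWord_of_ne _ _ _ hij.symm, flatMap_bind_bind, flatMap_bind_one,
      compWord_self]
    congr 2
    funext p
    rw [flatMap_bind_one, compWord_of_ne _ _ _ (outerPos_ne_innerPos _ _ _ _ _).symm,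
      outerPos_innerPos _ h₁.card _ h₃.card]
  · by_cases hq' : q = j
    · subst hq'
      rw [compWord_self, compWord_of_ne _ _ _ hij, flatMap_bind_bind, flatMap_bind_one,
        compWord_self]
      congr 2
      funext p
      rw [flatMap_bind_one, compWord_of_ne _ _ _ (outerPos_ne_innerPos _ _ _ _ _).symm,
        outerPos_innerPos _ h.card _ h₂.card]
    · rw [compWord_of_ne _ _ _ hq, compWord_of_ne _ _ _ hq', flatMap_bind_one, flatMap_bind_one,
        compWord_of_ne _ _ _ fun e => hq' (outerPos_inj _ _ _ _ _ _ e),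
        compWord_of_ne _ _ _ fun e => hq (outerPos_inj _ _ _ _ _ _ e),
        outerPos_outerPos h.card h₁.card h₂.card h₃.card i j q hij hq hq']

theorem equivariant (i : Fin k) (κ : Equiv.Perm (Fin k)) (lam : Equiv.Perm (Fin l))
    (μ : Equiv.Perm (Fin r)) (he : c (κ i) = e) (h : Ins c (κ i) b a)
    (h₁ : Ins (c ∘ κ) i (b ∘ lam) (a ∘ μ)) (hμ : IsBlockPerm h.card i κ lam μ)
    (x : DecTree c d) (y : DecTree b e) :
    (x.act κ).comp i he h₁ (y.act lam) = (x.comp (κ i) he h y).act μ := by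
  refine ext_word ?_
  simp only [word_comp, word_act]
  rw [flatMap_bind_bind, flatMap_bind_bind]
  congr 2
  funext q
  rw [flatMap_bind_one]
  obtain ⟨q, rfl⟩ := κ.surjective q
  rw [Equiv.symm_apply_apply]
  by_cases hq : q = i
  · subst hq
    rw [compWord_self, compWord_self, flatMap_bind_bind, flatMap_bind_bind]
    congr 2
    funext p
    obtain ⟨p, rfl⟩ := lam.surjective p
    rw [flatMap_bind_one, flatMap_bind_one, Equiv.symm_apply_apply, ← hμ.2 p,
      Equiv.symm_apply_apply]
  · rw [compWord_of_ne _ _ _ hq, compWord_of_ne _ _ _ fun e => hq (κ.injective e),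
      flatMap_bind_one, ← hμ.1 q hq, Equiv.symm_apply_apply]

end Laws

section Counting

variable {k l r : ℕ} {c : Fin k → ℕ+} {b : Fin l → ℕ+} {a : Fin r → ℕ+} {d e : ℕ+}

theorem length_word (t : DecTree c d) : t.word.length = t.1.numEdges + 1 := t.1.length_word

theorem numRight_of_split (t : DecTree c d) {i : Fin k} {u v : List (Letter (Fin k))}
    (h : t.word = u ++ lf i :: v) : t.1.numRight i = v.length := by
  have hn := t.nodup_lfs
  rw [numRight_eq, h]
  refine after_eq_length (fun hu => ?_) v
  rw [h, lfs_append, lfs_cons_lf, List.nodup_append] at hn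
  exact hn.2.2 i hu i (by simp) rfl

theorem erase_compWord (h : r + 1 = k + l) (i : Fin k) (w : List (Letter (Fin l))) {j : Fin k}
    (hj : j ≠ i) : (compWord h i w j).map erase = [lf ()] := by
  rw [compWord_of_ne _ _ _ hj]; rfl

theorem erase_flatMap_compWord (h : r + 1 = k + l) (i : Fin k) (w : List (Letter (Fin l)))
    {u : List (Letter (Fin k))} (hu : i ∉ lfs u) :
    (u.flatMap (Letter.bind (compWord h i w))).map erase = u.map erase :=
  map_erase_flatMap fun _ hj => erase_compWord h i w fun e => hu (e ▸ hj)

theorem erase_compWord_self (h : r + 1 = k + l) (i : Fin k) (w : List (Letter (Fin l))) :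
    (compWord h i w i).map erase = w.map erase := by
  rw [compWord_self]
  exact map_erase_flatMap fun _ _ => rfl

theorem length_flatMap_compWord (h : r + 1 = k + l) (i : Fin k) (w : List (Letter (Fin l)))
    {u : List (Letter (Fin k))} (hu : i ∉ lfs u) :
    (u.flatMap (Letter.bind (compWord h i w))).length = u.length := by
  simpa using congrArg List.length (erase_flatMap_compWord h i w hu)

theorem length_compWord_self (h : r + 1 = k + l) (i : Fin k) (w : List (Letter (Fin l))) :
    (compWord h i w i).length = w.length := by
  simpa using congrArg List.length (erase_compWord_self h i w)

theorem word_comp_split (i : Fin k) (he : c i = e) (h : Ins c i b a) (x : DecTree c d)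
    (y : DecTree b e) {u v : List (Letter (Fin k))} (hx : x.word = u ++ lf i :: v) :
    (x.comp i he h y).word = u.flatMap (Letter.bind (compWord h.card i y.word)) ++
      (compWord h.card i y.word i ++ v.flatMap (Letter.bind (compWord h.card i y.word))) := by
  rw [word_comp, hx, List.flatMap_append, List.flatMap_cons]
  rfl

theorem numEdges_act (t : DecTree c d) (κ : Equiv.Perm (Fin k)) :
    (t.act κ).1.numEdges = t.1.numEdges := by
  have := (t.act κ).length_word
  rw [word_act, length_flatMap_bind fun _ _ => rfl, length_word] at this
  omega

theorem numRight_act (t : DecTree c d) (κ : Equiv.Perm (Fin k)) (i : Fin k) :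
    (t.act κ).1.numRight i = t.1.numRight (κ i) := by
  obtain ⟨u, v, h, -, -⟩ := t.exists_split (κ i)
  rw [t.numRight_of_split h]
  have h' := word_act t κ
  rw [h, List.flatMap_append, List.flatMap_cons] at h'
  simp only [Letter.bind, Equiv.symm_apply_apply, List.singleton_append] at h'
  rw [numRight_of_split _ h']
  exact length_flatMap_bind fun _ _ => rfl

theorem numEdges_one (n : ℕ+) : (one n).1.numEdges = 0 := rfl

theorem numEdges_comp (i : Fin k) (he : c i = e) (h : Ins c i b a) (x : DecTree c d)
    (y : DecTree b e) : (x.comp i he h y).1.numEdges = x.1.numEdges + y.1.numEdges := by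
  obtain ⟨u, v, hx, hu, hv⟩ := x.exists_split i
  have h1 := (x.comp i he h y).length_word
  have h2 := x.length_word
  rw [word_comp_split i he h x y hx, List.length_append, List.length_append,
    length_flatMap_compWord _ _ _ hu, length_flatMap_compWord _ _ _ hv, length_compWord_self,
    y.length_word] at h1
  rw [hx, List.length_append, List.length_cons] at h2
  omega

/-- For the words `u, i, v` of `x` and `u', j, v'` of `y`, the composite has up to labels the word
`u, u', j, v', v`. -/
theorem numRight_comp_inner (i : Fin k) (he : c i = e) (h : Ins c i b a) (x : DecTree c d)
    (y : DecTree b e) (j : Fin l) : (x.comp i he h y).1.numRight (innerPos h.card i j) =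
      x.1.numRight i + y.1.numRight j := by
  obtain ⟨u, v, hx, hu, hv⟩ := x.exists_split i
  obtain ⟨u', v', hy, -, -⟩ := y.exists_split j
  have h1 := word_comp_split i he h x y hx
  rw [compWord_self] at h1
  nth_rw 2 [hy] at h1
  rw [List.flatMap_append, List.flatMap_cons, List.append_assoc, ← List.append_assoc] at h1
  simp only [Letter.bind, List.cons_append, List.nil_append] at h1
  rw [numRight_of_split _ h1, x.numRight_of_split hx, y.numRight_of_split hy, List.length_append]
  have h2 := length_flatMap_compWord h.card i y.word hv
  have h3 := length_flatMap_bind (w := v') (s := fun p => [lf (innerPos h.card i p)])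
    fun _ _ => rfl
  omega

/-- The condition in the conditional says that `j` is to the left of `i`. In that case the grafted
tree lies to the right of `j`, where one letter is replaced by the whole word of `y`; otherwise
nothing changes there. -/
theorem numRight_comp_outer (i : Fin k) (he : c i = e) (h : Ins c i b a) (x : DecTree c d)
    (y : DecTree b e) (j : Fin k) (hj : j ≠ i) :
    (x.comp i he h y).1.numRight (outerPos h.card i j hj) =
      x.1.numRight j + (if x.1.numRight i < x.1.numRight j then y.1.numEdges else 0) ∧
    x.1.numRight i ≠ x.1.numRight j := by
  obtain ⟨u, v, hx, hu, hv⟩ := x.exists_split i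
  have hjx := x.mem_lfs j
  have h1 := word_comp_split i he h x y hx
  have hn := x.nodup_lfs
  rw [hx, lfs_append, lfs_cons_lf] at hn hjx
  rw [x.numRight_of_split hx]
  have hb : Letter.bind (compWord h.card i y.word) (lf j) = [lf (outerPos h.card i j hj)] :=
    compWord_of_ne _ _ _ hj
  rcases List.mem_append.1 hjx with hju | hjv
  · obtain ⟨u₁, u₂, rfl, hu₁, hu₂⟩ :=
      OInfty.exists_split (List.Nodup.of_append_left hn) hju
    rw [List.append_assoc, List.cons_append] at hx
    rw [List.flatMap_append, List.flatMap_cons, hb, List.append_assoc, List.append_assoc,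
      List.singleton_append] at h1
    rw [numRight_of_split _ h1, x.numRight_of_split hx]
    rw [lfs_append, lfs_cons_lf] at hu
    simp only [List.length_append, List.length_cons]
    rw [length_flatMap_compWord _ _ _ (fun hh => hu (by simp [hh])),
      length_flatMap_compWord _ _ _ hv, length_compWord_self, y.length_word]
    constructor
    · rw [if_pos (by omega)]; omega
    · omega
  · have hjv : j ∈ lfs v := by simpa [hj] using hjv
    obtain ⟨v₁, v₂, rfl, hv₁, hv₂⟩ := OInfty.exists_split
      (List.Nodup.of_cons (List.Nodup.of_append_right hn)) hjv
    rw [← List.cons_append, ← List.append_assoc] at hx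
    rw [List.flatMap_append, List.flatMap_cons, hb, ← List.append_assoc, ← List.append_assoc,
      List.singleton_append] at h1
    rw [numRight_of_split _ h1, x.numRight_of_split hx]
    rw [lfs_append, lfs_cons_lf] at hv
    rw [length_flatMap_compWord _ _ _ (fun hh => hv (by simp [hh]))]
    simp only [List.length_append, List.length_cons]
    constructor
    · rw [if_neg (by omega)]; omega
    · omega

end Counting

end DecTree

end OInfty

/-! ### Partial compositions in terms of lists of colours, and their signs. -/

namespace OInfty

section InsLemmas

variable {C : Type} {k l r s : ℕ} {c : Fin k → C} {b : Fin l → C} {a : Fin r → C} {i : Fin k}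

theorem Ins.ofFn_eq (h : Ins c i b a) :
    List.ofFn a = (List.ofFn c).take i ++ (List.ofFn b ++ (List.ofFn c).drop (i + 1)) := by
  have hc := h.card
  have hi := i.2
  apply List.ext_getElem
  · simp; omega
  · intro n h1 h2
    have hn : n < r := by simpa using h1
    simp only [List.getElem_ofFn, List.getElem_append, List.getElem_take, List.getElem_drop,
      List.length_take, List.length_ofFn]
    rcases pos_cases h.card i ⟨n, hn⟩ with ⟨j, hj, e⟩ | ⟨j, e⟩
    · rw [e, h.outer]
      have e' := congrArg Fin.val e
      rw [outerPos_val] at e'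
      simp only [Fin.lt_def] at e'
      have a1 : (j : ℕ) ≠ i := fun q => hj (Fin.ext q)
      have := j.2
      split_ifs at e' ⊢ with p1 p2 p3 <;> first | omega | (congr 1; apply Fin.ext; simp; omega)
    · rw [e, h.inner]
      have e' : n = i + j := congrArg Fin.val e
      have := j.2
      split_ifs with p1 p2 <;> first | omega | (congr 1; apply Fin.ext; simp; omega)

theorem exists_ins (c : Fin k → C) (i : Fin k) (b : Fin l → C) (hr : r + 1 = k + l) :
    ∃ a : Fin r → C, Ins c i b a := by
  have hi := i.2
  refine ⟨fun p => if h1 : (p : ℕ) < i then c ⟨p, by omega⟩ else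
    if h2 : (p : ℕ) < i + l then b ⟨p - i, by omega⟩ else c ⟨p + 1 - l, by omega⟩, hr, ?_, ?_⟩
  · intro j hj
    have a1 : (j : ℕ) ≠ i := fun q => hj (Fin.ext q)
    have e := outerPos_val hr i j hj
    simp only [Fin.lt_def] at e
    split_ifs at e ⊢ <;> first | omega | (congr 1; apply Fin.ext; simp; omega)
  · intro j
    have := j.2
    have e : (innerPos hr i j : ℕ) = i + j := rfl
    simp only [e]
    rw [dif_neg (by omega), dif_pos (by omega)]
    congr 1
    apply Fin.ext
    simp

theorem ins_iff : Ins c i b a ↔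
    List.ofFn a = (List.ofFn c).take i ++ (List.ofFn b ++ (List.ofFn c).drop (i + 1)) := by
  refine ⟨Ins.ofFn_eq, fun h => ?_⟩
  have hi := i.2
  have hr : r + 1 = k + l := by
    have := congrArg List.length h
    simp at this
    omega
  obtain ⟨a', ha'⟩ := exists_ins c i b hr
  obtain rfl : a = a' := List.ofFn_injective (h.trans ha'.ofFn_eq.symm)
  exact ha'

/-- Once the colours are split at the input in question, iterated insertions are compared by
associativity of concatenation instead of arithmetic of positions. -/
theorem ins_iff_append {D R : List C} {e : C} (hc : List.ofFn c = D ++ e :: R)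
    (hi : (i : ℕ) = D.length) : Ins c i b a ↔ List.ofFn a = D ++ (List.ofFn b ++ R) := by
  have h1 : (D ++ e :: R).drop (D.length + 1) = R := by
    rw [← List.drop_drop, List.drop_left, List.drop_one, List.tail_cons]
  rw [ins_iff, hc, hi, h1, List.take_left]

theorem exists_index {D R : List C} {e : C} (hc : List.ofFn c = D ++ e :: R) :
    ∃ i : Fin k, (i : ℕ) = D.length ∧ c i = e ∧ k = D.length + 1 + R.length := by
  have hl := congrArg List.length hc
  simp at hl
  refine ⟨⟨D.length, by omega⟩, rfl, ?_, by omega⟩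
  have h1 : (List.ofFn c)[D.length]'(by simp; omega) = e := by
    simp [hc]
  simpa using h1

end InsLemmas

variable {𝕜 : Type u} [Field 𝕜] {C : Type}

/-- The axioms of a coloured operad, with a Koszul rule for parallel compositions with an
arbitrary sign `σ`, for operations that are homogeneous with respect to a family `H` of subspaces.
With `σ = 1` and `H = ⊤` these are the axioms of a plain operad, with `σ = -1` those of a graded
operad. -/
structure OperadData.Twisted (O : OperadData.{u, w} 𝕜 C) (H : O.Grading) (σ : 𝕜) : Prop
    extends O.Laws where
  one_mem : ∀ n : C, O.one n ∈ H _ (fun _ : Fin 1 => n) n 0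
  act_mem : ∀ {k : ℕ} {c : Fin k → C} {d : C} (κ : Equiv.Perm (Fin k)) (p : ℤ) (x : O.Op c d),
    x ∈ H _ c d p → O.act κ x ∈ H _ (c ∘ κ) d p
  comp_mem : ∀ {k l r : ℕ} {c : Fin k → C} {b : Fin l → C} {a : Fin r → C} {d e : C} (i : Fin k)
    (he : c i = e) (h : Ins c i b a) (p q : ℤ) (x : O.Op c d) (y : O.Op b e),
    x ∈ H _ c d p → y ∈ H _ b e q → O.comp i he h x y ∈ H _ a d (p + q)
  parallel : ∀ {k l m r s t : ℕ} {c : Fin k → C} {b : Fin l → C} {b₁ : Fin m → C} {a : Fin r → C}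
    {a₁ : Fin s → C} {a₂ : Fin t → C} {d e e₁ : C} (i j : Fin k) (hij : j ≠ i) (hi : c i = e)
    (hj : c j = e₁) (h : Ins c i b a) (h₁ : Ins c j b₁ a₁)
    (hj₂ : a (outerPos h.card i j hij) = e₁) (hi₂ : a₁ (outerPos h₁.card j i hij.symm) = e)
    (h₂ : Ins a (outerPos h.card i j hij) b₁ a₂) (h₃ : Ins a₁ (outerPos h₁.card j i hij.symm) b a₂)
    (p q : ℤ) (x : O.Op c d) (y : O.Op b e) (z : O.Op b₁ e₁), y ∈ H _ b e p → z ∈ H _ b₁ e₁ q →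
    O.comp _ hj₂ h₂ (O.comp i hi h x y) z =
      (σ ^ (p * q)) • O.comp _ hi₂ h₃ (O.comp j hj h₁ x z) y

/-- Operations with a varying list of input colours, and with a chosen degree. -/
structure TOp (O : OperadData.{u, w} 𝕜 C) (e : C) where
  {k : ℕ}
  c : Fin k → C
  op : O.Op c e
  deg : ℕ

namespace TOp

variable {O : OperadData.{u, w} 𝕜 C} {d e e₁ : C}

/-- The list of the input colours. -/
def cols (x : TOp O e) : List C := List.ofFn x.c

/-- Multiplication by a scalar. -/
def smul (t : 𝕜) (x : TOp O e) : TOp O e := ⟨x.c, t • x.op, x.deg⟩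

theorem one_smul (x : TOp O e) : smul 1 x = x := by
  simp [smul]

theorem smul_smul (t t' : 𝕜) (x : TOp O e) : smul t (smul t' x) = smul (t * t') x := by
  simp only [smul]
  congr 1
  exact (mul_smul t t' x.op).symm

theorem length_cols (x : TOp O e) : x.cols.length = x.k := by simp [cols]

open Classical in
/-- The signed composition: `x ∘_i y` with the sign `σ ^ ((k - 1 - i) * |y|)`. -/
noncomputable def comp (σ : 𝕜) (i : ℕ) (x : TOp O e) (y : TOp O d) : TOp O e :=
  if h : ∃ hi : i < x.k, x.c ⟨i, hi⟩ = d then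
    have hi := h.1
    have hex := exists_ins (r := x.k + y.k - 1) x.c ⟨i, h.1⟩ y.c (by omega)
    ⟨hex.choose, σ ^ ((x.k - 1 - i) * y.deg) • O.comp ⟨i, h.1⟩ h.2 hex.choose_spec x.op y.op,
      x.deg + y.deg⟩
  else x

/-- The colours chosen in the definition of `comp` are unique, so any `a` at hand computes the
composite. -/
theorem comp_mk (σ : 𝕜) {k l r : ℕ} {c : Fin k → C} {b : Fin l → C} {a : Fin r → C} (i : Fin k)
    (he : c i = d) (h : Ins c i b a) (x : O.Op c e) (y : O.Op b d) (p q : ℕ) :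
    comp σ i (⟨c, x, p⟩ : TOp O e) (⟨b, y, q⟩ : TOp O d) =
      ⟨a, σ ^ ((k - 1 - i) * q) • O.comp i he h x y, p + q⟩ := by
  have hi := i.2
  have hc := h.card
  unfold comp
  simp only
  rw [dif_pos ⟨i.2, he⟩]
  obtain rfl : r = k + l - 1 := by omega
  generalize_proofs h1
  have h4 := h1.choose_spec
  obtain rfl : h1.choose = a := List.ofFn_injective (h4.ofFn_eq.trans h.ofFn_eq.symm)
  rfl

theorem comp_smul_left (σ t : 𝕜) (i : ℕ) (x : TOp O e) (y : TOp O d) :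
    comp σ i (smul t x) y = smul t (comp σ i x y) := by
  by_cases h : ∃ hi : i < x.k, x.c ⟨i, hi⟩ = d
  · obtain ⟨a, ha⟩ := exists_ins (r := x.k + y.k - 1) x.c ⟨i, h.1⟩ y.c (by have := h.1; omega)
    obtain ⟨c, x, p⟩ := x
    obtain ⟨b, y, q⟩ := y
    have h1 := comp_mk σ ⟨i, h.1⟩ h.2 ha x y p q
    have h2 := comp_mk σ ⟨i, h.1⟩ h.2 ha (t • x) y p q
    simp only at h1 h2
    rw [smul, h1]
    simp only
    rw [h2]
    simp [smul, smul_comm t]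
  · have h' : ¬∃ hi : i < (smul t x).k, (smul t x).c ⟨i, hi⟩ = d := h
    unfold comp
    rw [dif_neg h, dif_neg h']

theorem cols_comp (σ : 𝕜) {x : TOp O e} {y : TOp O d} {D R : List C}
    (hx : x.cols = D ++ d :: R) : (comp σ D.length x y).cols = D ++ (y.cols ++ R) := by
  obtain ⟨c, x, p⟩ := x
  obtain ⟨b, y, q⟩ := y
  rename_i k l
  obtain ⟨i, hi, he, hk⟩ := exists_index (c := c) hx
  obtain ⟨a, ha⟩ := exists_ins (r := k + l - 1) c i b (by have := i.2; omega)
  rw [← hi, comp_mk σ i he ha]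
  exact (ins_iff_append hx hi).1 ha

theorem deg_comp (σ : 𝕜) {x : TOp O e} {y : TOp O d} {D R : List C}
    (hx : x.cols = D ++ d :: R) : (comp σ D.length x y).deg = x.deg + y.deg := by
  obtain ⟨c, x, p⟩ := x
  obtain ⟨b, y, q⟩ := y
  rename_i k l
  obtain ⟨i, hi, he, hk⟩ := exists_index (c := c) hx
  obtain ⟨a, ha⟩ := exists_ins (r := k + l - 1) c i b (by have := i.2; omega)
  rw [← hi, comp_mk σ i he ha]

/-- The operation is homogeneous of the chosen degree. -/
def Homogeneous (H : O.Grading) (x : TOp O e) : Prop := x.op ∈ H _ x.c e x.deg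

theorem Homogeneous.comp {H : O.Grading} {σ : 𝕜} (hO : O.Twisted H σ) {x : TOp O e}
    {y : TOp O d} {D R : List C} (hx : x.cols = D ++ d :: R) (h₁ : x.Homogeneous H)
    (h₂ : y.Homogeneous H) : (TOp.comp σ D.length x y).Homogeneous H := by
  obtain ⟨c, x, p⟩ := x
  obtain ⟨b, y, q⟩ := y
  rename_i k l
  obtain ⟨i, hi, he, hk⟩ := exists_index (c := c) hx
  obtain ⟨a, ha⟩ := exists_ins (r := k + l - 1) c i b (by have := i.2; omega)
  rw [← hi, comp_mk σ i he ha]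
  have := Submodule.smul_mem _ (σ ^ ((k - 1 - i) * q)) (hO.comp_mem i he ha p q x y h₁ h₂)
  simpa [Homogeneous] using this

/-- The inputs to the right of `z` are those to its right in `y` and those to the right of `y` in
`x`. As the normalising exponent is additive both in this number and in the degree, no sign remains.
-/
theorem comp_assoc {σ : 𝕜} (hO : O.Laws) {x : TOp O e} {y : TOp O d} {z : TOp O e₁}
    {D R D' R' : List C} (hx : x.cols = D ++ d :: R) (hy : y.cols = D' ++ e₁ :: R') :
    comp σ (D.length + D'.length) (comp σ D.length x y) z =
      comp σ D.length x (comp σ D'.length y z) := by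
  obtain ⟨c, x, p⟩ := x
  obtain ⟨b, y, q⟩ := y
  obtain ⟨b₁, z, q₁⟩ := z
  rename_i k l m
  obtain ⟨i, hi, he, hk⟩ := exists_index (c := c) hx
  obtain ⟨j, hj, he', hl⟩ := exists_index (c := b) hy
  change List.ofFn c = _ at hx
  change List.ofFn b = _ at hy
  have hil := i.2
  have hjl := j.2
  obtain ⟨a, ha⟩ := exists_ins (r := k + l - 1) c i b (by omega)
  obtain ⟨a₁, ha₁⟩ := exists_ins (r := l + m - 1) b j b₁ (by omega)
  obtain ⟨a₂, ha₂⟩ := exists_ins (r := k + (l + m - 1) - 1) c i a₁ (by omega)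
  have e1 := (ins_iff_append hx hi).1 ha
  have e2 := (ins_iff_append hy hj).1 ha₁
  have e3 := (ins_iff_append hx hi).1 ha₂
  have hpos : ((innerPos ha.card i j : Fin _) : ℕ) = D.length + D'.length := by
    simp [innerPos, hi, hj]
  have ha₃ : Ins a (innerPos ha.card i j) b₁ a₂ := by
    refine (ins_iff_append (D := D ++ D') (e := e₁) (R := R' ++ R) ?_ (by simpa using hpos)).2 ?_
    · rw [e1, hy]; simp
    · rw [e3, e2]; simp
  have hcol : a (innerPos ha.card i j) = e₁ := by rw [ha.inner, he']
  rw [← hpos, ← hi, ← hj, comp_mk σ i he ha, comp_mk σ j he' ha₁, comp_mk σ i he ha₂,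
    comp_mk σ _ hcol ha₃]
  simp only [map_smul, LinearMap.smul_apply, _root_.smul_smul, ← pow_add]
  rw [hO.assoc i j he he' ha hcol ha₃ ha₁ ha₂]
  have hexp : (k + l - 1 - 1 - (innerPos ha.card i j : ℕ)) * q₁ + (k - 1 - i) * q =
      (k - 1 - i) * (q + q₁) + (l - 1 - j) * q₁ := by
    have : k + l - 1 - 1 - (innerPos ha.card i j : ℕ) = (k - 1 - i) + (l - 1 - j) := by
      simp only [innerPos]; omega
    rw [this]; ring
  rw [hexp, add_assoc]

theorem pow_eq_of_even {σ : 𝕜} (hσ : σ * σ = 1) {m n s : ℕ} (h : m = n + 2 * s) :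
    σ ^ m = σ ^ n := by
  rw [h, pow_add, pow_mul, sq, hσ, one_pow, mul_one]

/-- The Koszul rule contributes `y.deg * z.deg`. In addition, grafting `z` to the right of `y`
changes the number of inputs to the right of `y` by `z.k - 1`, and with it the normalisation of `y`.
-/
theorem comp_parallel {H : O.Grading} {σ : 𝕜} (hσ : σ * σ = 1) (hO : O.Twisted H σ) {x : TOp O e}
    {y : TOp O d} {z : TOp O e₁} {D M R : List C} (hx : x.cols = D ++ d :: (M ++ e₁ :: R))
    (hy : y.Homogeneous H) (hz : z.Homogeneous H) (hm : 1 ≤ z.k) :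
    comp σ (D.length + y.k + M.length) (comp σ D.length x y) z =
      smul (σ ^ (y.deg * (z.deg + (z.k - 1))))
        (comp σ D.length (comp σ (D.length + 1 + M.length) x z) y) := by
  obtain ⟨c, x, p⟩ := x
  obtain ⟨b, y, q⟩ := y
  obtain ⟨b₁, z, q₁⟩ := z
  rename_i k l m
  obtain ⟨i, hi, he, hk⟩ := exists_index (c := c) hx
  have hx' : TOp.cols ⟨c, x, p⟩ = (D ++ d :: M) ++ e₁ :: R := by rw [hx]; simp
  obtain ⟨j, hj, he', -⟩ := exists_index (c := c) hx'
  change List.ofFn c = _ at hx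
  change List.ofFn c = _ at hx'
  simp only [List.length_append, List.length_cons] at hj hk
  change 1 ≤ m at hm
  have hil := i.2
  have hjl := j.2
  have hij : j ≠ i := fun e => by rw [e] at hj; omega
  obtain ⟨a, ha⟩ := exists_ins (r := k + l - 1) c i b (by omega)
  obtain ⟨a₁, ha₁⟩ := exists_ins (r := k + m - 1) c j b₁ (by omega)
  have e1 := (ins_iff_append hx hi).1 ha
  have e2 := (ins_iff_append hx' (by simpa using hj)).1 ha₁
  have hp₁ : (outerPos ha.card i j hij : ℕ) = D.length + l + M.length := by
    rw [outerPos_val, if_neg (by rw [Fin.lt_def]; omega)]; omega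
  have hp₂ : (outerPos ha₁.card j i hij.symm : ℕ) = D.length := by
    rw [outerPos_val, if_pos (by rw [Fin.lt_def]; omega)]; omega
  obtain ⟨a₂, ha₂⟩ := exists_ins (r := k + l - 1 + m - 1) a (outerPos ha.card i j hij) b₁
    (by omega)
  have e1' : List.ofFn a = (D ++ (List.ofFn b ++ M)) ++ e₁ :: R := by rw [e1]; simp
  have e3 := (ins_iff_append e1' (by rw [hp₁]; simp; omega)).1 ha₂
  have e2' : List.ofFn a₁ = D ++ d :: (M ++ (List.ofFn b₁ ++ R)) := by rw [e2]; simp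
  have ha₃ : Ins a₁ (outerPos ha₁.card j i hij.symm) b a₂ := by
    rw [ins_iff_append e2' hp₂, e3]; simp
  have hc₁ : a (outerPos ha.card i j hij) = e₁ := by rw [ha.outer, he']
  have hc₂ : a₁ (outerPos ha₁.card j i hij.symm) = d := by rw [ha₁.outer, he]
  have hj' : D.length + 1 + M.length = j := by omega
  rw [hj']
  conv_lhs => rw [← hp₁, ← hi, comp_mk σ i he ha, comp_mk σ _ hc₁ ha₂]
  conv_rhs => rw [← hp₂, comp_mk σ j he' ha₁, comp_mk σ _ hc₂ ha₃]
  simp only [smul, map_smul, LinearMap.smul_apply, _root_.smul_smul, ← pow_add]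
  rw [hO.parallel i j hij he he' ha ha₁ hc₁ hc₂ ha₂ ha₃ q q₁ x y z hy hz]
  rw [← Nat.cast_mul, zpow_natCast, _root_.smul_smul, ← pow_add]
  have hexp : σ ^ (q * (q₁ + (m - 1)) + ((k + m - 1 - 1 -
      (outerPos ha₁.card j i hij.symm : ℕ)) * q + (k - 1 - j) * q₁)) =
      σ ^ ((k + l - 1 - 1 - (outerPos ha.card i j hij : ℕ)) * q₁ + (k - 1 - i) * q + q * q₁) := by
    -- The term `(m - 1) * q` occurs twice on the left: in the scalar of the statement, and from the
    -- additional inputs to the right of `y`.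
    refine pow_eq_of_even hσ (s := (m - 1) * q) ?_
    rw [hp₁, hp₂, hi, hj]
    obtain ⟨m, rfl⟩ := Nat.exists_eq_add_of_le' hm
    have s1 : k + (m + 1) - 1 - 1 - D.length = (1 + M.length + R.length) + m := by omega
    have s2 : k + l - 1 - 1 - (D.length + l + M.length) = R.length := by omega
    have s3 : k - 1 - (D.length + (M.length + 1)) = R.length := by omega
    have s4 : k - 1 - D.length = 1 + M.length + R.length := by omega
    rw [s1, s2, s3, s4, Nat.add_sub_cancel]
    ring
  rw [hexp, Nat.add_right_comm p q]

/-- The unit operation. -/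
def one (O : OperadData.{u, w} 𝕜 C) (e : C) : TOp O e := ⟨fun _ : Fin 1 => e, O.one e, 0⟩

theorem comp_one {σ : 𝕜} (hO : O.Laws) {x : TOp O e} {D R : List C} (hx : x.cols = D ++ d :: R) :
    comp σ D.length x (one O d) = x := by
  obtain ⟨c, x, p⟩ := x
  obtain ⟨i, hi, he, hk⟩ := exists_index (c := c) hx
  have ha : Ins c i (fun _ : Fin 1 => d) c := by
    rw [ins_iff_append hx hi]
    change List.ofFn c = _ at hx
    rw [hx]; simp
  rw [one, ← hi, comp_mk σ i he ha, hO.comp_one]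
  simp

end TOp

end OInfty

namespace OInfty

open Letter

variable {𝕜 : Type u} [Field 𝕜]

/-! ## Evaluation of words in an operad -/

/-- Operations of an operad that interpret the vertices of decorated trees. -/
abbrev Generators (O : OperadData.{u, w} 𝕜 ℕ+) : Type w :=
  ∀ (m : ℕ) (a : Fin m → ℕ+) (d : ℕ+), OpTree a d → 2 ≤ m → O.Op a d

section Steps

variable {V : Type}

/-- A word, read from left to right, turns the list `P` of the colours of the pending inputs into
the list `P'`. -/
def Steps (c : V → ℕ+) : List (Letter V) → List ℕ+ → List ℕ+ → Prop
  | [], P, P' => P = P'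
  | lf v :: w, P, P' => ∃ P₁, P = c v :: P₁ ∧ Steps c w P₁ P'
  | nd (a := a) (d := d) T _ :: w, P, P' =>
      T.IsLeftRecursive ∧ ∃ P₁, P = d :: P₁ ∧ Steps c w (List.ofFn a ++ P₁) P'

theorem steps_append {c : V → ℕ+} {w w' : List (Letter V)} {P P' : List ℕ+} :
    Steps c (w ++ w') P P' ↔ ∃ Q, Steps c w P Q ∧ Steps c w' Q P' := by
  induction w generalizing P with
  | nil => simp [Steps]
  | cons x w ih =>
      cases x with
      | lf v =>
          simp only [List.cons_append, Steps, ih]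
          constructor
          · rintro ⟨P₁, h, Q, h1, h2⟩; exact ⟨Q, ⟨P₁, h, h1⟩, h2⟩
          · rintro ⟨Q, ⟨P₁, h, h1⟩, h2⟩; exact ⟨P₁, h, Q, h1, h2⟩
      | nd T hm =>
          simp only [List.cons_append, Steps, ih]
          constructor
          · rintro ⟨hT, P₁, h, Q, h1, h2⟩; exact ⟨Q, ⟨hT, P₁, h, h1⟩, h2⟩
          · rintro ⟨Q, ⟨hT, P₁, h, h1⟩, h2⟩; exact ⟨hT, P₁, h, Q, h1, h2⟩

theorem steps_flatten {c : V → ℕ+} : ∀ {m : ℕ} {a : Fin m → ℕ+} {w : Fin m → List (Letter V)},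
    (∀ q R, Steps c (w q) (a q :: R) R) → ∀ R, Steps c (List.ofFn w).flatten (List.ofFn a ++ R) R
  | 0, _, _, _, _ => by simp [Steps]
  | m + 1, a, w, h, R => by
      rw [List.ofFn_succ, List.ofFn_succ, List.flatten_cons, steps_append]
      exact ⟨_, h 0 _, steps_flatten (fun q R => h q.succ R) R⟩

theorem FTree.steps_word {k : ℕ} {c : Fin k → ℕ+} {d : ℕ+} (t : FTree c d) (R : List ℕ+) :
    Steps c t.word (d :: R) R := by
  induction t generalizing R with
  | leaf i => exact ⟨R, rfl, rfl⟩
  | node T hm hT ch ih => exact ⟨hT, R, rfl, steps_flatten ih R⟩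

end Steps

namespace TOp

variable {V V' : Type} {O : OperadData.{u, w} 𝕜 ℕ+} {d e : ℕ+}

/-- A generator, with its degree. -/
def ofGen (g : Generators O) {m : ℕ} {a : Fin m → ℕ+} {d : ℕ+} (T : OpTree a d) (hm : 2 ≤ m) :
    TOp O d :=
  ⟨a, g m a d T hm, m - 2⟩

/-- The action of a word on an operation `z`: reading the word from left to right, the vertices
are grafted to the first pending input of `z`, where the first `n` inputs of `z` are not
pending. -/
noncomputable def run (σ : 𝕜) (g : Generators O) : List (Letter V) → ℕ → TOp O e → TOp O e
  | [], _, z => z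
  | lf _ :: w, n, z => run σ g w (n + 1) z
  | nd T hm :: w, n, z => run σ g w n (comp σ n z (ofGen g T hm))

variable {σ : 𝕜} {g : Generators O}

theorem run_erase (w : List (Letter V)) (n : ℕ) (z : TOp O e) :
    run σ g (w.map erase) n z = run σ g w n z := by
  induction w generalizing n z with
  | nil => rfl
  | cons x w ih => cases x <;> simp only [List.map_cons, erase, run, ih]

theorem run_congr {w : List (Letter V)} {w' : List (Letter V')} (h : w.map erase = w'.map erase)
    (n : ℕ) (z : TOp O e) : run σ g w n z = run σ g w' n z := by
  rw [← run_erase w, h, run_erase]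

theorem run_append (w w' : List (Letter V)) (n : ℕ) (z : TOp O e) :
    run σ g (w ++ w') n z = run σ g w' (n + (lfs w).length) (run σ g w n z) := by
  induction w generalizing n z with
  | nil => rfl
  | cons x w ih =>
      cases x with
      | lf v =>
          rw [List.cons_append, run, ih, lfs_cons_lf, run, List.length_cons]
          congr 1; omega
      | nd T hm => rw [List.cons_append, run, ih, lfs_cons_nd, run]

theorem run_smul (w : List (Letter V)) (n : ℕ) (t : 𝕜) (z : TOp O e) :
    run σ g w n (smul t z) = smul t (run σ g w n z) := by
  induction w generalizing n z with
  | nil => rfl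
  | cons x w ih => cases x <;> simp only [run, ih, comp_smul_left]

theorem cols_ofGen {m : ℕ} {a : Fin m → ℕ+} {d : ℕ+} (T : OpTree a d) (hm : 2 ≤ m) :
    (ofGen g T hm).cols = List.ofFn a := rfl

theorem cols_run {c : V → ℕ+} {w : List (Letter V)} {P P' D : List ℕ+} (hw : Steps c w P P')
    {z : TOp O e} (hz : z.cols = D ++ P) :
    (run σ g w D.length z).cols = D ++ ((lfs w).map c ++ P') := by
  induction w generalizing P D z with
  | nil => rw [run, hz, show P = P' from hw]; rfl
  | cons x w ih =>
      cases x with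
      | lf v =>
          obtain ⟨P₁, rfl, h⟩ := hw
          have := ih (D := D ++ [c v]) h (by rw [hz]; simp)
          rw [List.length_append, List.length_singleton] at this
          rw [run, this, lfs_cons_lf]
          simp
      | nd T hm =>
          obtain ⟨-, P₁, rfl, h⟩ := hw
          rw [run, ih h (cols_comp σ hz), lfs_cons_nd]

theorem deg_run {c : V → ℕ+} {w : List (Letter V)} {P P' D : List ℕ+} (hw : Steps c w P P')
    {z : TOp O e} (hz : z.cols = D ++ P) :
    (run σ g w D.length z).deg + 2 * nodeCount w = z.deg + arityCount w := by
  induction w generalizing P D z with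
  | nil => rfl
  | cons x w ih =>
      cases x with
      | lf v =>
          obtain ⟨P₁, rfl, h⟩ := hw
          have := ih (D := D ++ [c v]) h (by rw [hz]; simp)
          rw [List.length_append, List.length_singleton] at this
          simpa [run, nodeCount, arityCount, isNode, arity] using this
      | nd T hm =>
          obtain ⟨-, P₁, rfl, h⟩ := hw
          have := ih h (cols_comp σ (y := ofGen g T hm) hz)
          rw [deg_comp σ hz] at this
          simp only [run, nodeCount, arityCount, isNode, arity, List.map_cons, List.sum_cons,
            ofGen] at this ⊢
          omega

theorem Homogeneous.run {H : O.Grading} (hO : O.Twisted H σ)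
    (hg : ∀ (m : ℕ) (a : Fin m → ℕ+) (d : ℕ+) (T : OpTree a d) (hm : 2 ≤ m),
      (ofGen g T hm).Homogeneous H)
    {c : V → ℕ+} {w : List (Letter V)} {P P' D : List ℕ+} (hw : Steps c w P P')
    {z : TOp O e} (hz : z.cols = D ++ P) (hh : z.Homogeneous H) :
    (TOp.run σ g w D.length z).Homogeneous H := by
  induction w generalizing P D z with
  | nil => exact hh
  | cons x w ih =>
      cases x with
      | lf v =>
          obtain ⟨P₁, rfl, h⟩ := hw
          have := ih (D := D ++ [c v]) h (by rw [hz]; simp) hh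
          rwa [List.length_append, List.length_singleton] at this
      | nd T hm =>
          obtain ⟨-, P₁, rfl, h⟩ := hw
          exact ih h (cols_comp σ hz) (hh.comp hO hz (hg _ _ _ T hm))

/-- All generators are grafted to inputs that come from `y`, so each of them moves inside by
associativity, without signs. -/
theorem run_comp_of_inner (hO : O.Laws) {c : V → ℕ+} {w : List (Letter V)} {P P' D D' R : List ℕ+}
    (hw : Steps c w P P') {x : TOp O e} {y : TOp O d} (hx : x.cols = D' ++ d :: R)
    (hy : y.cols = D ++ P) :
    run σ g w (D'.length + D.length) (comp σ D'.length x y) =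
      comp σ D'.length x (run σ g w D.length y) := by
  induction w generalizing P D y with
  | nil => rfl
  | cons l w ih =>
      cases l with
      | lf v =>
          obtain ⟨P₁, rfl, h⟩ := hw
          have := ih (D := D ++ [c v]) h (by rw [hy]; simp)
          rw [List.length_append, List.length_singleton] at this
          rw [run, run, ← this]; rfl
      | nd T hm =>
          obtain ⟨-, P₁, rfl, h⟩ := hw
          rw [run, run, ← ih h (cols_comp σ hy), comp_assoc hO hx hy]

/-- The value of a decorated tree; its inputs are ordered as the leaves in the plane. -/
noncomputable def eval (σ : 𝕜) (g : Generators O) {k : ℕ} {c : Fin k → ℕ+} (t : FTree c d) :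
    TOp O d :=
  run σ g t.word 0 (one O d)

/-- The word of a tree uses up exactly one pending input. Inserting a unit there, the whole process
takes place inside the unit. -/
theorem run_word (hO : O.Laws) {k : ℕ} {c : Fin k → ℕ+} (t : FTree c d) {z : TOp O e}
    {D R : List ℕ+} (hz : z.cols = D ++ d :: R) :
    run σ g t.word D.length z = comp σ D.length z (eval σ g t) := by
  conv_lhs => rw [← comp_one (σ := σ) hO hz]
  exact run_comp_of_inner hO (D := []) (t.steps_word []) hz rfl

theorem run_comp_of_right {H : O.Grading} (hσ : σ * σ = 1) (hO : O.Twisted H σ)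
    (hg : ∀ (m : ℕ) (a : Fin m → ℕ+) (d : ℕ+) (T : OpTree a d) (hm : 2 ≤ m),
      (ofGen g T hm).Homogeneous H)
    {c : V → ℕ+} {w : List (Letter V)} {P P' D M : List ℕ+}
    (hw : Steps c w P P') {x : TOp O e} {y : TOp O d} (hx : x.cols = D ++ d :: (M ++ P))
    (hy : y.Homogeneous H) :
    run σ g w (D.length + y.k + M.length) (comp σ D.length x y) =
      smul (σ ^ (y.deg * nodeCount w))
        (comp σ D.length (run σ g w (D.length + 1 + M.length) x) y) := by
  induction w generalizing P M x with
  | nil => simp [run, nodeCount, one_smul]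
  | cons l w ih =>
      cases l with
      | lf v =>
          obtain ⟨P₁, rfl, h⟩ := hw
          have := ih (M := M ++ [c v]) h (by rw [hx]; simp)
          rw [List.length_append, List.length_singleton] at this
          rw [run, run, add_assoc, this]
          simp [nodeCount, isNode, add_assoc]
      | nd T hm =>
          rename_i m a d₁
          obtain ⟨-, P₁, rfl, h⟩ := hw
          have hx' : x.cols = (D ++ d :: M) ++ d₁ :: P₁ := by rw [hx]; simp
          have hl : (D ++ d :: M).length = D.length + 1 + M.length := by simp; omega
          have hc := cols_comp σ (y := ofGen g T hm) hx'
          rw [hl] at hc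
          rw [run, run, comp_parallel hσ hO hx hy (hg _ _ _ T hm) (show 1 ≤ _ by
            exact le_trans one_le_two hm), run_smul, ih h (by rw [hc]; simp [cols_ofGen]), smul_smul,
            ← pow_add]
          congr 1
          -- A generator of degree `m` has `m + 2` inputs, so exchanging it with `y` costs `y.deg *
          -- (2 * m + 1)`, which has the parity of `y.deg`.
          refine pow_eq_of_even hσ (s := y.deg * ((ofGen g T hm).k - 2)) ?_
          obtain ⟨m, hm'⟩ := Nat.exists_eq_add_of_le' (show 2 ≤ (ofGen g T hm).k from hm)
          have h2 : (ofGen g T hm).deg = m := by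
            change (ofGen g T hm).k - 2 = m; omega
          rw [h2, hm']
          simp only [nodeCount, isNode, List.map_cons, List.sum_cons]
          rw [show m + 2 - 1 = m + 1 by omega, show m + 2 - 2 = m by omega]
          ring

theorem cols_eval {k : ℕ} {c : Fin k → ℕ+} (t : FTree c d) :
    (eval σ g t).cols = (lfs t.word).map c := by
  have := cols_run (σ := σ) (g := g) (D := []) (t.steps_word []) (z := one O d) rfl
  simpa [eval] using this

theorem deg_eval {k : ℕ} {c : Fin k → ℕ+} (t : FTree c d) :
    (eval σ g t).deg + 2 * t.numNodes = t.numEdges := by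
  have := deg_run (σ := σ) (g := g) (D := []) (t.steps_word []) (z := one O d) rfl
  rw [FTree.nodeCount_word, FTree.arityCount_word] at this
  simpa [eval, one] using this

theorem Homogeneous.eval {H : O.Grading} (hO : O.Twisted H σ)
    (hg : ∀ (m : ℕ) (a : Fin m → ℕ+) (d : ℕ+) (T : OpTree a d) (hm : 2 ≤ m),
      (ofGen g T hm).Homogeneous H) {k : ℕ} {c : Fin k → ℕ+} (t : FTree c d) :
    (TOp.eval σ g t).Homogeneous H :=
  Homogeneous.run hO hg (D := []) (t.steps_word []) (z := one O d) rfl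
    (hO.one_mem d)

end TOp

end OInfty

/-! ### Values of decorated trees with labelled leaves. -/

namespace OInfty

open Letter

variable {𝕜 : Type u} [Field 𝕜]

theorem exists_perm_of_nodup {k : ℕ} {l : List (Fin k)} (h : l.Nodup) (h' : ∀ i, i ∈ l) :
    ∃ lam : Equiv.Perm (Fin k), l = List.ofFn lam := by
  have hl : l.length = k := by
    have := List.toFinset_card_of_nodup h
    rw [← this, Finset.eq_univ_iff_forall.2 fun i => List.mem_toFinset.2 (h' i)]
    simp
  have hinj : Function.Injective fun j : Fin k => l.get (j.cast hl.symm) := fun i j e =>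
    Fin.cast_injective _ (List.nodup_iff_injective_get.1 h e)
  refine ⟨Equiv.ofBijective _ (Finite.injective_iff_bijective.1 hinj), ?_⟩
  apply List.ext_get
  · simp [hl]
  · intro n h1 h2
    simp

theorem length_lfs_map_erase {V : Type} (w : List (Letter V)) :
    (lfs (w.map erase)).length = (lfs w).length := by
  induction w with
  | nil => rfl
  | cons x w ih =>
      cases x with
      | lf v => rw [List.map_cons, erase, lfs_cons_lf, lfs_cons_lf, List.length_cons, ih]; rfl
      | nd T hm => rw [List.map_cons, erase, lfs_cons_nd, lfs_cons_nd, ih]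

theorem lfs_map_lf {V : Type} (l : List V) : lfs (l.map lf) = l := by
  induction l with
  | nil => rfl
  | cons x l ih => rw [List.map_cons, lfs_cons_lf, ih]

theorem DecTree.word_corolla {k : ℕ} {c : Fin k → ℕ+} {d : ℕ+} (T : OpTree c d) (hk : 2 ≤ k)
    (hT : T.IsLeftRecursive) :
    (DecTree.corolla T hk hT).word = nd T hk :: (List.finRange k).map lf := by
  change nd T hk :: (List.ofFn fun q => [lf q]).flatten = _
  rw [List.ofFn_eq_map, ← List.flatMap_def, List.map_eq_flatMap]

namespace TOp

variable {O : OperadData.{u, w} 𝕜 ℕ+} {d e : ℕ+}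

section Act

variable {C : Type} {P : OperadData.{u, w} 𝕜 C} {k : ℕ} {c : Fin k → C} {z : C}

theorem mk_act_congr {κ κ' : Equiv.Perm (Fin k)} (h : κ = κ') (f : P.Op c z) (n : ℕ) :
    (⟨c ∘ κ, P.act κ f, n⟩ : TOp P z) = ⟨c ∘ κ', P.act κ' f, n⟩ := by subst h; rfl

theorem mk_act_one (hP : P.Laws) (f : P.Op c z) (n : ℕ) :
    (⟨c ∘ (1 : Equiv.Perm (Fin k)), P.act 1 f, n⟩ : TOp P z) = ⟨c, f, n⟩ := by
  have := hP.act_one f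
  exact congrArg (fun f => (⟨c, f, n⟩ : TOp P z)) this

theorem mk_act_mul (hP : P.Laws) (κ lam : Equiv.Perm (Fin k)) (f : P.Op c z) (n : ℕ) :
    (⟨(c ∘ κ) ∘ lam, P.act lam (P.act κ f), n⟩ : TOp P z) =
      ⟨c ∘ ⇑(κ * lam), P.act (κ * lam) f, n⟩ :=
  congrArg (fun f => (⟨c ∘ ⇑(κ * lam), f, n⟩ : TOp P z)) (hP.act_mul κ lam f)

theorem _root_.OInfty.OperadData.Laws.act_injective (hP : P.Laws) {κ : Equiv.Perm (Fin k)}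
    {f f' : P.Op c z} (h : P.act κ f = P.act κ f') : f = f' := by
  have h1 := mk_act_mul hP κ κ⁻¹ f 0
  rw [h, mk_act_mul hP, mk_act_congr (mul_inv_cancel κ), mk_act_congr (mul_inv_cancel κ),
    mk_act_one hP, mk_act_one hP] at h1
  simpa using h1.symm

theorem exists_act_eq (hP : P.Laws) (lam : Equiv.Perm (Fin k)) {c' : Fin k → C} (hc : c' = c ∘ lam)
    (f' : P.Op c' z) (n : ℕ) :
    ∃ f : P.Op c z, (⟨c', f', n⟩ : TOp P z) = ⟨c ∘ lam, P.act lam f, n⟩ := by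
  obtain rfl : c = c' ∘ ⇑lam⁻¹ := by rw [hc]; ext j; simp
  refine ⟨P.act lam⁻¹ f', ?_⟩
  rw [mk_act_mul hP, mk_act_congr (inv_mul_cancel lam), mk_act_one hP]

end Act

variable {k l r : ℕ} {c : Fin k → ℕ+} {b : Fin l → ℕ+} {a : Fin r → ℕ+} {σ : 𝕜} {g : Generators O}

/-- `f` is the value of a decorated tree, with the inputs ordered by the labels of the leaves. -/
def IsValue (σ : 𝕜) (g : Generators O) (t : DecTree c d) (f : O.Op c d) : Prop :=
  ∃ lam : Equiv.Perm (Fin k), lfs t.word = List.ofFn lam ∧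
    eval σ g t.1 = ⟨c ∘ lam, O.act lam f, (eval σ g t.1).deg⟩

theorem IsValue.of_eq {t : DecTree c d} {f : O.Op c d} {lam : Equiv.Perm (Fin k)} {n : ℕ}
    (hl : lfs t.word = List.ofFn lam) (he : eval σ g t.1 = ⟨c ∘ lam, O.act lam f, n⟩) :
    IsValue σ g t f :=
  ⟨lam, hl, by rw [he]⟩

theorem exists_isValue (hO : O.Laws) (σ : 𝕜) (g : Generators O) (t : DecTree c d) :
    ∃ f, IsValue σ g t f := by
  obtain ⟨lam, hl⟩ := exists_perm_of_nodup t.nodup_lfs t.mem_lfs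
  have h1 := cols_eval (σ := σ) (g := g) t.1
  rw [show lfs t.1.word = _ from hl, List.map_ofFn] at h1
  suffices h : ∀ z : TOp O d, z.cols = List.ofFn (c ∘ lam) →
      ∃ f, z = ⟨c ∘ lam, O.act lam f, z.deg⟩ by
    obtain ⟨f, hf⟩ := h _ h1
    exact ⟨f, lam, hl, hf⟩
  rintro ⟨c', z, n⟩ h
  rename_i k'
  obtain rfl : k' = k := by simpa [cols] using congrArg List.length h
  exact exists_act_eq hO lam (List.ofFn_injective h) z n

theorem IsValue.unique (hO : O.Laws) {t : DecTree c d} {f f' : O.Op c d} (h : IsValue σ g t f)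
    (h' : IsValue σ g t f') : f = f' := by
  obtain ⟨lam, h1, h2⟩ := h
  obtain ⟨lam', h3, h4⟩ := h'
  obtain rfl : lam = lam' := DFunLike.coe_injective (List.ofFn_injective (h1.symm.trans h3))
  rw [h2] at h4
  exact hO.act_injective (by simpa using h4)

theorem isValue_one (hO : O.Laws) (n : ℕ+) : IsValue σ g (DecTree.one n) (O.one n) :=
  ⟨1, rfl, (mk_act_one hO (O.one n) 0).symm⟩

/-- Evaluation depends on the shape of the tree only; relabelling changes just the permutation
between planar order and labels. -/
theorem isValue_act (hO : O.Laws) {t : DecTree c d} {f : O.Op c d} (h : IsValue σ g t f)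
    (κ : Equiv.Perm (Fin k)) : IsValue σ g (t.act κ) (O.act κ f) := by
  obtain ⟨lam, h1, h2⟩ := h
  have h3 : eval σ g (t.act κ).1 = eval σ g t.1 := by
    refine run_congr ?_ _ _
    rw [show (t.act κ).1.word = _ from t.word_act κ]
    exact map_erase_flatMap fun _ _ => rfl
  refine ⟨κ⁻¹ * lam, ?_, ?_⟩
  · rw [t.word_act, lfs_flatMap, h1]
    have : (fun j => lfs [(lf (κ.symm j) : Letter (Fin k))]) = fun j => [κ.symm j] := by
      funext j; rfl
    rw [this, ← List.map_eq_flatMap, List.map_ofFn]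
    rfl
  · rw [h3, mk_act_mul hO, mk_act_congr (mul_inv_cancel_left κ lam)]
    exact h2

theorem comp_one_left (hO : O.Laws) (y : TOp O d) : comp σ 0 (one O d) y = y := by
  obtain ⟨b, y, q⟩ := y
  have ha : Ins (fun _ : Fin 1 => d) 0 b b := by
    rw [ins_iff_append (D := []) (R := []) (e := d) (by simp) rfl]
    simp
  have := comp_mk σ (0 : Fin 1) rfl ha (O.one d) y 0 q
  rw [hO.one_comp] at this
  simpa [one] using this

theorem isValue_corolla (hO : O.Laws) (T : OpTree c d) (hk : 2 ≤ k) (hT : T.IsLeftRecursive) :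
    IsValue σ g (DecTree.corolla T hk hT) (g k c d T hk) := by
  have hw := DecTree.word_corolla T hk hT
  have hrun : ∀ (w : List (Fin k)) (n : ℕ) (z : TOp O d), run σ g (w.map lf) n z = z := by
    intro w
    induction w with
    | nil => exact fun n z => rfl
    | cons x w ih => exact fun n z => ih _ _
  have hev : eval σ g (DecTree.corolla T hk hT).1 = ofGen g T hk := by
    rw [eval, show (DecTree.corolla T hk hT).1.word = _ from hw, run, hrun, comp_one_left hO]
  refine ⟨1, ?_, ?_⟩
  · rw [hw, lfs_cons_nd, lfs_map_lf, ← List.ofFn_id]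
    rfl
  · rw [hev]
    exact (mk_act_one hO _ _).symm

/-- The position in a composite of an input of the first factor, with a junk value at the input
along which the composite is taken. -/
def _root_.OInfty.outerLabel (h : r + 1 = k + l) (i j : Fin k) : ℕ :=
  if hj : j = i then 0 else outerPos h i j hj

theorem _root_.OInfty.DecTree.map_lfs_comp (i : Fin k) (he : c i = e) (h : Ins c i b a)
    (x : DecTree c d) (y : DecTree b e) {u v : List (Letter (Fin k))}
    (hw : x.word = u ++ lf i :: v) (hu : i ∉ lfs u) (hv : i ∉ lfs v) :
    (lfs (x.comp i he h y).word).map Fin.val = (lfs u).map (outerLabel h.card i) ++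
      ((lfs y.word).map (fun j => (innerPos h.card i j : ℕ)) ++
        (lfs v).map (outerLabel h.card i)) := by
  rw [DecTree.word_comp_split i he h x y hw, lfs_append, lfs_append, lfs_flatMap, lfs_flatMap,
    DecTree.compWord_self, lfs_flatMap]
  have hc : ∀ j, j ≠ i → (lfs (DecTree.compWord h.card i y.word j)).map Fin.val =
      [outerLabel h.card i j] := by
    intro j hj
    rw [DecTree.compWord_of_ne _ _ _ hj, outerLabel, dif_neg hj]; rfl
  rw [List.map_append, List.map_append, List.map_flatMap, List.map_flatMap, List.map_flatMap]
  congr 1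
  · rw [List.map_eq_flatMap]
    exact List.flatMap_congr fun j hj => hc j fun e => hu (e ▸ hj)
  congr 1
  · rw [List.map_eq_flatMap]; rfl
  · rw [List.map_eq_flatMap]
    exact List.flatMap_congr fun j hj => hc j fun e => hv (e ▸ hj)

/-- Positions are regarded as colours: the lists then express an insertion, and the two clauses of
`Ins` are the two conditions on a block permutation. -/
theorem isBlockPerm_of_ofFn (h : r + 1 = k + l) {i p : Fin k} {lam : Equiv.Perm (Fin k)}
    {mu : Equiv.Perm (Fin l)} {nu : Equiv.Perm (Fin r)} {A : Fin k → ℕ} {L R : List (Fin k)}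
    (hA : ∀ j hj, A j = outerPos h i j hj) (hlam : List.ofFn lam = L ++ i :: R)
    (hp : (p : ℕ) = L.length) (hi : lam p = i)
    (hnu : (List.ofFn nu).map Fin.val =
      L.map A ++ ((List.ofFn mu).map (fun j => (innerPos h i j : ℕ)) ++ R.map A)) :
    IsBlockPerm h p lam mu nu := by
  subst hi
  have h1 : Ins (A ∘ lam) p ((fun j => (innerPos h (lam p) j : ℕ)) ∘ mu) (Fin.val ∘ nu) := by
    have h2 : List.ofFn (A ∘ lam) = L.map A ++ A (lam p) :: R.map A := by
      rw [← List.map_ofFn, hlam]; simp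
    rw [ins_iff_append h2 (by simpa using hp), ← List.map_ofFn, hnu, List.map_ofFn]
  exact ⟨fun j hj => Fin.ext ((h1.outer j hj).trans (hA _ _)), fun j => Fin.ext (h1.inner j)⟩

/-- The prescribed sign arises from reading the word `u, i, v` of `x` with the word of `y` in place
of `i`, combined with the normalisation of the composition. -/
theorem isValue_comp {H : O.Grading} (hσ : σ * σ = 1) (hO : O.Twisted H σ)
    (hg : ∀ (m : ℕ) (a : Fin m → ℕ+) (d : ℕ+) (T : OpTree a d) (hm : 2 ≤ m),
      (ofGen g T hm).Homogeneous H) (i : Fin k) (he : c i = e) (h : Ins c i b a)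
    {x : DecTree c d} {y : DecTree b e} {f : O.Op c d} {f' : O.Op b e}
    (hx : IsValue σ g x f) (hy : IsValue σ g y f') :
    IsValue σ g (x.comp i he h y)
      (σ ^ (x.1.numRight i * y.1.numEdges) • O.comp i he h f f') := by
  obtain ⟨lam, hlam, hx⟩ := hx
  obtain ⟨mu, hmu, hy⟩ := hy
  obtain ⟨nu, hnu⟩ := exists_perm_of_nodup (x.comp i he h y).nodup_lfs (x.comp i he h y).mem_lfs
  obtain ⟨u, v, hw, hu, hv⟩ := x.exists_split i
  have hsplit := DecTree.word_comp_split i he h x y hw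
  have hlam' := hlam
  rw [hw, lfs_append, lfs_cons_lf] at hlam'
  obtain ⟨p, hp, hpi, hk⟩ := exists_index hlam'.symm
  -- the permutation of the leaves of the composite
  have hblock : IsBlockPerm h.card p lam mu nu := by
    refine isBlockPerm_of_ofFn h.card (A := outerLabel h.card i)
      (fun j hj => dif_neg hj) hlam'.symm hp hpi ?_
    rw [← hnu, ← hmu, DecTree.map_lfs_comp i he h x y hw hu hv]
  subst hpi
  have h₁ : Ins (c ∘ lam) p (b ∘ mu) (a ∘ nu) := by
    refine ⟨h.card, fun j hj => ?_, fun j => ?_⟩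
    · rw [Function.comp, hblock.1 j hj, h.outer]; rfl
    · rw [Function.comp, hblock.2 j, h.inner]; rfl
  -- the value of the composite
  have hst : Steps c x.1.word [d] [] := x.1.steps_word []
  rw [show x.1.word = _ from hw, steps_append] at hst
  obtain ⟨Q, hst₁, Q₁, rfl, hst₂⟩ := hst
  have hcols := cols_run (σ := σ) (g := g) (D := []) hst₁ (z := one O d) rfl
  rw [List.nil_append, he] at hcols
  have hval : eval σ g (x.comp (lam p) he h y).1 =
      smul (σ ^ ((eval σ g y.1).deg * nodeCount v)) (comp σ p (eval σ g x.1) (eval σ g y.1)) := by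
    have e1 : (x.comp (lam p) he h y).1.word.map erase =
        (u.map erase ++ (y.1.word.map erase ++ v.map erase)) := by
      rw [show (x.comp (lam p) he h y).1.word = _ from hsplit, List.map_append, List.map_append,
        DecTree.erase_flatMap_compWord _ _ _ hu, DecTree.erase_flatMap_compWord _ _ _ hv,
        DecTree.erase_compWord_self]
      rfl
    rw [eval, ← run_erase, e1, run_append, run_append, run_erase, run_erase, run_erase,
      length_lfs_map_erase, length_lfs_map_erase, Nat.zero_add]
    have hl : ((lfs u).map c).length = (lfs u).length := by simp
    have hrun := run_word (σ := σ) (g := g) hO.toLaws y.1 hcols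
    rw [hl] at hrun
    have hyk : (eval σ g y.1).k = (lfs y.1.word).length := by
      rw [← length_cols, cols_eval, List.length_map]
    -- All of `v` is grafted to the right of `y`; moving `y` to the end costs its degree for every
    -- vertex of `v`.
    have e3 := run_comp_of_right (M := []) hσ hO hg hst₂ hcols (Homogeneous.eval hO hg y.1)
    rw [hl, hyk] at e3
    simp only [List.length_nil, Nat.add_zero] at e3
    rw [List.length_nil] at hrun
    have hX : eval σ g x.1 = run σ g v ((lfs u).length + 1) (run σ g u 0 (one O d)) := by
      rw [eval, show x.1.word = _ from hw, run_append, run, Nat.zero_add]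
    rw [hrun, e3, hp, hX]
  have hcomp := (congrArg₂ (comp σ p) hx hy).trans (comp_mk σ p (by exact he) h₁ _ _ _ _)
  rw [hcomp, hO.equivariant p lam mu nu he h h₁ hblock] at hval
  refine IsValue.of_eq (n := (eval σ g x.1).deg + (eval σ g y.1).deg) hnu (hval.trans ?_)
  rw [smul, _root_.smul_smul, ← pow_add, map_smul]
  -- The inputs to the right of `p` are the leaves of `v`, so together with the vertices all letters
  -- of `v` are counted. The degree of `y` differs from its number of edges by an even number.
  have hexp : σ ^ ((eval σ g y.1).deg * nodeCount v + (k - 1 - p) * (eval σ g y.1).deg) =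
      σ ^ (x.1.numRight (lam p) * y.1.numEdges) := by
    have h1 := deg_eval (σ := σ) (g := g) y.1
    rw [x.numRight_of_split hw, length_eq_nodeCount_add, hp, ← h1,
      show k - 1 - (lfs u).length = (lfs v).length by omega]
    refine (pow_eq_of_even hσ (s := (nodeCount v + (lfs v).length) * y.1.numNodes) ?_).symm
    ring
  rw [hexp]

end TOp

end OInfty

/-! ### The signed operad of decorated trees, and existence of extensions. -/

namespace OInfty

open Letter

variable (𝕜 : Type u) [Field 𝕜]

/-- The operad of decorated planar trees, with the signs
`σ ^ (#{edges and leaves to the right of the leaf i in x} * #{edges and leaves of y but the root})`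
in the composition `x ∘_i y`. -/
noncomputable def signedDecOperad (σ : 𝕜) : OperadData.{u, u} 𝕜 ℕ+ where
  Op c d := DecTree c d →₀ 𝕜
  act κ := Finsupp.lmapDomain 𝕜 𝕜 fun x => x.act κ
  one n := Finsupp.single (DecTree.one n) 1
  comp i he h := bilinearExt 𝕜 fun x y =>
    Finsupp.single (x.comp i he h y) (σ ^ (x.1.numRight i * y.1.numEdges))

variable {𝕜}

theorem bilinearExt_single {A B M : Type} (m : A → B → M →₀ 𝕜) (x : A) (y : B) (s t : 𝕜) :
    bilinearExt 𝕜 m (Finsupp.single x s) (Finsupp.single y t) = (s * t) • m x y := by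
  simp [bilinearExt, mul_smul]

variable {k l r : ℕ} {c : Fin k → ℕ+} {b : Fin l → ℕ+} {a : Fin r → ℕ+} {d e : ℕ+} {σ : 𝕜}

/-- The basis vectors of the operad of decorated trees. -/
noncomputable def DecTree.vec (σ : 𝕜) (t : DecTree c d) : (signedDecOperad 𝕜 σ).Op c d :=
  (Finsupp.single t 1 : DecTree c d →₀ 𝕜)

theorem DecTree.comp_vec (i : Fin k) (he : c i = e) (h : Ins c i b a)
    (x : DecTree c d) (y : DecTree b e) :
    (signedDecOperad 𝕜 σ).comp i he h (x.vec σ) (y.vec σ) =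
      (σ ^ (x.1.numRight i * y.1.numEdges)) • (x.comp i he h y).vec σ := by
  refine (bilinearExt_single _ x y 1 1).trans ?_
  rw [one_mul, one_smul]
  exact (Finsupp.smul_single_one _ _).symm

theorem DecTree.act_vec (κ : Equiv.Perm (Fin k)) (x : DecTree c d) :
    (signedDecOperad 𝕜 σ).act κ (x.vec σ) = (x.act κ).vec σ :=
  Finsupp.mapDomain_single

theorem DecTree.one_eq_vec (n : ℕ+) : (signedDecOperad 𝕜 σ).one n = (DecTree.one n).vec σ := rfl

theorem DecTree.length_lfs (t : DecTree c d) : (lfs t.word).length = k := by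
  obtain ⟨lam, h⟩ := exists_perm_of_nodup t.nodup_lfs t.mem_lfs
  rw [h, List.length_ofFn]

theorem DecTree.numNodes_add (t : DecTree c d) : t.1.numNodes + k = t.1.numEdges + 1 := by
  rw [← t.length_word, length_eq_nodeCount_add, t.length_lfs, word, FTree.nodeCount_word]

theorem signedDecOperad_hom_ext {M : Type*} [AddCommGroup M] [Module 𝕜 M]
    {f f' : (signedDecOperad 𝕜 σ).Op c d →ₗ[𝕜] M}
    (h : ∀ t : DecTree c d, f (t.vec σ) =
      f' (t.vec σ)) : f = f' :=
  Finsupp.lhom_ext' (α := DecTree c d) (M := 𝕜) (φ := f) (ψ := f') fun t =>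
    LinearMap.ext_ring (h t)

theorem OperadData.Twisted.mem_of_act_mem {C : Type} {P : OperadData.{u, w} 𝕜 C} {H : P.Grading}
    (hP : P.Twisted H σ) {k : ℕ} {c : Fin k → C} {z : C} {κ : Equiv.Perm (Fin k)} {f : P.Op c z}
    {p : ℤ} (h : P.act κ f ∈ H k (c ∘ κ) z p) : f ∈ H k c z p := by
  have h1 : P.act (κ * κ⁻¹) f ∈ H k (c ∘ ⇑(κ * κ⁻¹)) z p := by
    rw [← hP.act_mul]
    exact hP.act_mem κ⁻¹ p _ h
  have h2 : ∀ κ' : Equiv.Perm (Fin k), κ' = 1 → P.act κ' f ∈ H k (c ∘ κ') z p → f ∈ H k c z p := by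
    rintro _ rfl h
    rw [← hP.act_one f]
    exact h
  exact h2 _ (mul_inv_cancel κ) h1

/-- Operations that interpret the vertices of decorated trees extend to a morphism of operads. -/
theorem exists_isOperadHom {P : OperadData.{u, w} 𝕜 ℕ+} {H : P.Grading} (hσ : σ * σ = 1)
    (hP : P.Twisted H σ) (g : Generators P)
    (hg : ∀ (m : ℕ) (a : Fin m → ℕ+) (d : ℕ+) (T : OpTree a d) (hm : 2 ≤ m),
      g m a d T hm ∈ H m a d ((m - 2 : ℕ) : ℤ)) :
    ∃ F : LinFamily (signedDecOperad 𝕜 σ).toCollection P.toCollection,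
      IsOperadHom (signedDecOperad 𝕜 σ) P F ∧
      (∀ {k : ℕ} {c : Fin k → ℕ+} {d : ℕ+} (T : OpTree c d) (hk : 2 ≤ k)
        (hT : T.IsLeftRecursive), F k c d ((DecTree.corolla T hk hT).vec σ) = g k c d T hk) ∧
      ∀ {k : ℕ} {c : Fin k → ℕ+} {d : ℕ+} (t : DecTree c d),
        F k c d (t.vec σ) ∈ H k c d (k - 1 - t.1.numNodes) := by
  choose val hval using fun (k : ℕ) (c : Fin k → ℕ+) (d : ℕ+) (t : DecTree c d) =>
    TOp.exists_isValue hP.toLaws σ g t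
  let F : LinFamily (signedDecOperad 𝕜 σ).toCollection P.toCollection := fun k c d =>
    (Finsupp.linearCombination 𝕜 (val k c d) : (DecTree c d →₀ 𝕜) →ₗ[𝕜] P.Op c d)
  have hF : ∀ {k : ℕ} {c : Fin k → ℕ+} {d : ℕ+} (t : DecTree c d),
      F k c d (t.vec σ) = val k c d t :=
    fun t => (Finsupp.linearCombination_single _ _ _).trans (one_smul _ _)
  refine ⟨F, ⟨?_, ?_, ?_⟩, ?_, ?_⟩
  · intro k c d κ x
    refine LinearMap.congr_fun (f := F k (c ∘ κ) d ∘ₗ (signedDecOperad 𝕜 σ).act κ)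
      (g := P.act κ ∘ₗ F k c d) (signedDecOperad_hom_ext fun t => ?_) x
    rw [LinearMap.comp_apply, LinearMap.comp_apply, DecTree.act_vec, hF, hF]
    exact (hval _ _ _ _).unique hP.toLaws (TOp.isValue_act hP.toLaws (hval _ _ _ t) κ)
  · intro n
    rw [DecTree.one_eq_vec, hF]
    exact (hval _ _ _ _).unique hP.toLaws (TOp.isValue_one hP.toLaws n)
  · intro k l r c b a d e i he h x y
    refine LinearMap.congr_fun₂ (f := ((signedDecOperad 𝕜 σ).comp i he h).compr₂ (F r a d))
      (g := (P.comp i he h).compl₁₂ (F k c d) (F l b e))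
      (signedDecOperad_hom_ext fun x => signedDecOperad_hom_ext fun y => ?_) x y
    -- The sign in the composition of trees and the sign in the value of the composite are the same
    -- and cancel, as `σ * σ = 1`.
    rw [LinearMap.compr₂_apply, LinearMap.compl₁₂_apply, DecTree.comp_vec, map_smul, hF, hF, hF,
      (hval _ _ _ (x.comp i he h y)).unique hP.toLaws
        (TOp.isValue_comp hσ hP (fun _ _ _ T hm => hg _ _ _ T hm) i he h
          (hval _ _ _ x) (hval _ _ _ y)), smul_smul, ← mul_pow, hσ, one_pow, one_smul]
  · intro k c d T hk hT
    rw [hF]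
    exact (hval _ _ _ _).unique hP.toLaws (TOp.isValue_corolla hP.toLaws T hk hT)
  · intro k c d t
    rw [hF]
    obtain ⟨lam, -, h⟩ := hval k c d t
    have h1 := TOp.Homogeneous.eval hP (fun _ _ _ T hm => hg _ _ _ T hm) t.1
    have h2 := TOp.deg_eval (σ := σ) (g := g) t.1
    have h3 : P.act lam (val k c d t) ∈ H _ (c ∘ lam) d ((TOp.eval σ g t.1).deg : ℕ) := by
      rw [h] at h1; exact h1
    have h4 := t.numNodes_add
    rw [show (k : ℤ) - 1 - t.1.numNodes = ((TOp.eval σ g t.1).deg : ℕ) by omega]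
    exact hP.mem_of_act_mem h3

end OInfty

/-! ### Uniqueness of extensions. -/

namespace OInfty

open Letter

variable {𝕜 : Type u} [Field 𝕜]

namespace TOp

variable {O : OperadData.{u, v} 𝕜 ℕ+} {P : OperadData.{u, w} 𝕜 ℕ+} {d e : ℕ+}

/-- The image under a family of linear maps. -/
def map (F : LinFamily O.toCollection P.toCollection) (x : TOp O e) : TOp P e :=
  ⟨x.c, F _ _ _ x.op, x.deg⟩

theorem map_comp {F : LinFamily O.toCollection P.toCollection} (hF : IsOperadHom O P F) (σ : 𝕜)
    (i : ℕ) (x : TOp O e) (y : TOp O d) :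
    (comp σ i x y).map F = comp σ i (x.map F) (y.map F) := by
  by_cases h : ∃ hi : i < x.k, x.c ⟨i, hi⟩ = d
  · obtain ⟨a, ha⟩ := exists_ins (r := x.k + y.k - 1) x.c ⟨i, h.1⟩ y.c (by have := h.1; omega)
    obtain ⟨c, x, p⟩ := x
    obtain ⟨b, y, q⟩ := y
    have h1 := comp_mk σ ⟨i, h.1⟩ h.2 ha x y p q
    have h2 := comp_mk σ ⟨i, h.1⟩ h.2 ha (F _ _ _ x) (F _ _ _ y) p q
    rw [← hF.map_comp] at h2
    simp only at h1 h2
    rw [h1]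
    simp only [map]
    rw [h2, map_smul]
  · have h' : ¬∃ hi : i < (x.map F).k, (x.map F).c ⟨i, hi⟩ = d := h
    unfold comp
    rw [dif_neg h, dif_neg h']

theorem map_run {F : LinFamily O.toCollection P.toCollection} (hF : IsOperadHom O P F) (σ : 𝕜)
    (g : Generators O) {V : Type} (w : List (Letter V)) (n : ℕ) (z : TOp O e) :
    (run σ g w n z).map F = run σ (fun m a d T hm => F m a d (g m a d T hm)) w n (z.map F) := by
  induction w generalizing n z with
  | nil => rfl
  | cons x w ih =>
      cases x with
      | lf v => exact ih _ _
      | nd T hm => rw [run, ih, map_comp hF]; rfl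

theorem map_eval {F : LinFamily O.toCollection P.toCollection} (hF : IsOperadHom O P F) (σ : 𝕜)
    (g : Generators O) {k : ℕ} {c : Fin k → ℕ+} (t : FTree c d) :
    (eval σ g t).map F = eval σ (fun m a d T hm => F m a d (g m a d T hm)) t := by
  rw [eval, map_run hF, eval, one, map, hF.map_one]
  rfl

end TOp

section Universal

variable {k l r : ℕ} {c : Fin k → ℕ+} {b : Fin l → ℕ+} {a : Fin r → ℕ+} {d e : ℕ+} {σ : 𝕜}

open Classical in
/-- The corollas, as operations. -/
noncomputable def corollas (σ : 𝕜) : Generators (signedDecOperad 𝕜 σ) :=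
  fun _ _ _ T hm => if hT : T.IsLeftRecursive then (DecTree.corolla T hm hT).vec σ else 0

/-- The operation `z` is a multiple of a decorated tree with the prefix notation `w`, with leaves
labelled from left to right. -/
def IsWordOp (w : List (Letter Unit)) (z : TOp (signedDecOperad 𝕜 σ) e) : Prop :=
  ∃ (s : DecTree z.c e) (ε : 𝕜), ε ≠ 0 ∧ z.op = ε • s.vec σ ∧ s.word.map erase = w ∧
    lfs s.word = List.finRange z.k

theorem isWordOp_one (n : ℕ+) : IsWordOp [lf ()] (TOp.one (signedDecOperad 𝕜 σ) n) :=
  ⟨DecTree.one n, 1, one_ne_zero, (one_smul _ _).symm, rfl, rfl⟩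

theorem lfs_comp_eq_finRange (i : Fin k) (he : c i = e) (h : Ins c i b a) (x : DecTree c d)
    (y : DecTree b e) (hx : lfs x.word = List.finRange k) (hy : lfs y.word = List.finRange l) :
    lfs (x.comp i he h y).word = List.finRange r := by
  obtain ⟨u, v, hw, hu, hv⟩ := x.exists_split i
  apply List.map_injective_iff.2 Fin.val_injective
  rw [DecTree.map_lfs_comp i he h x y hw hu hv, hy]
  rw [hw, lfs_append, lfs_cons_lf, ← List.ofFn_id] at hx
  have h1 : Ins (outerLabel h.card i) i (fun j => (innerPos h.card i j : ℕ)) Fin.val :=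
    ⟨h.card, fun j hj => by rw [outerLabel, dif_neg hj], fun j => rfl⟩
  obtain ⟨p, hp, hpi, -⟩ := exists_index hx.symm
  obtain rfl : p = i := hpi
  have h2 : List.ofFn (outerLabel h.card p) = (lfs u).map (outerLabel h.card p) ++
      outerLabel h.card p p :: (lfs v).map (outerLabel h.card p) := by
    have := congrArg (List.map (outerLabel h.card p)) hx
    rw [List.map_ofFn] at this
    rw [← List.map_cons, ← List.map_append, this]
    rfl
  have h3 := (ins_iff_append h2 (by simpa using hp)).1 h1
  rw [← List.ofFn_id, ← List.ofFn_id, List.map_ofFn, List.map_ofFn]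
  exact h3.symm

/-- With the leaves numbered from left to right, the input at position `D.length` is the leaf behind
`pre`, and grafting a corolla there preserves the numbering. Signs are absorbed by the scalar; only
that it is non-zero matters. -/
theorem isWordOp_comp (hσ : σ ≠ 0) {pre rest : List (Letter Unit)} {z : TOp (signedDecOperad 𝕜 σ) e}
    (hz : IsWordOp (pre ++ lf () :: rest) z) {D R : List ℕ+} (hc : z.cols = D ++ d :: R)
    (hD : D.length = (lfs pre).length) (T : OpTree b d) (hl : 2 ≤ l) (hT : T.IsLeftRecursive) :
    IsWordOp (pre ++ (nd T hl :: (List.replicate l (lf ()) ++ rest)))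
      (TOp.comp 1 D.length z (TOp.ofGen (corollas σ) T hl)) := by
  obtain ⟨c, z, q⟩ := z
  rename_i k
  obtain ⟨s, ε, hε, hz, hs, hf⟩ := hz
  obtain ⟨i, hi, he, hk⟩ := exists_index (c := c) hc
  obtain ⟨a, ha⟩ := exists_ins (r := k + l - 1) c i b (by have := i.2; omega)
  rw [TOp.ofGen, ← hi, TOp.comp_mk 1 i he ha]
  have hsplit : ∃ u v, s.word = u ++ lf i :: v ∧ u.map erase = pre ∧ v.map erase = rest := by
    obtain ⟨u, v', hw, rfl, hv'⟩ := List.map_eq_append_iff.1 hs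
    obtain ⟨x, v, rfl, hx, rfl⟩ := List.map_eq_cons_iff.1 hv'
    cases x with
    | nd T hm => cases hx
    | lf j =>
        obtain rfl : j = i := by
          rw [hw, lfs_append, lfs_cons_lf, ← List.ofFn_id] at hf
          obtain ⟨p, hp, hpi, -⟩ := exists_index hf.symm
          rw [← hpi]
          exact Fin.ext (by rw [id, hp, hi, hD, length_lfs_map_erase])
        exact ⟨u, v, hw, rfl, rfl⟩
  obtain ⟨u, v, hw, rfl, rfl⟩ := hsplit
  have hn := s.nodup_lfs
  rw [hw, lfs_append, lfs_cons_lf, List.nodup_append] at hn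
  have hu : i ∉ lfs u := fun hh => hn.2.2 i hh i (by simp) rfl
  have hv : i ∉ lfs v := (List.nodup_cons.1 hn.2.1).1
  simp only at hz
  refine ⟨s.comp i he ha (DecTree.corolla T hl hT),
    ε * σ ^ (s.1.numRight i * (DecTree.corolla T hl hT).1.numEdges),
    mul_ne_zero hε (pow_ne_zero _ hσ), ?_, ?_, ?_⟩
  · simp only
    rw [corollas, dif_pos hT, hz, map_smul, LinearMap.smul_apply, DecTree.comp_vec, one_pow,
      one_smul, smul_smul]
  · rw [DecTree.word_comp_split i he ha _ _ hw, List.map_append, List.map_append,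
      DecTree.erase_flatMap_compWord _ _ _ hu, DecTree.erase_flatMap_compWord _ _ _ hv,
      DecTree.erase_compWord_self, DecTree.word_corolla]
    have h1 : ((List.finRange l).map lf).map erase = List.replicate l (lf ()) := by
      rw [List.map_map]
      simp [Function.comp_def, erase, List.map_const']
    rw [List.map_cons, h1, erase, List.cons_append]
  · exact lfs_comp_eq_finRange i he ha _ _ hf (by rw [DecTree.word_corolla, lfs_cons_nd, lfs_map_lf])

/-- The invariant is that the letters already read, followed by a leaf for each pending input, form
the word of a tree. -/
theorem isWordOp_run (hσ : σ ≠ 0) {V : Type} {f : V → ℕ+} {w : List (Letter V)} {Q Q' D : List ℕ+}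
    (hw : Steps f w Q Q')
    {pre : List (Letter Unit)} {z : TOp (signedDecOperad 𝕜 σ) e} (hc : z.cols = D ++ Q)
    (hD : D.length = (lfs pre).length)
    (hz : IsWordOp (pre ++ List.replicate Q.length (lf ())) z) :
    IsWordOp (pre ++ (w.map erase ++ List.replicate Q'.length (lf ())))
      (TOp.run 1 (corollas σ) w D.length z) := by
  induction w generalizing Q D z pre with
  | nil => obtain rfl : Q = Q' := hw; exact hz
  | cons x w ih =>
      cases x with
      | lf v =>
          obtain ⟨Q₁, rfl, h⟩ := hw
          have := ih (D := D ++ [f v]) (pre := pre ++ [lf ()]) h (by rw [hc]; simp)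
            (by rw [lfs_append, lfs_cons_lf]; simp [hD, lfs]) (by
              simpa [List.replicate_succ] using hz)
          rw [List.length_append, List.length_singleton] at this
          simpa [erase, TOp.run] using this
      | nd T hm =>
          obtain ⟨hT, Q₁, rfl, h⟩ := hw
          have h1 := isWordOp_comp hσ hz hc hD T hm hT
          have h2 := ih (D := D) (pre := pre ++ [nd T hm]) h
            (TOp.cols_comp 1 (y := TOp.ofGen (corollas σ) T hm) hc)
            (by rw [lfs_append, lfs_cons_nd]; simp [hD, lfs]) (by
              rw [List.append_assoc, List.length_append, List.length_ofFn, List.replicate_add]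
              exact h1)
          rw [List.append_assoc] at h2
          exact h2

/-- Grafting the corollas in prefix order rebuilds the tree up to a scalar and the labelling of its
leaves. The evaluation is unnormalised (sign `1`), since the scalar need not be known. -/
theorem eval_corollas (hσ : σ ≠ 0) (t : DecTree c d) :
    ∃ (lam : Equiv.Perm (Fin k)) (ε : 𝕜) (n : ℕ), ε ≠ 0 ∧
      TOp.eval 1 (corollas σ) t.1 = ⟨c ∘ lam, ε • (signedDecOperad 𝕜 σ).act lam (t.vec σ), n⟩ := by
  obtain ⟨lam, hl⟩ := exists_perm_of_nodup t.nodup_lfs t.mem_lfs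
  have h1 := TOp.cols_eval (σ := 1) (g := corollas σ) t.1
  rw [show lfs t.1.word = _ from hl, List.map_ofFn] at h1
  have h2 := isWordOp_run hσ (D := []) (pre := []) (t.1.steps_word []) rfl rfl
    (isWordOp_one (σ := σ) d)
  change IsWordOp _ (TOp.eval 1 (corollas σ) t.1) at h2
  generalize TOp.eval 1 (corollas σ) t.1 = z at h1 h2
  obtain ⟨c', z, n⟩ := z
  rename_i k'
  obtain rfl : k' = k := by simpa [TOp.cols] using congrArg List.length h1
  obtain rfl : c' = c ∘ lam := List.ofFn_injective h1
  obtain ⟨s, ε, hε, hz, hs, hf⟩ := h2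
  simp only at hz
  refine ⟨lam, ε, n, hε, ?_⟩
  rw [DecTree.act_vec]
  have : s = t.act lam := by
    apply DecTree.ext_word
    apply eq_of_erase_eq
    · rw [hs, t.word_act, map_erase_flatMap fun _ _ => rfl]
      simp
      rfl
    · rw [hf, t.word_act, lfs_flatMap, hl]
      have : (fun j => lfs [(lf (lam.symm j) : Letter (Fin k'))]) = fun j => [lam.symm j] := by
        funext j; rfl
      rw [this, ← List.map_eq_flatMap, List.map_ofFn, ← List.ofFn_id]
      congr 1
      funext j
      simp
  rw [← this, ← hz]

/-- Morphisms of operads from the operad of decorated trees are determined by the images of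
the corollas. -/
theorem isOperadHom_ext (hσ : σ ≠ 0) {P : OperadData.{u, w} 𝕜 ℕ+} (hP : P.Laws)
    {F F' : LinFamily (signedDecOperad 𝕜 σ).toCollection P.toCollection}
    (hF : IsOperadHom (signedDecOperad 𝕜 σ) P F) (hF' : IsOperadHom (signedDecOperad 𝕜 σ) P F')
    (h : ∀ {k : ℕ} {c : Fin k → ℕ+} {d : ℕ+} (T : OpTree c d) (hk : 2 ≤ k)
      (hT : T.IsLeftRecursive), F k c d ((DecTree.corolla T hk hT).vec σ) =
        F' k c d ((DecTree.corolla T hk hT).vec σ)) : F = F' := by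
  have hg : (fun m a d T hm => F m a d (corollas σ m a d T hm)) =
      fun m a d T hm => F' m a d (corollas σ m a d T hm) := by
    funext m a d T hm
    unfold corollas
    split
    · exact h _ _ _
    · rw [map_zero, map_zero]
  funext k c d
  refine signedDecOperad_hom_ext fun t => ?_
  have h1 := TOp.map_eval hF 1 (corollas σ) t.1
  have h2 := TOp.map_eval hF' 1 (corollas σ) t.1
  rw [hg, ← h2] at h1
  obtain ⟨lam, ε, n, hε, h3⟩ := eval_corollas hσ t
  rw [h3, TOp.map, TOp.map] at h1
  simp only [map_smul, TOp.mk.injEq, heq_eq_eq, true_and, and_true] at h1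
  have h4 := smul_right_injective _ hε h1
  rw [hF.equivariant, hF'.equivariant] at h4
  exact hP.act_injective h4

end Universal

end OInfty

/-! ### Grading and axioms of the operad of decorated trees. -/

namespace OInfty

variable {𝕜 : Type u} [Field 𝕜]
variable {k l r : ℕ} {c : Fin k → ℕ+} {b : Fin l → ℕ+} {a : Fin r → ℕ+} {d e : ℕ+} {σ : 𝕜}

/-- The degree of a decorated tree. -/
def DecTree.degree (t : DecTree c d) : ℤ := (k : ℤ) - 1 - t.1.numNodes

theorem DecTree.degree_act (t : DecTree c d) (κ : Equiv.Perm (Fin k)) :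
    (t.act κ).degree = t.degree := by
  have h1 := t.numNodes_add
  have h2 := (t.act κ).numNodes_add
  rw [numEdges_act] at h2
  unfold degree
  omega

theorem DecTree.degree_comp (i : Fin k) (he : c i = e) (h : Ins c i b a) (x : DecTree c d)
    (y : DecTree b e) : (x.comp i he h y).degree = x.degree + y.degree := by
  have h1 := x.numNodes_add
  have h2 := y.numNodes_add
  have h3 := (x.comp i he h y).numNodes_add
  have h4 := h.card
  rw [numEdges_comp] at h3
  unfold degree
  omega

theorem DecTree.numEdges_eq (t : DecTree c d) :
    (t.1.numEdges : ℤ) = t.degree + 2 * t.1.numNodes := by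
  have h1 := t.numNodes_add
  unfold degree
  omega

theorem DecTree.degree_corolla (T : OpTree c d) (hk : 2 ≤ k) (hT : T.IsLeftRecursive) :
    (DecTree.corolla T hk hT).degree = k - 2 := by
  have : (DecTree.corolla T hk hT).1.numNodes = 1 := by
    rw [← FTree.nodeCount_word, show (DecTree.corolla T hk hT).1.word = _ from
      DecTree.word_corolla T hk hT]
    simp [nodeCount, Letter.isNode, Function.comp_def]
  unfold degree
  rw [this]
  push_cast
  ring

/-- The grading of the operad of decorated trees. -/
noncomputable def decGrading (σ : 𝕜) : (signedDecOperad 𝕜 σ).Grading :=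
  fun _ c d p => Submodule.span 𝕜 {z | ∃ t : DecTree c d, t.degree = p ∧ z = t.vec σ}

theorem DecTree.vec_mem (t : DecTree c d) : t.vec σ ∈ decGrading σ k c d t.degree :=
  Submodule.subset_span ⟨t, rfl, rfl⟩

@[elab_as_elim]
theorem decGrading_induction {p : ℤ} {Q : (signedDecOperad 𝕜 σ).Op c d → Prop} (h0 : Q 0)
    (hadd : ∀ x y, Q x → Q y → Q (x + y)) (hsmul : ∀ (s : 𝕜) x, Q x → Q (s • x))
    (hv : ∀ t : DecTree c d, t.degree = p → Q (t.vec σ)) {x : (signedDecOperad 𝕜 σ).Op c d}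
    (hx : x ∈ decGrading σ k c d p) : Q x := by
  refine Submodule.span_induction ?_ h0 (fun x y _ _ => hadd x y) (fun s x _ => hsmul s x) hx
  rintro _ ⟨t, ht, rfl⟩
  exact hv t ht

@[elab_as_elim]
theorem vec_induction {Q : (signedDecOperad 𝕜 σ).Op c d → Prop} (h0 : Q 0)
    (hadd : ∀ x y, Q x → Q y → Q (x + y)) (hsmul : ∀ (s : 𝕜) x, Q x → Q (s • x))
    (hv : ∀ t : DecTree c d, Q (t.vec σ)) (x : (signedDecOperad 𝕜 σ).Op c d) : Q x := by
  refine Finsupp.induction_linear (motive := fun x : DecTree c d →₀ 𝕜 => Q x) x h0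
    (fun x y => hadd x y) fun t s => ?_
  rw [← Finsupp.smul_single_one]
  exact hsmul s _ (hv t)

theorem signedDecOperad_laws (σ : 𝕜) : (signedDecOperad 𝕜 σ).Laws where
  act_one x := by
    refine vec_induction ?_ (fun x y hx hy => ?_) (fun s x hx => ?_) (fun t => ?_) x
    · rw [map_zero]; rfl
    · rw [map_add, hx, hy]; rfl
    · rw [map_smul, hx]; rfl
    · exact (DecTree.act_vec _ t).trans (congrArg (DecTree.vec σ) t.act_one)
  act_mul κ lam x := by
    refine vec_induction ?_ (fun x y hx hy => ?_) (fun s x hx => ?_) (fun t => ?_) x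
    · simp only [map_zero]; rfl
    · simp only [map_add, hx, hy]; rfl
    · simp only [map_smul, hx]; rfl
    · rw [DecTree.act_vec, DecTree.act_vec, DecTree.act_act, DecTree.act_vec]
      rfl
  one_comp h y := by
    refine vec_induction ?_ (fun x y hx hy => ?_) (fun s x hx => ?_) (fun t => ?_) y
    · simp only [map_zero]
    · simp only [map_add, hx, hy]
    · simp only [map_smul, hx]
    · rw [DecTree.one_eq_vec, DecTree.comp_vec, DecTree.one_comp]
      rw [show (DecTree.one _).1.numRight 0 = 0 from rfl, zero_mul, pow_zero, one_smul]
  comp_one i he h x := by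
    refine vec_induction ?_ (fun x y hx hy => ?_) (fun s x hx => ?_) (fun t => ?_) x
    · simp only [map_zero, LinearMap.zero_apply]
    · simp only [map_add, LinearMap.add_apply, hx, hy]
    · simp only [map_smul, LinearMap.smul_apply, hx]
    · rw [DecTree.one_eq_vec, DecTree.comp_vec, DecTree.comp_one, DecTree.numEdges_one, mul_zero,
        pow_zero, one_smul]
  assoc i j hi hj hcb hj₁ h₁ h₂ h₃ x y z := by
    refine vec_induction ?_ (fun x y hx hy => ?_) (fun s x hx => ?_) (fun x => ?_) x
    · simp only [map_zero, LinearMap.zero_apply]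
    · simp only [map_add, LinearMap.add_apply, hx, hy]
    · simp only [map_smul, LinearMap.smul_apply, hx]
    refine vec_induction ?_ (fun x y hx hy => ?_) (fun s x hx => ?_) (fun y => ?_) y
    · simp only [map_zero, LinearMap.zero_apply]
    · simp only [map_add, LinearMap.add_apply, hx, hy]
    · simp only [map_smul, LinearMap.smul_apply, hx]
    refine vec_induction ?_ (fun x y hx hy => ?_) (fun s x hx => ?_) (fun z => ?_) z
    · simp only [map_zero]
    · simp only [map_add, hx, hy]
    · simp only [map_smul, hx]
    rw [DecTree.comp_vec, DecTree.comp_vec, map_smul, map_smul, LinearMap.smul_apply,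
      DecTree.comp_vec, DecTree.comp_vec, smul_smul, smul_smul, ← pow_add, ← pow_add,
      DecTree.assoc i j hi hj hcb hj₁ h₁ h₂ h₃, DecTree.numRight_comp_inner, DecTree.numEdges_comp]
    -- The edges to the right of the leaf `j` of `y` in the composite are those to the right of `j`
    -- in `y` and those to the right of `i` in `x`; as edges add up under grafting, the exponents
    -- agree.
    congr 2
    ring
  equivariant i κ lam μ he h h₁ hμ x y := by
    refine vec_induction ?_ (fun x y hx hy => ?_) (fun s x hx => ?_) (fun x => ?_) x
    · simp only [map_zero, LinearMap.zero_apply]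
    · simp only [map_add, LinearMap.add_apply, hx, hy]
    · simp only [map_smul, LinearMap.smul_apply, hx]
    refine vec_induction ?_ (fun x y hx hy => ?_) (fun s x hx => ?_) (fun y => ?_) y
    · simp only [map_zero]
    · simp only [map_add, hx, hy]
    · simp only [map_smul, hx]
    rw [DecTree.act_vec, DecTree.act_vec, DecTree.comp_vec, DecTree.comp_vec, map_smul,
      DecTree.act_vec, DecTree.equivariant i κ lam μ he h h₁ hμ, DecTree.numRight_act,
      DecTree.numEdges_act]

theorem zpow_eq_pow_of_even (hσ : σ * σ = 1) {n : ℕ} {p s : ℤ} (h : (n : ℤ) = p + 2 * s) :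
    σ ^ p = σ ^ n := by
  have h0 : σ ≠ 0 := fun h => by simp [h] at hσ
  rw [← zpow_natCast, h, zpow_add₀ h0, zpow_mul, zpow_two, hσ, one_zpow, mul_one]

theorem signedDecOperad_twisted (hσ : σ * σ = 1) :
    (signedDecOperad 𝕜 σ).Twisted (decGrading σ) σ where
  toLaws := signedDecOperad_laws σ
  one_mem n := DecTree.vec_mem (DecTree.one n)
  act_mem κ p x hx := by
    refine decGrading_induction ?_ (fun x y hx hy => ?_) (fun s x hx => ?_) (fun t ht => ?_) hx
    · rw [map_zero]; exact Submodule.zero_mem _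
    · rw [map_add]; exact Submodule.add_mem _ hx hy
    · rw [map_smul]; exact Submodule.smul_mem _ _ hx
    · rw [DecTree.act_vec, ← ht, ← t.degree_act κ]
      exact DecTree.vec_mem _
  comp_mem i he h p q x y hx hy := by
    refine decGrading_induction ?_ (fun x y hx hy => ?_) (fun s x hx => ?_) (fun x hxp => ?_) hx
    · rw [map_zero]; exact Submodule.zero_mem _
    · rw [map_add]; exact Submodule.add_mem _ hx hy
    · rw [map_smul]; exact Submodule.smul_mem _ _ hx
    refine decGrading_induction ?_ (fun x y hx hy => ?_) (fun s x hx => ?_) (fun y hyq => ?_) hy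
    · rw [map_zero]; exact Submodule.zero_mem _
    · rw [map_add]; exact Submodule.add_mem _ hx hy
    · rw [map_smul]; exact Submodule.smul_mem _ _ hx
    rw [DecTree.comp_vec, ← hxp, ← hyq, ← DecTree.degree_comp i he h]
    exact Submodule.smul_mem _ _ (DecTree.vec_mem _)
  parallel i j hij hi hj h h₁ hj₂ hi₂ h₂ h₃ p q x y z hy hz := by
    refine vec_induction ?_ (fun x y hx hy => ?_) (fun s x hx => ?_) (fun x => ?_) x
    · simp only [map_zero, LinearMap.zero_apply, smul_zero]
    · simp only [map_add, LinearMap.add_apply, hx, hy, smul_add]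
    · simp only [map_smul, LinearMap.smul_apply, hx, smul_comm s]
    refine decGrading_induction ?_ (fun x y hx hy => ?_) (fun s x hx => ?_) (fun y hyp => ?_) hy
    · simp only [map_zero, LinearMap.zero_apply, smul_zero]
    · simp only [map_add, LinearMap.add_apply, hx, hy, smul_add]
    · simp only [map_smul, LinearMap.smul_apply, hx, smul_comm s]
    refine decGrading_induction ?_ (fun x y hx hy => ?_) (fun s x hx => ?_) (fun z hzq => ?_) hz
    · simp only [map_zero, LinearMap.zero_apply, smul_zero]
    · simp only [map_add, LinearMap.add_apply, hx, hy, smul_add]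
    · simp only [map_smul, LinearMap.smul_apply, hx, smul_comm s]
    -- The degree of a tree has the parity of its number of edges, so the Koszul sign can be
    -- expressed by the latter.
    rw [DecTree.comp_vec, DecTree.comp_vec, map_smul, map_smul, LinearMap.smul_apply,
      LinearMap.smul_apply, DecTree.comp_vec, DecTree.comp_vec, smul_smul, smul_smul, smul_smul,
      DecTree.parallel i j hij hi hj h h₁ hj₂ hi₂ h₂ h₃,
      zpow_eq_pow_of_even (n := y.1.numEdges * z.1.numEdges)
        (s := y.degree * z.1.numNodes + y.1.numNodes * z.degree + 2 * y.1.numNodes * z.1.numNodes)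
        hσ (by
          push_cast
          rw [y.numEdges_eq, z.numEdges_eq, hyp, hzq]; ring),
      ← pow_add, ← pow_add, ← pow_add]
    congr 1
    obtain ⟨e1, hne⟩ := x.numRight_comp_outer i hi h y j hij
    obtain ⟨e2, -⟩ := x.numRight_comp_outer j hj h₁ z i hij.symm
    rw [e1, e2]
    -- One of the leaves `i`, `j` lies to the left of the other, so exactly one order of grafting
    -- sees the extra product of edge numbers.
    rcases lt_or_gt_of_ne hne with hlt | hlt
    · rw [if_pos hlt, if_neg (not_lt.2 hlt.le)]
      congr 1; ring
    · rw [if_neg (not_lt.2 hlt.le), if_pos hlt]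
      exact (TOp.pow_eq_of_even hσ (s := y.1.numEdges * z.1.numEdges) (by ring)).symm

end OInfty

-- Transfer along isomorphisms, and the universal properties.

universe w₁

namespace OInfty

variable {𝕜 : Type u} [Field 𝕜]

theorem OpTree.exists_act_isLeftRecursive {k : ℕ} {c : Fin k → ℕ+} {d : ℕ+} (T : OpTree c d) :
    ∃ κ : Equiv.Perm (Fin k), (T.act κ).IsLeftRecursive := by
  obtain ⟨κ, h⟩ := exists_perm_of_nodup T.nodup_labels T.mem_labels
  refine ⟨κ, ?_⟩
  rw [IsLeftRecursive, act, PTree.labels_map, h, List.map_ofFn, ← List.ofFn_id]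
  congr 1
  funext j
  simp

section Transfer

variable {C : Type} {O : OperadData.{u, v} 𝕜 C} {D : OperadData.{u, w} 𝕜 C}
  {E : ∀ (k : ℕ) (c : Fin k → C) (d : C), O.Op c d ≃ₗ[𝕜] D.Op c d}

theorem IsOperadHom.comp {P : OperadData.{u, w} 𝕜 C} {Q : OperadData.{u, w₁} 𝕜 C}
    {F : LinFamily O.toCollection P.toCollection} {F' : LinFamily P.toCollection Q.toCollection}
    (hF' : IsOperadHom P Q F') (hF : IsOperadHom O P F) :
    IsOperadHom O Q fun k c d => F' k c d ∘ₗ F k c d where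
  equivariant c d κ x := by
    simp only [LinearMap.comp_apply]; rw [hF.equivariant, hF'.equivariant]
  map_one n := by simp only [LinearMap.comp_apply]; rw [hF.map_one, hF'.map_one]
  map_comp i he h x y := by simp only [LinearMap.comp_apply]; rw [hF.map_comp, hF'.map_comp]

theorem IsOperadHom.symm (hE : IsOperadHom O D fun k c d => E k c d) :
    IsOperadHom D O fun k c d => (E k c d).symm where
  equivariant c d κ x := by
    apply (E _ _ _).injective
    have := hE.equivariant c d κ ((E _ c d).symm x)
    simpa using this.symm
  map_one n := by
    apply (E _ _ _).injective
    simpa using (hE.map_one n).symm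
  map_comp i he h x y := by
    apply (E _ _ _).injective
    have := hE.map_comp i he h ((E _ _ _).symm x) ((E _ _ _).symm y)
    simpa using this.symm

theorem OperadData.Laws.of_equiv (hD : D.Laws) (hE : IsOperadHom O D fun k c d => E k c d) :
    O.Laws where
  act_one x := by
    have := hE.equivariant _ _ 1 x
    exact (E _ _ _).injective (this.trans (hD.act_one _))
  act_mul κ lam x := by
    have h1 := hE.equivariant _ _ lam (O.act κ x)
    have h2 := hE.equivariant _ _ κ x
    have h3 := hE.equivariant _ _ (κ * lam) x
    simp only [LinearEquiv.coe_coe] at h1 h2 h3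
    rw [h2, hD.act_mul] at h1
    exact (E _ _ _).injective (h1.trans h3.symm)
  one_comp h y := by
    have h1 := hE.map_comp 0 rfl h (O.one _) y
    rw [hE.map_one, hD.one_comp] at h1
    exact (E _ _ _).injective h1
  comp_one i he h x := by
    have h1 := hE.map_comp i he h x (O.one _)
    rw [hE.map_one, hD.comp_one] at h1
    exact (E _ _ _).injective h1
  assoc i j hi hj hcb hj₁ h₁ h₂ h₃ x y z := by
    have h1 := hE.map_comp _ hj₁ h₁ (O.comp i hi hcb x y) z
    rw [hE.map_comp i hi hcb x y, hD.assoc i j hi hj hcb hj₁ h₁ h₂ h₃, ← hE.map_comp j hj h₂ y z,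
      ← hE.map_comp i hi h₃] at h1
    exact (E _ _ _).injective h1
  equivariant i κ lam μ he h h₁ hμ x y := by
    have h1 := hE.map_comp i he h₁ (O.act κ x) (O.act lam y)
    rw [hE.equivariant, hE.equivariant, hD.equivariant i κ lam μ he h h₁ hμ, ← hE.map_comp,
      ← hE.equivariant] at h1
    exact (E _ _ _).injective h1

theorem OperadData.Twisted.of_equiv {H : D.Grading} {σ : 𝕜} (hD : D.Twisted H σ)
    (hE : IsOperadHom O D fun k c d => E k c d) {H' : O.Grading}
    (hH : ∀ {k : ℕ} {c : Fin k → C} {d : C} {p : ℤ} {x : O.Op c d},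
      x ∈ H' k c d p ↔ E k c d x ∈ H k c d p) : O.Twisted H' σ where
  toLaws := hD.toLaws.of_equiv hE
  one_mem n := by
    have := hD.one_mem n
    rw [← hE.map_one] at this
    exact hH.2 this
  act_mem κ p x hx := by
    have := hD.act_mem κ p _ (hH.1 hx)
    rw [hH]
    have h1 := hE.equivariant _ _ κ x
    simp only [LinearEquiv.coe_coe] at h1
    rwa [h1]
  comp_mem i he h p q x y hx hy := by
    have := hD.comp_mem i he h p q _ _ (hH.1 hx) (hH.1 hy)
    rw [hH]
    have h1 := hE.map_comp i he h x y
    simp only [LinearEquiv.coe_coe] at h1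
    rwa [h1]
  parallel i j hij hi hj h h₁ hj₂ hi₂ h₂ h₃ p q x y z hy hz := by
    have e1 := hE.map_comp _ hj₂ h₂ (O.comp i hi h x y) z
    have e2 := hE.map_comp i hi h x y
    have e3 := hE.map_comp _ hi₂ h₃ (O.comp j hj h₁ x z) y
    have e4 := hE.map_comp j hj h₁ x z
    simp only [LinearEquiv.coe_coe] at e1 e2 e3 e4
    apply (E _ _ _).injective
    rw [map_smul, e1, e2, e3, e4]
    exact hD.parallel i j hij hi hj h h₁ hj₂ hi₂ h₂ h₃ p q _ _ _ (hH.1 hy) (hH.1 hz)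

end Transfer

theorem signedDecOperad_isOperad : (signedDecOperad 𝕜 (1 : 𝕜)).IsOperad where
  toLaws := signedDecOperad_laws 1
  parallel i j hij hi hj h h₁ hj₂ hi₂ h₂ h₃ x y z := by
    have hD := signedDecOperad_twisted (𝕜 := 𝕜) (σ := 1) (one_mul 1)
    refine vec_induction ?_ (fun x y hx hy => ?_) (fun s x hx => ?_) (fun y => ?_) y
    · simp only [map_zero, LinearMap.zero_apply]
    · simp only [map_add, LinearMap.add_apply, hx, hy]
    · simp only [map_smul, LinearMap.smul_apply, hx]
    refine vec_induction ?_ (fun x y hx hy => ?_) (fun s x hx => ?_) (fun z => ?_) z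
    · simp only [map_zero, LinearMap.zero_apply]
    · simp only [map_add, LinearMap.add_apply, hx, hy]
    · simp only [map_smul, LinearMap.smul_apply, hx]
    rw [hD.parallel i j hij hi hj h h₁ hj₂ hi₂ h₂ h₃ _ _ x _ _ y.vec_mem z.vec_mem, one_zpow,
      one_smul]

theorem OperadData.IsOperad.twisted {C : Type} {P : OperadData.{u, w} 𝕜 C} (hP : P.IsOperad) :
    P.Twisted (fun _ _ _ _ => ⊤) 1 where
  toLaws := hP.toLaws
  one_mem _ := trivial
  act_mem _ _ _ _ := trivial
  comp_mem _ _ _ _ _ _ _ _ _ := trivial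
  parallel i j hij hi hj h h₁ hj₂ hi₂ h₂ h₃ p q x y z _ _ := by
    rw [one_zpow, one_smul]
    exact hP.parallel i j hij hi hj h h₁ hj₂ hi₂ h₂ h₃ x y z

theorem OperadData.IsGradedOperad.twisted {C : Type} {P : OperadData.{u, w} 𝕜 C}
    {grP : P.Grading} (hP : P.IsGradedOperad grP) : P.Twisted grP (-1) where
  toLaws := hP.toLaws
  one_mem := hP.one_mem
  act_mem := hP.act_mem
  comp_mem := hP.comp_mem
  parallel := hP.parallel

section Free

variable {σ : 𝕜} {O : OperadData.{u, u} 𝕜 ℕ+}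
  {E : ∀ (k : ℕ) (c : Fin k → ℕ+) (d : ℕ+), O.Op c d ≃ₗ[𝕜] (signedDecOperad 𝕜 σ).Op c d}
  {ι : LinFamily (genCollection 𝕜) O.toCollection}

/-- The operation given by an operadic tree in the collection of generators. -/
noncomputable def genVec (𝕜 : Type u) [Field 𝕜] {k : ℕ} {c : Fin k → ℕ+} {d : ℕ+}
    (T : OpTree c d) (hk : 2 ≤ k) : (genCollection 𝕜).Op c d :=
  (Finsupp.single ⟨T, hk⟩ 1 : {_T : OpTree c d // 2 ≤ k} →₀ 𝕜)

theorem genCollection_hom_ext {k : ℕ} {c : Fin k → ℕ+} {d : ℕ+} {M : Type*} [AddCommGroup M]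
    [Module 𝕜 M] {f f' : (genCollection 𝕜).Op c d →ₗ[𝕜] M}
    (h : ∀ (T : OpTree c d) (hk : 2 ≤ k), f (genVec 𝕜 T hk) = f' (genVec 𝕜 T hk)) : f = f' :=
  Finsupp.lhom_ext' (α := {_T : OpTree c d // 2 ≤ k}) (M := 𝕜) (φ := f) (ψ := f') fun T =>
    LinearMap.ext_ring (h T.1 T.2)

theorem act_genVec {k : ℕ} {c : Fin k → ℕ+} {d : ℕ+} (T : OpTree c d) (hk : 2 ≤ k)
    (κ : Equiv.Perm (Fin k)) :
    (genCollection 𝕜).act κ (genVec 𝕜 T hk) = genVec 𝕜 (T.act κ) hk :=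
  Finsupp.mapDomain_single

/-- Two maps of symmetric collections that agree on the left-recursive operadic trees are equal. -/
theorem isEquivariant_ext {P : OperadData.{u, w} 𝕜 ℕ+} (hP : P.Laws)
    {φ ψ : LinFamily (genCollection 𝕜) P.toCollection}
    (hφ : IsEquivariant (genCollection 𝕜) P.toCollection φ)
    (hψ : IsEquivariant (genCollection 𝕜) P.toCollection ψ)
    (h : ∀ {k : ℕ} {c : Fin k → ℕ+} {d : ℕ+} (T : OpTree c d) (hk : 2 ≤ k)
      (_ : T.IsLeftRecursive), φ k c d (genVec 𝕜 T hk) = ψ k c d (genVec 𝕜 T hk)) : φ = ψ := by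
  funext k c d
  refine genCollection_hom_ext fun T hk => ?_
  obtain ⟨κ, hκ⟩ := T.exists_act_isLeftRecursive
  apply hP.act_injective (κ := κ)
  rw [← hφ, ← hψ, act_genVec, h _ hk hκ]

/-- Maps from the generators to an operad with the sign rule `σ` extend uniquely to operads that are
isomorphic to the operad of decorated trees. -/
theorem existsUnique_extension (hσ : σ * σ = 1)
    (hE : IsOperadHom O (signedDecOperad 𝕜 σ) fun k c d => E k c d)
    (hι : IsEquivariant (genCollection 𝕜) O.toCollection ι)
    (hιE : ∀ {k : ℕ} {c : Fin k → ℕ+} {d : ℕ+} (T : OpTree c d) (hk : 2 ≤ k)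
      (hT : T.IsLeftRecursive), E k c d (ι k c d (genVec 𝕜 T hk)) = (DecTree.corolla T hk hT).vec σ)
    {P : OperadData.{u, w} 𝕜 ℕ+} {H : P.Grading} (hP : P.Twisted H σ)
    {φ : LinFamily (genCollection 𝕜) P.toCollection}
    (hφ : IsEquivariant (genCollection 𝕜) P.toCollection φ)
    (hφH : ∀ {k : ℕ} {c : Fin k → ℕ+} {d : ℕ+} (T : OpTree c d) (hk : 2 ≤ k),
      φ k c d (genVec 𝕜 T hk) ∈ H k c d ((k - 2 : ℕ) : ℤ)) :
    ∃ F : LinFamily O.toCollection P.toCollection, IsOperadHom O P F ∧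
      (∀ {k : ℕ} (c : Fin k → ℕ+) (d : ℕ+) (x : (genCollection 𝕜).Op c d),
        F k c d (ι k c d x) = φ k c d x) ∧
      (∀ {k : ℕ} {c : Fin k → ℕ+} {d : ℕ+} {p : ℤ} {x : O.Op c d},
        E k c d x ∈ decGrading σ k c d p → F k c d x ∈ H k c d p) ∧
      ∀ F' : LinFamily O.toCollection P.toCollection, IsOperadHom O P F' →
        (∀ {k : ℕ} (c : Fin k → ℕ+) (d : ℕ+) (x : (genCollection 𝕜).Op c d),
          F' k c d (ι k c d x) = φ k c d x) → F' = F := by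
  obtain ⟨F, hF, hFg, hFH⟩ := exists_isOperadHom hσ hP
    (fun m a d T hm => φ m a d (genVec 𝕜 T hm)) fun m a d T hm => hφH T hm
  have hFE : IsOperadHom O P fun k c d => F k c d ∘ₗ E k c d := hF.comp hE
  have hext : ∀ F' : LinFamily O.toCollection P.toCollection, IsOperadHom O P F' →
      (∀ {k : ℕ} {c : Fin k → ℕ+} {d : ℕ+} (T : OpTree c d) (hk : 2 ≤ k) (hT : T.IsLeftRecursive),
        F' k c d (ι k c d (genVec 𝕜 T hk)) = φ k c d (genVec 𝕜 T hk)) →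
      (fun k c d => F' k c d ∘ₗ ι k c d) = φ := by
    intro F' hF' h
    refine isEquivariant_ext hP.toLaws (fun c d κ x => ?_) hφ fun T hk hT => h T hk hT
    simp only [LinearMap.comp_apply]
    rw [hι, hF'.equivariant]
  refine ⟨_, hFE, fun {k} c d x => ?_, fun {k c d p x} hx => ?_, fun F' hF' h => ?_⟩
  · have := hext _ hFE fun T hk hT => by
      simp only [LinearMap.comp_apply, LinearEquiv.coe_coe]
      rw [hιE T hk hT, hFg]
    exact LinearMap.congr_fun (congrFun (congrFun (congrFun this k) c) d) x
  · simp only [LinearMap.comp_apply, LinearEquiv.coe_coe]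
    generalize E k c d x = z at hx
    refine decGrading_induction ?_ (fun x y hx hy => ?_) (fun s x hx => ?_) (fun t ht => ?_) hx
    · rw [map_zero]; exact Submodule.zero_mem _
    · rw [map_add]; exact Submodule.add_mem _ hx hy
    · rw [map_smul]; exact Submodule.smul_mem _ _ hx
    · rw [← ht]; exact hFH t
  · have hσ0 : σ ≠ 0 := fun h => by simp [h] at hσ
    have h1 := isOperadHom_ext hσ0 hP.toLaws (hF'.comp hE.symm) hF fun T hk hT => by
      rw [hFg, ← hιE T hk hT]
      simp only [LinearMap.comp_apply, LinearEquiv.coe_coe, LinearEquiv.symm_apply_apply]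
      exact h _ _ _
    rw [← h1]
    funext k c d
    ext x
    simp

theorem isFreeOperadOn_of_equiv
    {E : ∀ (k : ℕ) (c : Fin k → ℕ+) (d : ℕ+), O.Op c d ≃ₗ[𝕜] (signedDecOperad 𝕜 (1 : 𝕜)).Op c d}
    (hE : IsOperadHom O (signedDecOperad 𝕜 (1 : 𝕜)) fun k c d => E k c d)
    (hι : IsEquivariant (genCollection 𝕜) O.toCollection ι)
    (hιE : ∀ {k : ℕ} {c : Fin k → ℕ+} {d : ℕ+} (T : OpTree c d) (hk : 2 ≤ k)
      (hT : T.IsLeftRecursive), E k c d (ι k c d (genVec 𝕜 T hk)) = (DecTree.corolla T hk hT).vec 1) :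
    IsFreeOperadOn.{u, u, w} O (genCollection 𝕜) ι := by
  refine ⟨⟨(signedDecOperad_laws 1).of_equiv hE, ?_⟩, hι, fun P hP φ hφ => ?_⟩
  · intro k l m r s t c b b₁ a a₁ a₂ d e e₁ i j hij hi hj h h₁ hj₂ hi₂ h₂ h₃ x y z
    have e1 := hE.map_comp _ hj₂ h₂ (O.comp i hi h x y) z
    have e2 := hE.map_comp i hi h x y
    have e3 := hE.map_comp _ hi₂ h₃ (O.comp j hj h₁ x z) y
    have e4 := hE.map_comp j hj h₁ x z
    simp only [LinearEquiv.coe_coe] at e1 e2 e3 e4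
    apply (E _ _ _).injective
    rw [e1, e2, e3, e4]
    exact signedDecOperad_isOperad.parallel i j hij hi hj h h₁ hj₂ hi₂ h₂ h₃ _ _ _
  · obtain ⟨F, hF, hFι, -, huniq⟩ := existsUnique_extension (one_mul 1) hE hι hιE hP.twisted hφ
      fun _ _ => trivial
    exact ⟨F, ⟨hF, hFι⟩, fun F' hF' => huniq F' hF'.1 hF'.2⟩

theorem isFreeGradedOperadOn_of_equiv
    {E : ∀ (k : ℕ) (c : Fin k → ℕ+) (d : ℕ+),
      O.Op c d ≃ₗ[𝕜] (signedDecOperad 𝕜 (-1 : 𝕜)).Op c d}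
    (hE : IsOperadHom O (signedDecOperad 𝕜 (-1 : 𝕜)) fun k c d => E k c d)
    (hι : IsEquivariant (genCollection 𝕜) O.toCollection ι)
    (hιE : ∀ {k : ℕ} {c : Fin k → ℕ+} {d : ℕ+} (T : OpTree c d) (hk : 2 ≤ k)
      (hT : T.IsLeftRecursive),
      E k c d (ι k c d (genVec 𝕜 T hk)) = (DecTree.corolla T hk hT).vec (-1))
    {grO : O.Grading}
    (hgr : ∀ {k : ℕ} {c : Fin k → ℕ+} {d : ℕ+} {p : ℤ} {x : O.Op c d},
      x ∈ grO k c d p ↔ E k c d x ∈ decGrading (-1) k c d p)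
    (hint : ∀ {k : ℕ} (c : Fin k → ℕ+) (d : ℕ+), DirectSum.IsInternal (grO k c d)) :
    IsFreeGradedOperadOn.{u, u, w} O grO (genCollection 𝕜) (genGrading 𝕜) ι := by
  have hσ : (-1 : 𝕜) * -1 = 1 := by ring
  have hO := (signedDecOperad_twisted hσ).of_equiv hE hgr
  refine ⟨⟨hO.toLaws, hint, hO.one_mem, hO.act_mem, hO.comp_mem, hO.parallel⟩, hι, ?_,
    fun P grP hP φ hφ hφgr => ?_⟩
  · intro k c d p x hx
    unfold genGrading at hx
    split at hx
    · rename_i hp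
      -- Passing to the quotient turns membership into an equation of linear maps, which can be
      -- checked on basis vectors.
      suffices h : (grO k c d p).mkQ ∘ₗ ι k c d = 0 by
        have := LinearMap.congr_fun h x
        simpa using this
      refine genCollection_hom_ext fun T hk => ?_
      rw [LinearMap.comp_apply, LinearMap.zero_apply, Submodule.mkQ_apply,
        Submodule.Quotient.mk_eq_zero]
      -- Only left-recursive trees are known to go to corollas; the others are reduced to them by a
      -- permutation, which preserves degrees.
      obtain ⟨κ, hκ⟩ := T.exists_act_isLeftRecursive
      apply hO.mem_of_act_mem (κ := κ)
      rw [← hι, act_genVec, hgr, hιE _ hk hκ, hp, ← DecTree.degree_corolla _ hk hκ]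
      exact DecTree.vec_mem _
    · rw [Submodule.mem_bot] at hx
      rw [hx, map_zero]
      exact Submodule.zero_mem _
  · obtain ⟨F, hF, hFι, hFH, huniq⟩ := existsUnique_extension hσ hE hι hιE hP.twisted hφ
      fun {k c d} T hk => hφgr c d _ _ (by
        unfold genGrading
        -- The truncated subtraction `k - 2` is harmless, as `2 ≤ k`.
        rw [if_pos (by omega)]
        trivial)
    exact ⟨F, ⟨hF, fun c d p x hx => hFH (hgr.1 hx), hFι⟩, fun F' hF' => huniq F' hF'.1 hF'.2.2⟩

end Free

end OInfty

/-! ### Linearisation of the bijection, and the theorem. -/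

namespace OInfty

variable {𝕜 : Type u} [Field 𝕜]

/-- Nothing is left after the removal of all vertices, so there are no components and the families
of sub-constructs are vacuous. This gives the equivariance of the inclusion of generators. -/
theorem Construct.rename_top {E E₁ : Type} [DecidableEq E] [DecidableEq E₁] {H : Hypergraph E}
    {H₁ : Hypergraph E₁} (f : E₁ → E) {X : Finset E₁} (hX : X.Nonempty) (X₁ : Finset E)
    (h : X.image f = X₁) (hX₁ : X₁.Nonempty) :
    (top H₁ X hX).rename f X₁ h = top H X₁ hX₁ := by
  subst h
  unfold top rename
  congr 1
  funext K hK
  obtain ⟨x, hx⟩ := hK.connected.1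
  have := hK.subset hx
  simp at this

theorem OInfBasis.gen_act {k : ℕ} {c : Fin k → ℕ+} {d : ℕ+} (T : OpTree c d)
    (κ : Equiv.Perm (Fin k)) : (gen T).act κ = gen (T.act κ) := by
  unfold gen act
  congr 1
  funext hk
  exact Construct.rename_top _ _ _ _ _

section Basis

variable {k l r : ℕ} {c : Fin k → ℕ+} {b : Fin l → ℕ+} {a : Fin r → ℕ+} {d e : ℕ+} {σ : 𝕜}
  {s : Coefficients 𝕜}

/-- The basis vectors of `O_∞`. -/
noncomputable def OInfBasis.vec (s : Coefficients 𝕜) (x : OInfBasis c d) : (OInf 𝕜 s).Op c d :=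
  (Finsupp.single x 1 : OInfBasis c d →₀ 𝕜)

theorem OInfBasis.comp_vec (i : Fin k) (he : c i = e) (h : Ins c i b a)
    (x : OInfBasis c d) (y : OInfBasis b e) :
    (OInf 𝕜 s).comp i he h (x.vec s) (y.vec s) = s k l c b d e i x y • (x.comp i he h y).vec s := by
  refine (bilinearExt_single _ x y 1 1).trans ?_
  rw [one_mul, one_smul]
  exact (Finsupp.smul_single_one _ _).symm

theorem OInfBasis.act_vec (κ : Equiv.Perm (Fin k)) (x : OInfBasis c d) :
    (OInf 𝕜 s).act κ (x.vec s) = (x.act κ).vec s :=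
  Finsupp.mapDomain_single

theorem genIncl_genVec (T : OpTree c d) (hk : 2 ≤ k) :
    genIncl 𝕜 s k c d (genVec 𝕜 T hk) = (OInfBasis.gen T).vec s :=
  Finsupp.mapDomain_single

theorem oInf_hom_ext {M : Type*} [AddCommGroup M] [Module 𝕜 M]
    {f f' : (OInf 𝕜 s).Op c d →ₗ[𝕜] M}
    (h : ∀ x : OInfBasis c d, f (x.vec s) = f' (x.vec s)) : f = f' :=
  Finsupp.lhom_ext' (α := OInfBasis c d) (M := 𝕜) (φ := f) (ψ := f') fun t =>
    LinearMap.ext_ring (h t)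

theorem genIncl_isEquivariant (s : Coefficients 𝕜) :
    IsEquivariant (genCollection 𝕜) (OInf 𝕜 s).toCollection (genIncl 𝕜 s) := by
  intro k c d κ x
  refine LinearMap.congr_fun (f := genIncl 𝕜 s k (c ∘ κ) d ∘ₗ (genCollection 𝕜).act κ)
    (g := (OInf 𝕜 s).act κ ∘ₗ genIncl 𝕜 s k c d) (genCollection_hom_ext fun T hk => ?_) x
  rw [LinearMap.comp_apply, LinearMap.comp_apply, act_genVec, genIncl_genVec, genIncl_genVec,
    OInfBasis.act_vec, OInfBasis.gen_act]

/-- The linear extension of the bijection between triples and decorated trees. -/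
noncomputable def oInfEquiv (s : Coefficients 𝕜) (σ : 𝕜) (k : ℕ) (c : Fin k → ℕ+) (d : ℕ+) :
    (OInf 𝕜 s).Op c d ≃ₗ[𝕜] (signedDecOperad 𝕜 σ).Op c d :=
  show (OInfBasis c d →₀ 𝕜) ≃ₗ[𝕜] (DecTree c d →₀ 𝕜) from
  LinearEquiv.ofLinearMap (Finsupp.lmapDomain 𝕜 𝕜 OInfBasis.equivDecTree)
    (Finsupp.lmapDomain 𝕜 𝕜 OInfBasis.equivDecTree.symm)
    (by rw [← Finsupp.lmapDomain_comp]; simp [Finsupp.lmapDomain_id])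
    (by rw [← Finsupp.lmapDomain_comp]; simp [Finsupp.lmapDomain_id])

theorem oInfEquiv_vec (x : OInfBasis c d) :
    oInfEquiv s σ k c d (x.vec s) = (OInfBasis.equivDecTree x).vec σ :=
  Finsupp.mapDomain_single

theorem oInfEquiv_isOperadHom (hs : ∀ {k l : ℕ} {c : Fin k → ℕ+} {b : Fin l → ℕ+} {d e : ℕ+}
    (i : Fin k) (x : OInfBasis c d) (y : OInfBasis b e), s k l c b d e i x y =
      σ ^ ((OInfBasis.equivDecTree x).1.numRight i * (OInfBasis.equivDecTree y).1.numEdges)) :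
    IsOperadHom (OInf 𝕜 s) (signedDecOperad 𝕜 σ) fun k c d => oInfEquiv s σ k c d where
  equivariant {k} c d κ x := by
    refine LinearMap.congr_fun (f := (oInfEquiv s σ k (c ∘ κ) d).toLinearMap ∘ₗ (OInf 𝕜 s).act κ)
      (g := (signedDecOperad 𝕜 σ).act κ ∘ₗ (oInfEquiv s σ k c d).toLinearMap)
      (oInf_hom_ext fun x => ?_) x
    simp only [LinearMap.comp_apply, LinearEquiv.coe_coe]
    rw [OInfBasis.act_vec, oInfEquiv_vec, oInfEquiv_vec, DecTree.act_vec,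
      OInfBasis.equivDecTree_act]
  map_one n := (oInfEquiv_vec (OInfBasis.one n)).trans
    (congrArg (DecTree.vec σ) (OInfBasis.equivDecTree_one n))
  map_comp {k l r c b a d e} i he h x y := by
    refine LinearMap.congr_fun₂
      (f := ((OInf 𝕜 s).comp i he h).compr₂ (oInfEquiv s σ r a d).toLinearMap)
      (g := ((signedDecOperad 𝕜 σ).comp i he h).compl₁₂ (oInfEquiv s σ k c d).toLinearMap
        (oInfEquiv s σ l b e).toLinearMap)
      (oInf_hom_ext fun x => oInf_hom_ext fun y => ?_) x y
    rw [LinearMap.compr₂_apply, LinearMap.compl₁₂_apply]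
    simp only [LinearEquiv.coe_coe]
    rw [OInfBasis.comp_vec, map_smul, oInfEquiv_vec, oInfEquiv_vec, oInfEquiv_vec,
      DecTree.comp_vec, OInfBasis.equivDecTree_comp, hs]

theorem oInfEquiv_genIncl (T : OpTree c d) (hk : 2 ≤ k) (hT : T.IsLeftRecursive) :
    oInfEquiv s σ k c d (genIncl 𝕜 s k c d (genVec 𝕜 T hk)) =
      (DecTree.corolla T hk hT).vec σ := by
  rw [genIncl_genVec, oInfEquiv_vec, OInfBasis.equivDecTree_gen T hk hT]

theorem degree_equivDecTree (x : OInfBasis c d) : (OInfBasis.equivDecTree x).degree = x.degree := by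
  rw [DecTree.degree, OInfBasis.degree, OInfBasis.numVerts_eq_numNodes]

/-- The bijection matches the vertices of constructs with those of decorated trees, so it preserves
the degrees of basis elements. -/
theorem mem_oInfGrading {p : ℤ} {x : (OInf 𝕜 s).Op c d} :
    x ∈ oInfGrading 𝕜 s k c d p ↔ oInfEquiv s σ k c d x ∈ decGrading σ k c d p := by
  have h : decGrading σ k c d p = Submodule.map (oInfEquiv s σ k c d).toLinearMap
      (oInfGrading 𝕜 s k c d p) := by
    refine Eq.trans ?_ (Submodule.map_span _ _).symm
    unfold decGrading
    congr 1
    ext z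
    constructor
    · rintro ⟨t, ht, rfl⟩
      refine ⟨(OInfBasis.equivDecTree.symm t).vec s, ⟨_, ?_, rfl⟩, ?_⟩
      · rw [← degree_equivDecTree, Equiv.apply_symm_apply, ht]
      · refine (oInfEquiv_vec _).trans ?_
        rw [Equiv.apply_symm_apply]
    · rintro ⟨_, ⟨x, hx, rfl⟩, rfl⟩
      exact ⟨OInfBasis.equivDecTree x, (degree_equivDecTree x).trans hx, oInfEquiv_vec x⟩
  rw [h]
  constructor
  · exact Submodule.mem_map_of_mem
  · rintro ⟨y, hy, hyx⟩
    exact (oInfEquiv s σ k c d).injective hyx ▸ hy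

/-- A space with basis `B` is the direct sum of the subspaces spanned by the elements of the
same degree. -/
theorem isInternal_span_degree {B : Type} (deg : B → ℤ) :
    DirectSum.IsInternal fun p => Submodule.span 𝕜
      {z : B →₀ 𝕜 | ∃ x : B, deg x = p ∧ z = Finsupp.single x 1} := by
  -- The homogeneous parts consist of the functions supported on the fibres of `deg`; independence
  -- and generation reduce to the fibres partitioning `B`.
  have h : ∀ p, Submodule.span 𝕜 {z : B →₀ 𝕜 | ∃ x : B, deg x = p ∧ z = Finsupp.single x 1} =
      Finsupp.supported 𝕜 𝕜 (deg ⁻¹' {p}) := by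
    intro p
    rw [Finsupp.supported_eq_span_single]
    congr 1
    ext z
    simp only [Set.mem_ofPred_eq, Set.mem_image, Set.mem_preimage, Set.mem_singleton_iff]
    exact ⟨fun ⟨x, hx, hz⟩ => ⟨x, hx, hz.symm⟩, fun ⟨x, hx, hz⟩ => ⟨x, hx, hz.symm⟩⟩
  simp only [h]
  rw [DirectSum.isInternal_submodule_iff_iSupIndep_and_iSup_eq_top]
  constructor
  · intro p
    have : (⨆ (q) (_ : q ≠ p), Finsupp.supported 𝕜 𝕜 (deg ⁻¹' {q})) ≤
        Finsupp.supported 𝕜 𝕜 (deg ⁻¹' {p}ᶜ) := by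
      refine iSup₂_le fun q hq => Finsupp.supported_mono ?_
      intro x hx
      simp only [Set.mem_preimage, Set.mem_singleton_iff, Set.mem_compl_iff] at hx ⊢
      rwa [hx]
    refine Disjoint.mono_right this (Finsupp.disjoint_supported_supported ?_)
    rw [Set.preimage_compl]
    exact disjoint_compl_right
  · rw [← Finsupp.supported_iUnion, eq_top_iff]
    intro x _
    rw [Finsupp.mem_supported]
    intro y _
    simp

end Basis

/-- The identity of the space of operations of the operad of decorated trees. -/
noncomputable def decEquiv (𝕜 : Type u) [Field 𝕜] (k : ℕ) (c : Fin k → ℕ+) (d : ℕ+) :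
    (decTreeOperad 𝕜).Op c d ≃ₗ[𝕜] (signedDecOperad 𝕜 (1 : 𝕜)).Op c d :=
  LinearEquiv.refl 𝕜 (DecTree c d →₀ 𝕜)

theorem decEquiv_isOperadHom :
    IsOperadHom (decTreeOperad 𝕜) (signedDecOperad 𝕜 (1 : 𝕜)) fun k c d => decEquiv 𝕜 k c d where
  equivariant _ _ _ _ := rfl
  map_one _ := rfl
  map_comp {k l r c b a d e} i he h x y := by
    have : (decTreeOperad 𝕜).comp (d := d) i he h =
        (signedDecOperad 𝕜 (1 : 𝕜)).comp (d := d) i he h := by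
      unfold decTreeOperad signedDecOperad
      simp only [one_pow]
    exact LinearMap.congr_fun₂ this x y

end OInfty

theorem theorem1 (𝕜 : Type u) [Field 𝕜] :
    OInfty.IsFreeOperadOn.{u, u, w} (OInfty.OInf 𝕜 (OInfty.noSigns 𝕜)) (OInfty.genCollection 𝕜)
      (OInfty.genIncl 𝕜 (OInfty.noSigns 𝕜)) ∧
    ∃ α : ∀ (k : ℕ) (c : Fin k → ℕ+) (d : ℕ+), OInfty.OInfBasis c d ≃ OInfty.DecTree c d,
      (∀ (k : ℕ) (c : Fin k → ℕ+) (d : ℕ+) (T : OInfty.OpTree c d) (hk : 2 ≤ k)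
        (hT : T.IsLeftRecursive),
        α k c d (OInfty.OInfBasis.gen T) = OInfty.DecTree.corolla T hk hT) ∧
      OInfty.IsOperadHom (OInfty.OInf 𝕜 (OInfty.noSigns 𝕜)) (OInfty.decTreeOperad 𝕜)
        (OInfty.linearExt 𝕜 α) ∧
      OInfty.IsFreeOperadOn.{u, u, w} (OInfty.decTreeOperad 𝕜) (OInfty.genCollection 𝕜)
        (fun k c d => OInfty.linearExt 𝕜 α k c d ∘ₗ
          OInfty.genIncl 𝕜 (OInfty.noSigns 𝕜) k c d) ∧
      OInfty.IsFreeGradedOperadOn.{u, u, w} (OInfty.OInf 𝕜 (OInfty.gradedSigns 𝕜 α))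
        (OInfty.oInfGrading 𝕜 (OInfty.gradedSigns 𝕜 α)) (OInfty.genCollection 𝕜)
        (OInfty.genGrading 𝕜) (OInfty.genIncl 𝕜 (OInfty.gradedSigns 𝕜 α)) := by
  open OInfty in
  have hE : IsOperadHom (OInf 𝕜 (noSigns 𝕜)) (signedDecOperad 𝕜 (1 : 𝕜))
      fun k c d => oInfEquiv (noSigns 𝕜) 1 k c d :=
    oInfEquiv_isOperadHom fun _ _ _ => (one_pow _).symm
  open OInfty in
  have hα : IsOperadHom (OInf 𝕜 (noSigns 𝕜)) (decTreeOperad 𝕜)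
      (linearExt 𝕜 fun k c d => OInfBasis.equivDecTree) :=
    decEquiv_isOperadHom.symm.comp hE
  refine ⟨OInfty.isFreeOperadOn_of_equiv hE (OInfty.genIncl_isEquivariant _)
    OInfty.oInfEquiv_genIncl, fun _ _ _ => OInfty.OInfBasis.equivDecTree,
    fun _ _ _ => OInfty.OInfBasis.equivDecTree_gen, hα, ?_, ?_⟩
  · refine OInfty.isFreeOperadOn_of_equiv OInfty.decEquiv_isOperadHom (fun c d κ x => ?_)
      OInfty.oInfEquiv_genIncl
    simp only [LinearMap.comp_apply]
    rw [OInfty.genIncl_isEquivariant, hα.equivariant]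
  -- For this bijection the graded signs are by definition those of the operad of decorated trees
  -- with `σ = -1`.
  · exact OInfty.isFreeGradedOperadOn_of_equiv (OInfty.oInfEquiv_isOperadHom fun _ _ _ => rfl)
      (OInfty.genIncl_isEquivariant _) OInfty.oInfEquiv_genIncl OInfty.mem_oInfGrading
      fun c d => OInfty.isInternal_span_degree _
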